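/- Let $g$ be a smooth Lorentzian metric of signature $(+,-,-,-)$ on a coordinate patch with coordinates $x^1,\dots,x^4$, let $(l,n,m,\bar m)$ be a smooth NP null tetrad for $g$ ($l\cdot n=1$, $m\cdot\bar m=-1$, all other products zero), and let $D,\Delta,\delta,\bar\delta$ be the derivatives along $l,n,m,\bar m$. Suppose that $g$ is everywhere of Petrov type I (the quartic $\Psi_0z^4+4\Psi_1z^3w+6\Psi_2z^2w^2+4\Psi_3zw^3+\Psi_4w^4$ is nonzero with four distinct roots $[z:w]$) and that the tetrad is in the canonical form $\Psi_1=\Psi_3=0$, $\Psi_0=\Psi_4$, $\Psi_2\neq0$. A smooth real vector field $\xi$ is called a (C)KV with conformal function $\varphi$ if $\pounds_\xi g=\varphi g$; it is a homothetic vector (HV) if $\varphi$ is constant and a Killing vector (KV) if $\varphi=0$. The NP scalars are the twelve spin coefficients and the Riemann tensor tetrad components, together with all combinations (smooth functions of finitely many) of these and their repeated NP derivatives. A scalar $\eta$ is Lie recurrent relative to $\xi$, with weight $w$, if $\pounds_\xi\eta=w\frac{\varphi}{2}\eta$. A combination is properly conformally weighted, of weight $w$, if it is multiplied by $\Omega^w$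 under $g\mapsto\Omega^2g$, $(l,n,m)\mapsto\Omega^{-1}(l,n,m)$, for every smooth positive function $\Omega$. Then a smooth vector field $\xi$ and a smooth function $\varphi$ satisfy $$[D,\pounds_\xi]x^i=\tfrac{\varphi}{2}Dx^i,\quad [\Delta,\pounds_\xi]x^i=\tfrac{\varphi}{2}\Delta x^i,\quad [\delta,\pounds_\xi]x^i=\tfrac{\varphi}{2}\delta x^i,\quad [\bar\delta,\pounds_\xi]x^i=\tfrac{\varphi}{2}\bar\delta x^i\qquad(i=1,\dots,4)$$ if and only if $\xi$ is a (C)KV with conformal function $\varphi$; so solving these equations for $\pounds_\xi x^i=\xi^i$ and $\varphi$ yields exactly all (C)KVs. Furthermore, wherever the combinations concerned are defined: (a) every properly conformally weighted combination of the NP scalars, of conformal weight $w$, is Lie recurrent with weight $w$ relative to each (C)KV; (b) every combination $\eta$ of the NP scalars satisfies $\pounds_\xi\eta=0$ for each KV $\xi$; and relative to each HV, every combination of the NP scalars that is multiplied by $\Omega^w$ under the above rescaling for all positive constants $\Omega$ is Lie recurrent with weight $w$. In particular, relative to each HV every $k$-fold NP derivative ($k\ge0$) of a spin coefficient is Lie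 recurrent with weight $-1-k$, and every $k$-fold NP derivative of a Riemann tensor tetrad component is Lie recurrent with weight $-2-k$. -/

import Mathlib

open scoped ContDiff ComplexConjugate

noncomputable section

namespace NewmanPenrose

/-- Points of a coordinate patch, labelled by the four real coordinates `x 0, …, x 3`. -/
abbrev Pt : Type := Fin 4 → ℝ

/-- Metric components `g_ij` as functions of the coordinates. -/
abbrev MetricField : Type := Pt → Matrix (Fin 4) (Fin 4) ℝ

/-- Partial derivative `∂_i f`. -/
def pd {F : Type*} [NormedAddCommGroup F] [NormedSpace ℝ F] (i : Fin 4) (f : Pt → F) (x : Pt) : F :=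
  fderiv ℝ f x (Pi.single i 1)

/-- Derivative `X f = X^i ∂_i f` of a complex scalar along a complex vector field. -/
def dirD (X : Pt → Fin 4 → ℂ) (f : Pt → ℂ) (x : Pt) : ℂ :=
  ∑ i, X x i * pd i f x

/-- Lie derivative `£_ξ f` of a complex scalar along a real vector field. -/
def lieD (ξ : Pt → Fin 4 → ℝ) (f : Pt → ℂ) (x : Pt) : ℂ :=
  dirD (fun y i => (ξ y i : ℂ)) f x

/-- The coordinate function `x^i`. -/
def coord (i : Fin 4) (x : Pt) : ℂ := (x i : ℂ)

/-! ### Levi-Civita connection and curvature in coordinates -/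

/-- Christoffel symbols `Γ^k_ij`. -/
def christoffel (g : MetricField) (k i j : Fin 4) (x : Pt) : ℝ :=
  (1 / 2) * ∑ s, (g x)⁻¹ k s *
    (pd i (fun y => g y j s) x + pd j (fun y => g y i s) x - pd s (fun y => g y i j) x)

/-- `R^k_lij = ∂_i Γ^k_jl - ∂_j Γ^k_il + Γ^k_is Γ^s_jl - Γ^k_js Γ^s_il`. -/
def riemannUp (g : MetricField) (k l i j : Fin 4) (x : Pt) : ℝ :=
  pd i (christoffel g k j l) x - pd j (christoffel g k i l) x
    + ∑ s, (christoffel g k i s x * christoffel g s j l x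
      - christoffel g k j s x * christoffel g s i l x)

/-- `R_klij = g_ks R^s_lij`. -/
def riemann (g : MetricField) (x : Pt) (k l i j : Fin 4) : ℝ :=
  ∑ s, g x k s * riemannUp g s l i j x

/-- `R_lj = R^k_lkj`. -/
def ricci (g : MetricField) (x : Pt) (l j : Fin 4) : ℝ :=
  ∑ k, riemannUp g k l k j x

/-- The curvature scalar `g^lj R_lj`. -/
def scalarCurv (g : MetricField) (x : Pt) : ℝ :=
  ∑ l, ∑ j, (g x)⁻¹ l j * ricci g x l j

/-- The Weyl tensor `C_abcd`. -/
def weyl (g : MetricField) (x : Pt) (a b c d : Fin 4) : ℝ :=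
  riemann g x a b c d
    - (1 / 2) * (g x a c * ricci g x b d - g x a d * ricci g x b c
        + g x b d * ricci g x a c - g x b c * ricci g x a d)
    + scalarCurv g x / 6 * (g x a c * g x b d - g x a d * g x b c)

/-- Full contraction of a covariant 4-tensor with four complex vectors. -/
def contract (R : Fin 4 → Fin 4 → Fin 4 → Fin 4 → ℝ) (X Y Z W : Fin 4 → ℂ) : ℂ :=
  ∑ a, ∑ b, ∑ c, ∑ d, (R a b c d : ℂ) * X a * Y b * Z c * W d

/-! ### Null tetrads -/

/-- The vectors `l, n` (real) and `m` (complex) of a tetrad at a point. -/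
structure Tetrad where
  l : Fin 4 → ℝ
  n : Fin 4 → ℝ
  m : Fin 4 → ℂ

/-- The tetrad as a complex frame `(l, n, m, m̄)`. -/
def Tetrad.frame (t : Tetrad) : Fin 4 → Fin 4 → ℂ :=
  ![fun i => (t.l i : ℂ), fun i => (t.n i : ℂ), t.m, fun i => conj (t.m i)]

/-- The inner products of `(l, n, m, m̄)`: `l·n = 1`, `m·m̄ = -1`, all others zero. -/
def nullProducts : Matrix (Fin 4) (Fin 4) ℂ :=
  !![0, 1, 0, 0; 1, 0, 0, 0; 0, 0, 0, -1; 0, 0, -1, 0]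

/-- `t` is a normalized null tetrad for the scalar product `G`. -/
def IsNullTetrad (G : Matrix (Fin 4) (Fin 4) ℝ) (t : Tetrad) : Prop :=
  ∀ a b, ∑ i, ∑ j, (G i j : ℂ) * t.frame a i * t.frame b j = nullProducts a b

/-- `g` is a smooth symmetric tensor on `U`, and `T` a smooth field of null tetrads for it. (The
existence of a null tetrad makes `g` nondegenerate of signature `(+,-,-,-)`.) -/
structure IsNPTetradOn (U : Set Pt) (g : MetricField) (T : Pt → Tetrad) : Prop where
  symm : ∀ x ∈ U, (g x).IsSymm
  smooth_g : ∀ i j, ContDiffOn ℝ ∞ (fun x => g x i j) U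
  smooth_l : ContDiffOn ℝ ∞ (fun x => (T x).l) U
  smooth_n : ContDiffOn ℝ ∞ (fun x => (T x).n) U
  smooth_m : ContDiffOn ℝ ∞ (fun x => (T x).m) U
  null : ∀ x ∈ U, IsNullTetrad (g x) (T x)

/-- The `a`-th NP derivative: `D, Δ, δ, δ̄` for `a = 0, 1, 2, 3`. -/
def npD (T : Pt → Tetrad) (a : Fin 4) (f : Pt → ℂ) : Pt → ℂ :=
  dirD (fun x => (T x).frame a) f

/-! ### Weyl scalars and Petrov type I -/

/-- `Ψ₀, …, Ψ₄` at the point `x` with respect to the tetrad `t` at `x`. -/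
def weylScalar (g : MetricField) (x : Pt) (t : Tetrad) : Fin 5 → ℂ :=
  let C := fun a b c d : Fin 4 =>
    contract (weyl g x) (t.frame a) (t.frame b) (t.frame c) (t.frame d)
  ![-C 0 2 0 2, -C 0 1 0 2, -C 0 2 3 1, -C 0 1 3 1, -C 1 3 1 3]

/-- The Weyl binary quartic `Ψ₀z⁴ + 4Ψ₁z³w + 6Ψ₂z²w² + 4Ψ₃zw³ + Ψ₄w⁴`, whose roots `[z : w]`
are the principal null directions. -/
def weylQuartic (Ψ : Fin 5 → ℂ) (z w : ℂ) : ℂ :=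
  Ψ 0 * z ^ 4 + 4 * Ψ 1 * z ^ 3 * w + 6 * Ψ 2 * z ^ 2 * w ^ 2 + 4 * Ψ 3 * z * w ^ 3 + Ψ 4 * w ^ 4

/-- Petrov type I at `x`: the Weyl quartic (of any null tetrad at `x`) is not zero and has four
distinct roots in the complex projective line. -/
def IsPetrovI (g : MetricField) (x : Pt) : Prop :=
  ∀ t : Tetrad, IsNullTetrad (g x) t →
    weylScalar g x t ≠ 0 ∧
    ∃ z w : Fin 4 → ℂ, (∀ i j, i ≠ j → z i * w j ≠ z j * w i) ∧
      ∀ i, weylQuartic (weylScalar g x t) (z i) (w i) = 0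

/-- The canonical form `Ψ₁ = Ψ₃ = 0`, `Ψ₀ = Ψ₄`, `Ψ₂ ≠ 0`. -/
def IsCanonicalI (g : MetricField) (x : Pt) (t : Tetrad) : Prop :=
  weylScalar g x t 1 = 0 ∧ weylScalar g x t 3 = 0 ∧
    weylScalar g x t 0 = weylScalar g x t 4 ∧ weylScalar g x t 2 ≠ 0

/-! ### (Conformal) Killing vectors and Lie recurrence -/

/-- `£_ξ g = φ g` on `U`: a Killing vector if `φ = 0`, a homothetic vector if `φ` is constant. -/
def IsConformalKilling (U : Set Pt) (g : MetricField) (ξ : Pt → Fin 4 → ℝ) (φ : Pt → ℝ) : Prop :=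
  ∀ x ∈ U, ∀ i j,
    ∑ k, (ξ x k * pd k (fun y => g y i j) x + g x k j * pd i (fun y => ξ y k) x
      + g x i k * pd j (fun y => ξ y k) x) = φ x * g x i j

/-- `(£_ξ - w φ / 2) f = 0` on `S`. -/
def LieRecurrentOn (S : Set Pt) (ξ : Pt → Fin 4 → ℝ) (φ : Pt → ℝ) (w : ℝ) (f : Pt → ℂ) : Prop :=
  ∀ x ∈ S, lieD ξ f x - (w : ℂ) * ((φ x : ℂ) / 2) * f x = 0

/-! ### NP scalars and their combinations -/

/-- With `e = (l, n, m, m̄)`: the rotation coefficient `(e_c)_{i;j} e_a^i e_b^j`. -/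
def rotCoef (g : MetricField) (T : Pt → Tetrad) (c a b : Fin 4) (x : Pt) : ℂ :=
  ∑ i, ∑ k, ∑ j, (g x i k : ℂ)
    * (pd j (fun y => (T y).frame c k) x
      + ∑ s, (christoffel g k j s x : ℂ) * (T x).frame c s)
    * (T x).frame a i * (T x).frame b j

/-- Names of the twelve NP spin coefficients. -/
inductive SpinCoef : Type
  | kappa | sigma | rho | tau | nu | lambda | mu | pi | epsilon | gamma | alpha | beta

/-- The values of the NP spin coefficients. -/
def SpinCoef.val (g : MetricField) (T : Pt → Tetrad) (x : Pt) : SpinCoef → ℂ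
  | kappa => rotCoef g T 0 2 0 x
  | rho => rotCoef g T 0 2 3 x
  | sigma => rotCoef g T 0 2 2 x
  | tau => rotCoef g T 0 2 1 x
  | pi => -rotCoef g T 1 3 0 x
  | lambda => -rotCoef g T 1 3 3 x
  | mu => -rotCoef g T 1 3 2 x
  | nu => -rotCoef g T 1 3 1 x
  | epsilon => (1 / 2) * (rotCoef g T 0 1 0 x - rotCoef g T 2 3 0 x)
  | alpha => (1 / 2) * (rotCoef g T 0 1 3 x - rotCoef g T 2 3 3 x)
  | beta => (1 / 2) * (rotCoef g T 0 1 2 x - rotCoef g T 2 3 2 x)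
  | gamma => (1 / 2) * (rotCoef g T 0 1 1 x - rotCoef g T 2 3 1 x)

/-- Combinations of NP scalars, as expressions: the spin coefficients, the Riemann tensor tetrad
components, NP derivatives of combinations, and smooth functions `F`, with open domain `O`, of
finitely many combinations (hence also constants, sums, products, quotients, roots and complex
conjugates, and so `Ψ_k`, `Φ_jk`, `Λ`, which are linear in the Riemann components). -/
inductive NPExpr : Type
  | spin (s : SpinCoef) : NPExpr
  | riem (a b c d : Fin 4) : NPExpr
  | der (a : Fin 4) (E : NPExpr) : NPExpr
  | comb (k : ℕ) (O : Set (Fin k → ℂ)) (F : (Fin k → ℂ) → ℂ) (hO : IsOpen O)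
      (hF : ContDiffOn ℝ ∞ F O) (E : Fin k → NPExpr) : NPExpr

/-- The scalar that an expression denotes for the metric `g` and the tetrad `T`. -/
def NPExpr.eval (g : MetricField) (T : Pt → Tetrad) : NPExpr → Pt → ℂ
  | spin s => fun x => s.val g T x
  | riem a b c d => fun x =>
      contract (riemann g x) ((T x).frame a) ((T x).frame b) ((T x).frame c) ((T x).frame d)
  | der a E => npD T a (E.eval g T)
  | comb _ _ F _ _ E => fun x => F fun i => (E i).eval g T x

/-- The expression is defined at `x`: each function in it is applied inside its domain. -/
def NPExpr.DefinedAt (g : MetricField) (T : Pt → Tetrad) (x : Pt) : NPExpr → Prop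
  | spin _ => True
  | riem _ _ _ _ => True
  | der _ E => E.DefinedAt g T x
  | comb _ O _ _ _ E => (∀ i, (E i).DefinedAt g T x) ∧ (fun i => (E i).eval g T x) ∈ O

/-- The points of `U` where the expression is defined. -/
def NPExpr.domain (U : Set Pt) (g : MetricField) (T : Pt → Tetrad) (E : NPExpr) : Set Pt :=
  {x ∈ U | E.DefinedAt g T x}

/-- Repeated NP derivatives of an expression. -/
def NPExpr.iterDer (as : List (Fin 4)) (E : NPExpr) : NPExpr :=
  as.foldr NPExpr.der E

/-- The conformally related metric `Ω² g`. -/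
def rescaleMetric (Ω : Pt → ℝ) (g : MetricField) : MetricField :=
  fun x => Ω x ^ 2 • g x

/-- The conformally related tetrad `Ω⁻¹ l, Ω⁻¹ n, Ω⁻¹ m`, which is a null tetrad for `Ω² g`. -/
def rescaleTetrad (Ω : Pt → ℝ) (T : Pt → Tetrad) : Pt → Tetrad :=
  fun x => ⟨(Ω x)⁻¹ • (T x).l, (Ω x)⁻¹ • (T x).n, (Ω x)⁻¹ • (T x).m⟩

/-- The value of `E` is multiplied by `Ω ^ w` under the conformal rescaling by `Ω`, wherever
it is defined both before and after. -/
def NPExpr.ScalesWith (U : Set Pt) (g : MetricField) (T : Pt → Tetrad) (E : NPExpr) (w : ℝ)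
    (Ω : Pt → ℝ) : Prop :=
  ∀ x ∈ E.domain U g T, x ∈ E.domain U (rescaleMetric Ω g) (rescaleTetrad Ω T) →
    E.eval (rescaleMetric Ω g) (rescaleTetrad Ω T) x = ((Ω x ^ w : ℝ) : ℂ) * E.eval g T x

/-- `E` is properly conformally weighted, of conformal weight `w`: it scales as `Ω ^ w` for all
smooth positive conformal factors `Ω`. -/
def NPExpr.HasConformalWeight (U : Set Pt) (g : MetricField) (T : Pt → Tetrad) (E : NPExpr)
    (w : ℝ) : Prop :=
  ∀ Ω : Pt → ℝ, ContDiffOn ℝ ∞ Ω U → (∀ x ∈ U, 0 < Ω x) → E.ScalesWith U g T w Ω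

/-- `E` has weight `w` relative to constant conformal rescalings. -/
def NPExpr.HasHomotheticWeight (U : Set Pt) (g : MetricField) (T : Pt → Tetrad) (E : NPExpr)
    (w : ℝ) : Prop :=
  ∀ c : ℝ, 0 < c → E.ScalesWith U g T w fun _ => c

end NewmanPenrose

end

/-!
The proof is infinitesimal. To a vector field `ξ` and a function `φ` belongs the one-parameter
family of metrics `Ω² g` and tetrads `Ω⁻¹ (l, n, m)` with `Ω = exp (t φ / 2)`, and on functions of
the parameter `t` and the point the operator `L = ∂_t - ξ^k ∂_k` at `t = 0` (`flowD ξ`). The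
conformal Killing equation says that `L g` is the pure Lie derivative term `g A + Aᵀ g`, where
`A^k_j = ∂_j ξ^k`, and the commutator equations say that `L e = -A e` for the matrix `e` of tetrad
vectors. Then `L` annihilates every scalar built naturally from `g` and `e`: the rotation
coefficients (`flowD_rotFrame`), the curvature components (`flowD_riemFrame`), and, by induction on
the expression, all combinations of them and of their NP derivatives (`flowD_evalFam`). If such a
scalar is multiplied by `Ω ^ w` along the family, then `L η = 0` reads `w (φ / 2) η = £_ξ η`
(`lieRecurrentOn_of_scalesWith`). For a Killing vector `Ω = 1`, and for a homothetic vector `Ω` is a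
constant for each `t`, so only weights under constant rescalings matter; those of derivatives of
spin coefficients and of curvature components are computed directly.

It remains to compare the two systems of equations. That the commutator equations imply the
conformal Killing equation follows by applying `L` to the constant products of the tetrad vectors
(`isConformalKilling_of_commutatorEqs`). For the converse
(`commutatorEqs_of_isConformalKilling`), apply `L` to the static family `g`, `e` of a conformal
Killing vector. Here `L e = -A e + e Mᵀ`, where the conformal Killing equation makes `M` an
infinitesimal rotation composed with a dilation. The variation of the curvature contains the second
covariant derivative of `φ`, but only through its Kulkarni-Nomizu product with the metric, which
does not contribute to the Weyl scalars. These therefore change linearly by the rotation and the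
dilation alone (`flowD_framePsi`, `framePsi_varTensor`). As `Ψ₁ = Ψ₃ = 0` and `Ψ₀ = Ψ₄`
everywhere, the variations of `Ψ₁`, `Ψ₃` and `Ψ₀ - Ψ₄` vanish. The four roots of the quartic being
distinct, `Ψ₀ ≠ 0` and `Ψ₀² ≠ 9 Ψ₂²` (`canonical_nondegenerate`), and the resulting linear equations
leave only `M = φ / 2`, which is the system of commutator equations.
-/

noncomputable section

namespace NewmanPenrose

open scoped Matrix
open Set

-- Any submultiplicative norm on matrices would do: it serves only to differentiate products.
attribute [local instance] Matrix.linftyOpNormedRing Matrix.linftyOpNormedAlgebra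

/-- Complex `4 × 4` matrices. -/
abbrev CMat : Type := Matrix (Fin 4) (Fin 4) ℂ

/-- Parameter value and point: the arguments of a one-parameter family of fields. -/
abbrev ParamPt : Type := ℝ × Pt

/-! ### Derivatives of one-parameter families of fields -/

section Calculus

variable {F : Type*} [NormedAddCommGroup F] [NormedSpace ℝ F]

/-- Partial derivative `∂_i` of a one-parameter family of fields, at fixed parameter. -/
def sd (i : Fin 4) (f : ParamPt → F) (p : ParamPt) : F :=
  fderiv ℝ f p (0, Pi.single i 1)

/-- The operator `∂_t - ξ^k ∂_k` at parameter value `t = 0`. -/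
def flowD (ξ : Pt → Fin 4 → ℝ) (f : ParamPt → F) (x : Pt) : F :=
  fderiv ℝ f (0, x) (1, -ξ x)

/-- The domain `ℝ × U` of a one-parameter family of fields on `U`. -/
abbrev cyl (U : Set Pt) : Set ParamPt := univ ×ˢ U

theorem isOpen_cyl {U : Set Pt} (hU : IsOpen U) : IsOpen (cyl U) := isOpen_univ.prod hU

theorem mem_cyl {U : Set Pt} {x : Pt} (hx : x ∈ U) (t : ℝ) : (t, x) ∈ cyl U := ⟨mem_univ _, hx⟩

theorem diffAt {E : Type*} [NormedAddCommGroup E] [NormedSpace ℝ E] {f : E → F} {W : Set E}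
    (hW : IsOpen W) (hf : ContDiffOn ℝ ∞ f W) {p : E} (hp : p ∈ W) : DifferentiableAt ℝ f p :=
  (hf.contDiffAt (hW.mem_nhds hp)).differentiableAt (by simp)

theorem pd_slice {f : ParamPt → F} {t : ℝ} {x : Pt} (hf : DifferentiableAt ℝ f (t, x))
    (i : Fin 4) : pd i (fun y => f (t, y)) x = sd i f (t, x) := by
  have h := hf.hasFDerivAt.comp x (hasFDerivAt_prodMk_right t x)
  have h' := h.fderiv
  simp only [Function.comp_def] at h'
  simp [pd, sd, h']

theorem contDiffOn_sd {f : ParamPt → F} {W : Set ParamPt} (hW : IsOpen W)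
    (hf : ContDiffOn ℝ ∞ f W) (i : Fin 4) : ContDiffOn ℝ ∞ (sd i f) W :=
  (hf.fderiv_of_isOpen hW (by simp)).clm_apply contDiffOn_const

theorem contDiffOn_pd {f : Pt → F} {U : Set Pt} (hU : IsOpen U)
    (hf : ContDiffOn ℝ ∞ f U) (i : Fin 4) : ContDiffOn ℝ ∞ (pd i f) U :=
  (hf.fderiv_of_isOpen hU (by simp)).clm_apply contDiffOn_const

theorem contDiffOn_slice {f : ParamPt → F} {U : Set Pt}
    (hf : ContDiffOn ℝ ∞ f (cyl U)) : ContDiffOn ℝ ∞ (fun y => f (0, y)) U :=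
  hf.comp (g := f) (f := fun y : Pt => ((0 : ℝ), y)) (by fun_prop) fun _ hx => mem_cyl hx 0

theorem contDiffOn_flowD {f : ParamPt → F} {U : Set Pt} (hU : IsOpen U)
    (hf : ContDiffOn ℝ ∞ f (cyl U)) {ξ : Pt → Fin 4 → ℝ} (hξ : ContDiffOn ℝ ∞ ξ U) :
    ContDiffOn ℝ ∞ (flowD ξ f) U :=
  (contDiffOn_slice (hf.fderiv_of_isOpen (isOpen_cyl hU) (by simp))).clm_apply
    (contDiffOn_const.prodMk hξ.neg)

theorem pd_congr {f g : Pt → F} {U : Set Pt} (hU : IsOpen U) (h : ∀ x ∈ U, f x = g x)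
    {x : Pt} (hx : x ∈ U) (i : Fin 4) : pd i f x = pd i g x := by
  unfold pd
  rw [Filter.EventuallyEq.fderiv_eq (Filter.eventually_of_mem (hU.mem_nhds hx) h)]

theorem flowD_congr {f g : ParamPt → F} {W : Set ParamPt} (hW : IsOpen W)
    (h : ∀ p ∈ W, f p = g p) {x : Pt} (hx : (0, x) ∈ W) (ξ : Pt → Fin 4 → ℝ) :
    flowD ξ f x = flowD ξ g x := by
  unfold flowD
  rw [Filter.EventuallyEq.fderiv_eq (Filter.eventually_of_mem (hW.mem_nhds hx) h)]

theorem sd_congr {f g : ParamPt → F} {W : Set ParamPt} (hW : IsOpen W)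
    (h : ∀ p ∈ W, f p = g p) {p : ParamPt} (hx : p ∈ W) (i : Fin 4) :
    sd i f p = sd i g p := by
  unfold sd
  rw [Filter.EventuallyEq.fderiv_eq (Filter.eventually_of_mem (hW.mem_nhds hx) h)]

/-- Second derivatives of a smooth function, one of them along a vector field. -/
theorem fderiv_fderiv_apply {E : Type*} [NormedAddCommGroup E] [NormedSpace ℝ E] {f : E → F}
    {W : Set E} (hW : IsOpen W) (hf : ContDiffOn ℝ ∞ f W) {p : E} (hp : p ∈ W) (u v : E) :
    fderiv ℝ (fun q => fderiv ℝ f q u) p v = fderiv ℝ (fun q => fderiv ℝ f q v) p u := by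
  have h1 : ContDiffOn ℝ ∞ (fderiv ℝ f) W := hf.fderiv_of_isOpen hW (by simp)
  have h2 := diffAt hW h1 hp
  have hs : IsSymmSndFDerivAt ℝ f p :=
    (hf.contDiffAt (hW.mem_nhds hp)).isSymmSndFDerivAt (by
      simpa using (WithTop.coe_le_coe.2 le_top : ((2 : ℕ∞) : WithTop ℕ∞) ≤ ((⊤ : ℕ∞) : WithTop ℕ∞)))
  rw [fderiv_clm_apply h2 (by fun_prop), fderiv_clm_apply h2 (by fun_prop)]
  simpa using hs v u

theorem pd_comm {f : Pt → F} {U : Set Pt} (hU : IsOpen U) (hf : ContDiffOn ℝ ∞ f U)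
    {x : Pt} (hx : x ∈ U) (i j : Fin 4) : pd i (pd j f) x = pd j (pd i f) x :=
  fderiv_fderiv_apply hU hf hx _ _

theorem sd_comm {f : ParamPt → F} {W : Set ParamPt} (hW : IsOpen W) (hf : ContDiffOn ℝ ∞ f W)
    {p : ParamPt} (hp : p ∈ W) (i j : Fin 4) : sd i (sd j f) p = sd j (sd i f) p :=
  fderiv_fderiv_apply hW hf hp _ _

theorem vec_eq_sum (v : Fin 4 → ℝ) : v = ∑ s, v s • (Pi.single s (1 : ℝ) : Fin 4 → ℝ) := by
  ext i
  simp [Finset.sum_apply, Pi.single_apply]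

theorem fderiv_vec {G : Pt → F} {x : Pt} (v : Fin 4 → ℝ) :
    fderiv ℝ G x v = ∑ s, v s • pd s G x := by
  conv_lhs => rw [vec_eq_sum v]
  simp [pd, map_sum]

theorem flowD_eq {f : ParamPt → F} {ξ : Pt → Fin 4 → ℝ} {x : Pt} :
    flowD ξ f x = fderiv ℝ f (0, x) (1, 0) - ∑ s, ξ x s • sd s f (0, x) := by
  have : ((1 : ℝ), -ξ x) = (1, 0) - ∑ s, ξ x s • ((0 : ℝ), (Pi.single s (1 : ℝ) : Fin 4 → ℝ)) := by
    refine Prod.ext ?_ ?_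
    · simp [Prod.fst_sum]
    · simp only [Prod.snd_sub, Prod.snd_sum, Prod.smul_snd]
      rw [← vec_eq_sum]; simp
  unfold flowD sd
  rw [this, map_sub, map_sum]
  simp only [map_smul]

/-- The operators `∂_t - ξ^k ∂_k` and `∂_i` have the commutator `(∂_i ξ^s) ∂_s`. -/
theorem flowD_sd {f : ParamPt → F} {W : Set ParamPt} (hW : IsOpen W)
    (hf : ContDiffOn ℝ ∞ f W) {U : Set Pt} (hU : IsOpen U) {ξ : Pt → Fin 4 → ℝ}
    (hξ : ContDiffOn ℝ ∞ ξ U) {x : Pt} (hx : x ∈ U) (hp : ((0 : ℝ), x) ∈ W) (i : Fin 4) :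
    flowD ξ (sd i f) x
      = pd i (flowD ξ f) x + ∑ s, pd i (fun y => ξ y s) x • sd s f (0, x) := by
  have h1 : ContDiffOn ℝ ∞ (fderiv ℝ f) W := hf.fderiv_of_isOpen hW (by simp)
  have h2 : DifferentiableAt ℝ (fun y => fderiv ℝ f ((0 : ℝ), y)) x :=
    (diffAt hW h1 hp).comp (g := fderiv ℝ f) (f := fun y : Pt => ((0 : ℝ), y)) x (by fun_prop)
  have hξ' := diffAt hU hξ hx
  have e0 : ∀ s, pd i (fun y => ξ y s) x = fderiv ℝ ξ x (Pi.single i 1) s := fun s => by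
    unfold pd
    have := (hasFDerivAt_pi'.1 hξ'.hasFDerivAt s).fderiv
    rw [this]; rfl
  have e1 : pd i (flowD ξ f) x = fderiv ℝ (fun q => fderiv ℝ f q (1, -ξ x)) (0, x)
      (0, Pi.single i 1) + fderiv ℝ f (0, x) (0, -fderiv ℝ ξ x (Pi.single i 1)) := by
    have h3 : pd i (fun y => fderiv ℝ f (0, y)) x = sd i (fderiv ℝ f) (0, x) :=
      pd_slice (diffAt hW h1 hp) i
    have hv : HasFDerivAt (fun y => ((1 : ℝ), -ξ y))
        ((0 : Pt →L[ℝ] ℝ).prod (-fderiv ℝ ξ x)) x :=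
      (hasFDerivAt_const (1 : ℝ) x).prodMk hξ'.hasFDerivAt.neg
    unfold pd flowD
    rw [fderiv_clm_apply h2 hv.differentiableAt, hv.fderiv,
      fderiv_clm_apply (diffAt hW h1 hp) (by fun_prop)]
    unfold pd sd at h3
    simp [h3, add_comm]
  have e2 : ∀ v : Fin 4 → ℝ, fderiv ℝ f (0, x) (0, -v) = - ∑ s, v s • sd s f (0, x) := by
    intro v
    have := flowD_eq (f := f) (ξ := fun _ => v) (x := x)
    have h4 : fderiv ℝ f (0, x) (1, -v)
        = fderiv ℝ f (0, x) (1, 0) + fderiv ℝ f (0, x) (0, -v) := by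
      rw [← map_add]; simp
    rw [flowD, h4, sub_eq_add_neg] at this
    exact add_left_cancel this
  rw [e1, e2]
  simp only [e0]
  rw [neg_add_cancel_right]
  exact fderiv_fderiv_apply hW hf hp _ _

end Calculus

/-! ### Product rules for matrix-valued fields -/

section MatrixCalculus

variable {E : Type*} [NormedAddCommGroup E] [NormedSpace ℝ E]

/-- A matrix entry as a continuous linear functional. -/
def entryCLM (k j : Fin 4) : CMat →L[ℝ] ℂ :=
  (Matrix.entryLinearMap ℝ ℂ k j).toContinuousLinearMap

/-- Transposition as a continuous linear map. -/
def transposeCLM : CMat →L[ℝ] CMat :=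
  (Matrix.transposeLinearEquiv (Fin 4) (Fin 4) ℝ ℂ).toLinearMap.toContinuousLinearMap

/-- The directional derivative of `f` at `p` along `v`. -/
def dd {F : Type*} [NormedAddCommGroup F] [NormedSpace ℝ F] (f : E → F) (p v : E) : F :=
  fderiv ℝ f p v

theorem dd_of_hasFDerivAt {F : Type*} [NormedAddCommGroup F] [NormedSpace ℝ F] {f : E → F}
    {f' : E →L[ℝ] F} {p : E} (h : HasFDerivAt f f' p) (v : E) : dd f p v = f' v := by
  rw [dd, h.fderiv]

theorem dd_clm_comp {F G : Type*} [NormedAddCommGroup F] [NormedSpace ℝ F] [NormedAddCommGroup G]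
    [NormedSpace ℝ G] (T : F →L[ℝ] G) {f : E → F} {p : E} (hf : DifferentiableAt ℝ f p) (v : E) :
    dd (fun q => T (f q)) p v = T (dd f p v) :=
  dd_of_hasFDerivAt (T.hasFDerivAt.comp p hf.hasFDerivAt) v

theorem dd_entry {f : E → CMat} {p : E} (hf : DifferentiableAt ℝ f p) (v : E) (k j : Fin 4) :
    dd (fun q => f q k j) p v = dd f p v k j := dd_clm_comp (entryCLM k j) hf v

theorem dd_transpose {f : E → CMat} {p : E} (hf : DifferentiableAt ℝ f p) (v : E) :
    dd (fun q => (f q)ᵀ) p v = (dd f p v)ᵀ := dd_clm_comp transposeCLM hf v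

theorem dd_mul {A : Type*} [NormedRing A] [NormedAlgebra ℝ A] {f g : E → A} {p : E}
    (hf : DifferentiableAt ℝ f p) (hg : DifferentiableAt ℝ g p) (v : E) :
    dd (fun q => f q * g q) p v = dd f p v * g p + f p * dd g p v := by
  refine (dd_of_hasFDerivAt (hf.hasFDerivAt.mul' hg.hasFDerivAt) v).trans ?_
  simp [dd, add_comm]

theorem dd_add {F : Type*} [NormedAddCommGroup F] [NormedSpace ℝ F] {f g : E → F} {p : E}
    (hf : DifferentiableAt ℝ f p) (hg : DifferentiableAt ℝ g p) (v : E) :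
    dd (fun q => f q + g q) p v = dd f p v + dd g p v :=
  dd_of_hasFDerivAt (hf.hasFDerivAt.add hg.hasFDerivAt) v

theorem dd_sub {F : Type*} [NormedAddCommGroup F] [NormedSpace ℝ F] {f g : E → F} {p : E}
    (hf : DifferentiableAt ℝ f p) (hg : DifferentiableAt ℝ g p) (v : E) :
    dd (fun q => f q - g q) p v = dd f p v - dd g p v :=
  dd_of_hasFDerivAt (hf.hasFDerivAt.sub hg.hasFDerivAt) v

theorem dd_sum {ι F : Type*} [NormedAddCommGroup F] [NormedSpace ℝ F] {s : Finset ι}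
    {f : ι → E → F} {p : E} (hf : ∀ i ∈ s, DifferentiableAt ℝ (f i) p) (v : E) :
    dd (fun q => ∑ i ∈ s, f i q) p v = ∑ i ∈ s, dd (f i) p v := by
  refine (dd_of_hasFDerivAt (HasFDerivAt.fun_sum fun i hi => (hf i hi).hasFDerivAt) v).trans ?_
  simp [dd]

theorem dd_const_mul (c : ℂ) {f : E → ℂ} {p : E} (hf : DifferentiableAt ℝ f p) (v : E) :
    dd (fun q => c * f q) p v = c * dd f p v :=
  dd_of_hasFDerivAt (hf.hasFDerivAt.const_mul c) v

theorem dd_smul {f : E → ℂ} {g : E → CMat} {p : E}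
    (hf : DifferentiableAt ℝ f p) (hg : DifferentiableAt ℝ g p) (v : E) :
    dd (fun q => f q • g q) p v = dd f p v • g p + f p • dd g p v := by
  ext k j
  have h : DifferentiableAt ℝ (fun q => f q • g q) p := hf.smul hg
  rw [← dd_entry h]
  have h2 := dd_mul hf ((entryCLM k j).differentiableAt.comp p hg) v
  have h3 := dd_clm_comp (entryCLM k j) hg v
  exact h2.trans (congrArg (fun z => dd f p v * g p k j + f p * z) h3)

theorem contDiffOn_entry {f : E → CMat} {W : Set E} (hf : ContDiffOn ℝ ∞ f W) (k j : Fin 4) :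
    ContDiffOn ℝ ∞ (fun q => f q k j) W :=
  (entryCLM k j).contDiff.comp_contDiffOn hf

theorem contDiffOn_transpose {f : E → CMat} {W : Set E} (hf : ContDiffOn ℝ ∞ f W) :
    ContDiffOn ℝ ∞ (fun q => (f q)ᵀ) W :=
  transposeCLM.contDiff.comp_contDiffOn hf

theorem contDiffOn_matrix {f : E → CMat} {W : Set E}
    (hf : ∀ k j, ContDiffOn ℝ ∞ (fun q => f q k j) W) : ContDiffOn ℝ ∞ f W := by
  have : f = fun q => ∑ k, ∑ j, f q k j • (Matrix.single k j 1 : CMat) := by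
    funext q
    conv_lhs => rw [Matrix.matrix_eq_sum_single (f q)]
    simp
  rw [this]
  exact ContDiffOn.sum fun k _ => ContDiffOn.sum fun j _ => (hf k j).smul contDiffOn_const

theorem contDiffOn_mul {f g : E → CMat} {W : Set E} (hf : ContDiffOn ℝ ∞ f W)
    (hg : ContDiffOn ℝ ∞ g W) : ContDiffOn ℝ ∞ (fun q => f q * g q) W := hf.mul hg

/-- The matrix `A^k_j = ∂_j ξ^k`. -/
def jac (ξ : Pt → Fin 4 → ℝ) (x : Pt) : CMat :=
  Matrix.of fun k j => ((pd j (fun y => ξ y k) x : ℝ) : ℂ)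

theorem ofReal_pd {f : Pt → ℝ} {x : Pt} (hf : DifferentiableAt ℝ f x) (i : Fin 4) :
    pd i (fun y => (f y : ℂ)) x = ((pd i f x : ℝ) : ℂ) := by
  exact dd_clm_comp Complex.ofRealCLM hf _

theorem contDiffOn_ofReal {f : E → ℝ} {W : Set E} (hf : ContDiffOn ℝ ∞ f W) :
    ContDiffOn ℝ ∞ (fun y => (f y : ℂ)) W :=
  Complex.ofRealCLM.contDiff.comp_contDiffOn hf

theorem contDiffOn_jac {ξ : Pt → Fin 4 → ℝ} {U : Set Pt} (hU : IsOpen U)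
    (hξ : ContDiffOn ℝ ∞ ξ U) : ContDiffOn ℝ ∞ (jac ξ) U :=
  contDiffOn_matrix fun k j =>
    contDiffOn_ofReal (contDiffOn_pd hU (contDiffOn_pi.1 hξ k) j)

theorem pd_jac_symm {ξ : Pt → Fin 4 → ℝ} {U : Set Pt} (hU : IsOpen U)
    (hξ : ContDiffOn ℝ ∞ ξ U) {x : Pt} (hx : x ∈ U) (i k j : Fin 4) :
    pd i (jac ξ) x k j = pd j (jac ξ) x k i := by
  have hk := contDiffOn_pi.1 hξ k
  have h : ∀ i j, pd i (jac ξ) x k j = ((pd i (pd j fun y => ξ y k) x : ℝ) : ℂ) := fun i j => by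
    have h1 := dd_entry (diffAt hU (contDiffOn_jac hU hξ) hx) (Pi.single i 1) k j
    exact h1.symm.trans <| ofReal_pd (diffAt hU (contDiffOn_pd hU hk j) hx) i
  rw [h, h, pd_comm hU hk hx]

theorem flowD_sd_jac {f : ParamPt → CMat} {U : Set Pt} (hU : IsOpen U)
    (hf : ContDiffOn ℝ ∞ f (cyl U)) {ξ : Pt → Fin 4 → ℝ} (hξ : ContDiffOn ℝ ∞ ξ U) {x : Pt}
    (hx : x ∈ U) (i : Fin 4) :
    flowD ξ (sd i f) x = pd i (flowD ξ f) x + ∑ s, jac ξ x s i • sd s f (0, x) := by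
  rw [flowD_sd (isOpen_cyl hU) hf hU hξ hx (mem_cyl hx 0)]
  simp [jac]

end MatrixCalculus

/-! ### Variation of the Levi-Civita connection -/

section Connection

/-- `Γ` is a family of symmetric connections, `(Γ i)_{kj} = Γ^k_ij`, compatible with the family `g`
of symmetric tensors. -/
structure IsLeviCivitaOn (U : Set Pt) (g : ParamPt → CMat) (Γ : Fin 4 → ParamPt → CMat) :
    Prop where
  smooth_g : ContDiffOn ℝ ∞ g (cyl U)
  smooth_conn : ∀ i, ContDiffOn ℝ ∞ (Γ i) (cyl U)
  symm : ∀ p ∈ cyl U, (g p)ᵀ = g p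
  compat : ∀ p ∈ cyl U, ∀ i, sd i g p = g p * Γ i p + (Γ i p)ᵀ * g p
  torsion : ∀ p ∈ cyl U, ∀ i j k, Γ i p k j = Γ j p k i

/-- The difference between `(∂_t - ξ^k ∂_k) Γ_i` and the Lie derivative terms that the
coordinate dependence of a connection produces. -/
def connVar (ξ : Pt → Fin 4 → ℝ) (Γ : Fin 4 → ParamPt → CMat) (i : Fin 4) (x : Pt) : CMat :=
  flowD ξ (Γ i) x - (Γ i (0, x) * jac ξ x - jac ξ x * Γ i (0, x)
    + ∑ s, jac ξ x s i • Γ s (0, x) + pd i (jac ξ) x)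

/-- The curvature matrices `(R_ij)^k_l = R^k_lij` of a connection. -/
def curv (Γ : Fin 4 → ParamPt → CMat) (i j : Fin 4) (p : ParamPt) : CMat :=
  sd i (Γ j) p - sd j (Γ i) p + Γ i p * Γ j p - Γ j p * Γ i p

variable {U : Set Pt} {g : ParamPt → CMat} {Γ : Fin 4 → ParamPt → CMat} {ξ : Pt → Fin 4 → ℝ}
  {h : Pt → ℂ}

theorem contDiffOn_curv (hU : IsOpen U) (hΓ : IsLeviCivitaOn U g Γ) (i j : Fin 4) :
    ContDiffOn ℝ ∞ (curv Γ i j) (cyl U) := by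
  have hW := isOpen_cyl hU
  have s := hΓ.smooth_conn
  exact (((contDiffOn_sd hW (s j) i).sub (contDiffOn_sd hW (s i) j)).add
    ((s i).mul (s j))).sub ((s j).mul (s i))

theorem contDiffOn_connVar (hU : IsOpen U) (hΓ : IsLeviCivitaOn U g Γ)
    (hξ : ContDiffOn ℝ ∞ ξ U) (i : Fin 4) : ContDiffOn ℝ ∞ (connVar ξ Γ i) U := by
  have s := fun i => contDiffOn_slice (hΓ.smooth_conn i)
  have hA := contDiffOn_jac hU hξ
  refine (contDiffOn_flowD hU (hΓ.smooth_conn i) hξ).sub (((((s i).mul hA).sub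
    (hA.mul (s i))).add (ContDiffOn.sum fun k _ => ?_)).add (contDiffOn_pd hU hA i))
  exact (contDiffOn_entry hA k i).smul (s k)

/-- The variation of the connection is compatible with the variation of the metric: the equation
`∂ g = g Γ + Γᵀ g` after applying `∂_t - ξ^k ∂_k`, without the Lie derivative terms, which cancel. -/
theorem connVar_compat (hU : IsOpen U) (hΓ : IsLeviCivitaOn U g Γ) (hξ : ContDiffOn ℝ ∞ ξ U)
    (hh : ContDiffOn ℝ ∞ h U)
    (hg : ∀ x ∈ U, flowD ξ g x = g (0, x) * jac ξ x + (jac ξ x)ᵀ * g (0, x) + h x • g (0, x))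
    {x : Pt} (hx : x ∈ U) (i : Fin 4) :
    g (0, x) * connVar ξ Γ i x + (connVar ξ Γ i x)ᵀ * g (0, x) = pd i h x • g (0, x) := by
  have hW := isOpen_cyl hU
  have hp := mem_cyl hx 0
  have dg := diffAt hW hΓ.smooth_g hp
  have dΓ := fun i => diffAt hW (hΓ.smooth_conn i) hp
  have sg := contDiffOn_slice hΓ.smooth_g
  have dg0 := diffAt hU sg hx
  have hA := contDiffOn_jac hU hξ
  have dA := diffAt hU hA hx
  have dh := diffAt hU hh hx
  have dAT := diffAt hU (contDiffOn_transpose hA) hx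
  have dΓT := diffAt hW (contDiffOn_transpose (hΓ.smooth_conn i)) hp
  have e1 : flowD ξ (sd i g) x = flowD ξ g x * Γ i (0, x) + g (0, x) * flowD ξ (Γ i) x
      + ((flowD ξ (Γ i) x)ᵀ * g (0, x) + (Γ i (0, x))ᵀ * flowD ξ g x) := by
    rw [flowD_congr hW (fun p hp => hΓ.compat p hp i) hp]
    refine (dd_add (dg.mul (dΓ i)) (dΓT.mul dg) _).trans ?_
    refine congrArg₂ (· + ·) (dd_mul dg (dΓ i) _) ((dd_mul dΓT dg _).trans ?_)
    rw [dd_transpose (dΓ i)]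
    rfl
  have e2 : pd i (flowD ξ g) x = sd i g (0, x) * jac ξ x + g (0, x) * pd i (jac ξ) x
      + ((pd i (jac ξ) x)ᵀ * g (0, x) + (jac ξ x)ᵀ * sd i g (0, x))
      + (pd i h x • g (0, x) + h x • sd i g (0, x)) := by
    rw [pd_congr hU hg hx, ← pd_slice dg i]
    refine (dd_add ((dg0.mul dA).add (dAT.mul dg0)) (dh.smul dg0) _).trans ?_
    refine congrArg₂ (· + ·) ((dd_add (dg0.mul dA) (dAT.mul dg0) _).trans ?_) (dd_smul dh dg0 _)
    refine congrArg₂ (· + ·) (dd_mul dg0 dA _) ((dd_mul dAT dg0 _).trans ?_)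
    rw [dd_transpose dA]
    rfl
  have e3 := flowD_sd_jac hU hΓ.smooth_g hξ hx i
  rw [e1, e2, hg x hx] at e3
  simp only [hΓ.compat _ hp] at e3
  simp only [connVar, Matrix.transpose_sub, Matrix.transpose_add, Matrix.transpose_mul,
    Matrix.transpose_sum, Matrix.transpose_smul, mul_sub, mul_add, sub_mul, add_mul,
    Finset.mul_sum, Finset.sum_mul, Matrix.mul_smul, Matrix.smul_mul, smul_add,
    Finset.sum_add_distrib, mul_assoc] at e3 ⊢
  rw [← sub_eq_zero] at e3 ⊢
  rw [← e3]
  abel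

theorem connVar_symm (hU : IsOpen U) (hΓ : IsLeviCivitaOn U g Γ) (hξ : ContDiffOn ℝ ∞ ξ U)
    {x : Pt} (hx : x ∈ U) (i j k : Fin 4) : connVar ξ Γ i x k j = connVar ξ Γ j x k i := by
  have hW := isOpen_cyl hU
  have hp := mem_cyl hx 0
  have t := hΓ.torsion _ hp
  have e1 : flowD ξ (Γ i) x k j = flowD ξ (Γ j) x k i := by
    refine (dd_entry (diffAt hW (hΓ.smooth_conn i) hp) _ k j).symm.trans
      (Eq.trans ?_ (dd_entry (diffAt hW (hΓ.smooth_conn j) hp) _ k i))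
    exact flowD_congr hW (fun p hp => hΓ.torsion p hp i j k) hp ξ
  simp only [connVar, Matrix.sub_apply, Matrix.add_apply, Matrix.mul_apply, Matrix.sum_apply,
    Matrix.smul_apply, smul_eq_mul]
  rw [e1, pd_jac_symm hU hξ hx i k j]
  have e2 : ∀ s, Γ i (0, x) s j = Γ j (0, x) s i := fun s => t i j s
  have e3 : ∀ s, Γ s (0, x) k i = Γ i (0, x) k s := fun s => t s i k
  have e4 : ∀ s, Γ s (0, x) k j = Γ j (0, x) k s := fun s => t s j k
  simp only [e2, e3, e4, mul_comm (jac ξ x _ _)]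
  ring

/-- The variation of the Levi-Civita connection under a conformal variation of the metric. -/
theorem lower_connVar (hU : IsOpen U) (hΓ : IsLeviCivitaOn U g Γ) (hξ : ContDiffOn ℝ ∞ ξ U)
    (hh : ContDiffOn ℝ ∞ h U)
    (hg : ∀ x ∈ U, flowD ξ g x = g (0, x) * jac ξ x + (jac ξ x)ᵀ * g (0, x) + h x • g (0, x))
    {x : Pt} (hx : x ∈ U) (i k j : Fin 4) :
    (g (0, x) * connVar ξ Γ i x) k j = (1 / 2) * (pd i h x * g (0, x) k j
      + pd j h x * g (0, x) k i - pd k h x * g (0, x) i j) := by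
  have c : ∀ i k j, (g (0, x) * connVar ξ Γ i x) k j + (g (0, x) * connVar ξ Γ i x) j k
      = pd i h x * g (0, x) k j := by
    intro i k j
    have := congrFun (congrFun (connVar_compat hU hΓ hξ hh hg hx i) k) j
    have e : (connVar ξ Γ i x)ᵀ * g (0, x) = (g (0, x) * connVar ξ Γ i x)ᵀ := by
      rw [Matrix.transpose_mul, hΓ.symm _ (mem_cyl hx 0)]
    rw [e] at this
    exact this
  have s : ∀ i k j, (g (0, x) * connVar ξ Γ i x) k j = (g (0, x) * connVar ξ Γ j x) k i := by
    intro i k j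
    simp only [Matrix.mul_apply, connVar_symm hU hΓ hξ hx i j]
  -- the cyclic combination of the compatibility equations that determines a symmetric connection
  linear_combination (1 / 2) * (c i k j + c j k i - c k i j) - (1 / 2) * s j k i
    - (1 / 2) * s i j k + (1 / 2) * s k i j

end Connection

/-! ### Variation of the curvature -/

section Curvature
variable {U : Set Pt} {g : ParamPt → CMat} {Γ : Fin 4 → ParamPt → CMat} {ξ : Pt → Fin 4 → ℝ}
  {h : Pt → ℂ}

/-- The covariant derivative `∇_i X_j`, without the terms symmetric in `i, j`, of the tensor
by which a connection varies. -/
def covVar (ξ : Pt → Fin 4 → ℝ) (Γ : Fin 4 → ParamPt → CMat) (i j : Fin 4) (x : Pt) : CMat :=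
  pd i (connVar ξ Γ j) x + Γ i (0, x) * connVar ξ Γ j x - connVar ξ Γ j x * Γ i (0, x)

theorem pd_flowD_conn (hU : IsOpen U) (hΓ : IsLeviCivitaOn U g Γ) (hξ : ContDiffOn ℝ ∞ ξ U)
    {x : Pt} (hx : x ∈ U) (i j : Fin 4) :
    pd i (flowD ξ (Γ j)) x = pd i (connVar ξ Γ j) x
      + (sd i (Γ j) (0, x) * jac ξ x + Γ j (0, x) * pd i (jac ξ) x
        - (pd i (jac ξ) x * Γ j (0, x) + jac ξ x * sd i (Γ j) (0, x))
        + ∑ s, (pd i (jac ξ) x s j • Γ s (0, x) + jac ξ x s j • sd i (Γ s) (0, x))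
        + pd i (pd j (jac ξ)) x) := by
  have hA := contDiffOn_jac hU hξ
  have dA := diffAt hU hA hx
  have sΓ := fun k => contDiffOn_slice (hΓ.smooth_conn k)
  have dΓ := fun k => diffAt hU (sΓ k) hx
  have dX := diffAt hU (contDiffOn_connVar hU hΓ hξ j) hx
  have dpA := diffAt hU (contDiffOn_pd hU hA j) hx
  have dAe := fun s => diffAt hU (contDiffOn_entry hA s j) hx
  have e : flowD ξ (Γ j) = fun y => connVar ξ Γ j y + (Γ j (0, y) * jac ξ y
      - jac ξ y * Γ j (0, y) + ∑ s, jac ξ y s j • Γ s (0, y) + pd j (jac ξ) y) := by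
    funext y; simp only [connVar, sub_add_cancel]
  have sl : ∀ k, sd i (Γ k) (0, x) = dd (fun y => Γ k (0, y)) x (Pi.single i 1) := fun k =>
    (pd_slice (diffAt (isOpen_cyl hU) (hΓ.smooth_conn k) (mem_cyl hx 0)) i).symm
  rw [e]
  simp only [sl]
  have dS : ∀ s, DifferentiableAt ℝ (fun y => jac ξ y s j • Γ s (0, y)) x := fun s =>
    (dAe s).smul (dΓ s)
  have dSum : DifferentiableAt ℝ (fun y => ∑ s, jac ξ y s j • Γ s (0, y)) x :=
    DifferentiableAt.fun_sum fun s _ => dS s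
  have d1 := (dΓ j).mul dA
  have d2 := dA.mul (dΓ j)
  refine (dd_add dX (((d1.sub d2).add dSum).add dpA) _).trans (congrArg₂ (· + ·) rfl ?_)
  refine (dd_add ((d1.sub d2).add dSum) dpA _).trans (congrArg₂ (· + ·) ?_ rfl)
  refine (dd_add (d1.sub d2) dSum _).trans (congrArg₂ (· + ·) ?_ ?_)
  · exact (dd_sub d1 d2 _).trans (congrArg₂ (· - ·) (dd_mul (dΓ j) dA _) (dd_mul dA (dΓ j) _))
  · refine (dd_sum (fun s _ => dS s) _).trans (Finset.sum_congr rfl fun s _ => ?_)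
    refine (dd_smul (dAe s) (dΓ s) _).trans ?_
    rw [dd_entry dA]
    rfl

/-- The variation of the curvature: Lie derivative terms, and the antisymmetrized covariant
derivative of the variation of the connection. -/
theorem flowD_curv (hU : IsOpen U) (hΓ : IsLeviCivitaOn U g Γ) (hξ : ContDiffOn ℝ ∞ ξ U)
    {x : Pt} (hx : x ∈ U) (i j : Fin 4) :
    flowD ξ (curv Γ i j) x = curv Γ i j (0, x) * jac ξ x - jac ξ x * curv Γ i j (0, x)
      + ∑ s, jac ξ x s i • curv Γ s j (0, x) + ∑ s, jac ξ x s j • curv Γ i s (0, x)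
      + (covVar ξ Γ i j x - covVar ξ Γ j i x) := by
  have hW := isOpen_cyl hU
  have hp := mem_cyl hx 0
  have sΓ := hΓ.smooth_conn
  have dΓ := fun k => diffAt hW (sΓ k) hp
  have dsΓ := fun i k => diffAt hW (contDiffOn_sd hW (sΓ k) i) hp
  have e1 : flowD ξ (curv Γ i j) x = flowD ξ (sd i (Γ j)) x - flowD ξ (sd j (Γ i)) x
      + (flowD ξ (Γ i) x * Γ j (0, x) + Γ i (0, x) * flowD ξ (Γ j) x)
      - (flowD ξ (Γ j) x * Γ i (0, x) + Γ j (0, x) * flowD ξ (Γ i) x) := by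
    have d1 := (dΓ i).mul (dΓ j)
    have d2 := (dΓ j).mul (dΓ i)
    have d3 := (dsΓ i j).sub (dsΓ j i)
    refine (dd_sub (d3.add d1) d2 _).trans (congrArg₂ (· - ·) ?_ (dd_mul (dΓ j) (dΓ i) _))
    exact (dd_add d3 d1 _).trans (congrArg₂ (· + ·) (dd_sub (dsΓ i j) (dsΓ j i) _)
      (dd_mul (dΓ i) (dΓ j) _))
  have e2 : ∀ k, flowD ξ (Γ k) x = connVar ξ Γ k x + (Γ k (0, x) * jac ξ x
      - jac ξ x * Γ k (0, x) + ∑ s, jac ξ x s k • Γ s (0, x) + pd k (jac ξ) x) := by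
    intro k; simp only [connVar, sub_add_cancel]
  rw [e1, flowD_sd_jac hU (sΓ j) hξ hx, flowD_sd_jac hU (sΓ i) hξ hx,
    pd_flowD_conn hU hΓ hξ hx, pd_flowD_conn hU hΓ hξ hx, e2, e2,
    pd_comm hU (contDiffOn_jac hU hξ) hx i j]
  simp only [pd_jac_symm hU hξ hx i _ j]
  simp only [curv, covVar, mul_sub, mul_add, sub_mul, add_mul,
    Finset.mul_sum, Finset.sum_mul, Matrix.mul_smul, Matrix.smul_mul, smul_add, smul_sub,
    Finset.sum_add_distrib, Finset.sum_sub_distrib, mul_assoc]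
  abel

/-- The second covariant derivative of `h`. -/
def hessian (Γ : Fin 4 → ParamPt → CMat) (h : Pt → ℂ) (x : Pt) (i l : Fin 4) : ℂ :=
  pd i (pd l h) x - ∑ s, Γ i (0, x) s l * pd s h x

/-- The lowered covariant derivative of the variation of the connection. The right-hand side is the
derivative of `lower_connVar`; its terms symmetric in `i, j` drop out of the curvature. -/
theorem lower_covVar (hU : IsOpen U) (hΓ : IsLeviCivitaOn U g Γ) (hξ : ContDiffOn ℝ ∞ ξ U)
    (hh : ContDiffOn ℝ ∞ h U)
    (hg : ∀ x ∈ U, flowD ξ g x = g (0, x) * jac ξ x + (jac ξ x)ᵀ * g (0, x) + h x • g (0, x))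
    {x : Pt} (hx : x ∈ U) (i j k l : Fin 4) :
    (g (0, x) * covVar ξ Γ i j x) k l = (1 / 2) * (pd i (pd j h) x * g (0, x) k l
      + hessian Γ h x i l * g (0, x) k j - hessian Γ h x i k * g (0, x) j l
      + pd l h x * (∑ s, g (0, x) k s * Γ i (0, x) s j)
      - pd k h x * (∑ s, Γ i (0, x) s j * g (0, x) s l)) := by
  have hW := isOpen_cyl hU
  have hp := mem_cyl hx 0
  have sg := contDiffOn_slice hΓ.smooth_g
  have dg := diffAt hU sg hx
  have sX := contDiffOn_connVar hU hΓ hξ j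
  have dX := diffAt hU sX hx
  have dh := fun l => diffAt hU (contDiffOn_pd hU hh l) hx
  have dge := fun k l => diffAt hU (contDiffOn_entry sg k l) hx
  have e0 : pd i (fun y => g (0, y)) x = g (0, x) * Γ i (0, x) + (Γ i (0, x))ᵀ * g (0, x) := by
    rw [pd_slice (diffAt hW hΓ.smooth_g hp), hΓ.compat _ hp]
  have e1 : pd i (fun y => g (0, y) * connVar ξ Γ j y) x = pd i (fun y => g (0, y)) x
      * connVar ξ Γ j x + g (0, x) * pd i (connVar ξ Γ j) x := dd_mul dg dX _
  have e2 : g (0, x) * covVar ξ Γ i j x = pd i (fun y => g (0, y) * connVar ξ Γ j y) x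
      - (Γ i (0, x))ᵀ * (g (0, x) * connVar ξ Γ j x)
      - (g (0, x) * connVar ξ Γ j x) * Γ i (0, x) := by
    rw [e1, e0]
    simp only [covVar, mul_sub, mul_add, add_mul, mul_assoc]
    abel
  have e3 : pd i (fun y => g (0, y) * connVar ξ Γ j y) x k l
      = (1 / 2) * ((pd i (pd j h) x * g (0, x) k l + pd j h x * pd i (fun y => g (0, y)) x k l)
        + (pd i (pd l h) x * g (0, x) k j + pd l h x * pd i (fun y => g (0, y)) x k j)
        - (pd i (pd k h) x * g (0, x) j l + pd k h x * pd i (fun y => g (0, y)) x j l)) := by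
    refine (dd_entry (dg.mul dX) _ k l).symm.trans ?_
    refine (pd_congr hU (fun y hy => lower_connVar hU hΓ hξ hh hg hy j k l) hx i).trans ?_
    have m : ∀ a b c, DifferentiableAt ℝ (fun y => pd a h y * g (0, y) b c) x :=
      fun a b c => (dh a).mul (dge b c)
    have r : ∀ a b c, dd (fun y => pd a h y * g (0, y) b c) x (Pi.single i 1)
        = pd i (pd a h) x * g (0, x) b c + pd a h x * pd i (fun y => g (0, y)) x b c :=
      fun a b c => (dd_mul (dh a) (dge b c) _).trans
        (congrArg₂ (· + ·) rfl (congrArg _ (dd_entry dg _ b c)))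
    refine (dd_const_mul _ (((m j k l).add (m l k j)).sub (m k j l)) _).trans (congrArg _ ?_)
    refine (dd_sub ((m j k l).add (m l k j)) (m k j l) _).trans (congrArg₂ (· - ·) ?_ (r k j l))
    exact (dd_add (m j k l) (m l k j) _).trans (congrArg₂ (· + ·) (r j k l) (r l k j))
  rw [e2, Matrix.sub_apply, Matrix.sub_apply, e3, e0]
  have gs : ∀ k j, g (0, x) k j = g (0, x) j k := fun k j =>
    congrFun (congrFun (hΓ.symm _ hp) j) k
  rw [Matrix.mul_apply (M := (Γ i (0, x))ᵀ), Matrix.mul_apply (N := Γ i (0, x))]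
  simp only [lower_connVar hU hΓ hξ hh hg hx, Matrix.transpose_apply, Matrix.mul_apply,
    Matrix.add_apply, hessian, Fin.sum_univ_four]
  rw [gs j 0, gs j 1, gs j 2, gs j 3]
  ring

/-- The variation of the covariant curvature tensor `R_klij` under a conformal variation of the
metric. -/
theorem flowD_lower_curv (hU : IsOpen U) (hΓ : IsLeviCivitaOn U g Γ) (hξ : ContDiffOn ℝ ∞ ξ U)
    (hh : ContDiffOn ℝ ∞ h U)
    (hg : ∀ x ∈ U, flowD ξ g x = g (0, x) * jac ξ x + (jac ξ x)ᵀ * g (0, x) + h x • g (0, x))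
    {x : Pt} (hx : x ∈ U) (i j : Fin 4) :
    flowD ξ (fun p => g p * curv Γ i j p) x
      = (jac ξ x)ᵀ * (g (0, x) * curv Γ i j (0, x)) + (g (0, x) * curv Γ i j (0, x)) * jac ξ x
      + ∑ s, jac ξ x s i • (g (0, x) * curv Γ s j (0, x))
      + ∑ s, jac ξ x s j • (g (0, x) * curv Γ i s (0, x))
      + h x • (g (0, x) * curv Γ i j (0, x))
      + Matrix.of fun k l => (1 / 2) * (hessian Γ h x i l * g (0, x) k j
        - hessian Γ h x i k * g (0, x) j l - hessian Γ h x j l * g (0, x) k i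
        + hessian Γ h x j k * g (0, x) i l) := by
  have hW := isOpen_cyl hU
  have hp := mem_cyl hx 0
  have e1 : flowD ξ (fun p => g p * curv Γ i j p) x = flowD ξ g x * curv Γ i j (0, x)
      + g (0, x) * flowD ξ (curv Γ i j) x :=
    dd_mul (diffAt hW hΓ.smooth_g hp) (diffAt hW (contDiffOn_curv hU hΓ i j) hp) _
  have e2 : g (0, x) * (covVar ξ Γ i j x - covVar ξ Γ j i x)
      = Matrix.of fun k l => (1 / 2) * (hessian Γ h x i l * g (0, x) k j
        - hessian Γ h x i k * g (0, x) j l - hessian Γ h x j l * g (0, x) k i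
        + hessian Γ h x j k * g (0, x) i l) := by
    ext k l
    have t : ∀ s, Γ j (0, x) s i = Γ i (0, x) s j := fun s => hΓ.torsion _ hp j i s
    rw [mul_sub, Matrix.sub_apply, lower_covVar hU hΓ hξ hh hg hx,
      lower_covVar hU hΓ hξ hh hg hx, pd_comm hU hh hx i j, Matrix.of_apply]
    simp only [t]
    ring
  rw [e1, hg x hx, flowD_curv hU hΓ hξ hx, mul_add, e2]
  simp only [mul_sub, mul_add, add_mul, Finset.mul_sum, Matrix.mul_smul, Matrix.smul_mul,
    mul_assoc]
  abel

end Curvature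

/-! ### Frame components of the connection and the curvature -/

section Frame

/-- `E` is a smooth family of null frames for `g`: the column `a` of `E` is the frame vector
`e_a`. -/
structure IsNullFrameOn (U : Set Pt) (g E : ParamPt → CMat) : Prop where
  smooth : ContDiffOn ℝ ∞ E (cyl U)
  null : ∀ p ∈ cyl U, (E p)ᵀ * g p * E p = nullProducts

/-- The frame components of the curvature: `riemFrame g Γ E c d p a b` is
`R(e_a, e_b, e_c, e_d)`. -/
def riemFrame (g : ParamPt → CMat) (Γ : Fin 4 → ParamPt → CMat) (E : ParamPt → CMat)
    (c d : Fin 4) (p : ParamPt) : CMat :=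
  ∑ i, ∑ j, (E p i c * E p j d) • ((E p)ᵀ * (g p * curv Γ i j p) * E p)

/-- The covariant derivatives `∇_j e_c` of the frame vectors. -/
def covFrame (Γ : Fin 4 → ParamPt → CMat) (E : ParamPt → CMat) (j : Fin 4) (p : ParamPt) : CMat :=
  sd j E p + Γ j p * E p

/-- The frame components of the connection: `rotFrame g Γ E b p a c` is
`g(e_a, ∇_{e_b} e_c)`. -/
def rotFrame (g : ParamPt → CMat) (Γ : Fin 4 → ParamPt → CMat) (E : ParamPt → CMat)
    (b : Fin 4) (p : ParamPt) : CMat :=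
  ∑ j, E p j b • ((E p)ᵀ * (g p * covFrame Γ E j p))

variable {U : Set Pt} {g E : ParamPt → CMat} {Γ : Fin 4 → ParamPt → CMat} {ξ : Pt → Fin 4 → ℝ}
  {h : Pt → ℂ} {M : Pt → CMat}

theorem nullProducts_mul_self : nullProducts * nullProducts = 1 := by
  ext i j
  fin_cases i <;> fin_cases j <;> simp [nullProducts, Matrix.mul_apply, Fin.sum_univ_four]

/-- Completeness relation: `e η eᵀ` is the inverse of `G` if `e` is a null frame for `G`. -/
theorem inverse_of_null {G e : CMat} (h : eᵀ * G * e = nullProducts) :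
    (e * nullProducts * eᵀ) * G = 1 := by
  have h1 : (nullProducts * eᵀ * G) * e = 1 := by
    rw [mul_assoc, mul_assoc, ← mul_assoc eᵀ, h, nullProducts_mul_self]
  have h2 := mul_eq_one_comm.1 h1
  rw [← h2]; simp only [mul_assoc]

theorem contDiffOn_riemFrame (hU : IsOpen U) (hΓ : IsLeviCivitaOn U g Γ)
    (hE : IsNullFrameOn U g E) (c d : Fin 4) : ContDiffOn ℝ ∞ (riemFrame g Γ E c d) (cyl U) := by
  refine ContDiffOn.sum fun i _ => ContDiffOn.sum fun j _ => ?_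
  refine ContDiffOn.smul ((contDiffOn_entry hE.smooth i c).mul (contDiffOn_entry hE.smooth j d)) ?_
  exact contDiffOn_mul (contDiffOn_mul (contDiffOn_transpose hE.smooth)
    (contDiffOn_mul hΓ.smooth_g (contDiffOn_curv hU hΓ i j))) hE.smooth

theorem contDiffOn_covFrame (hU : IsOpen U) (hΓ : IsLeviCivitaOn U g Γ)
    (hE : IsNullFrameOn U g E) (j : Fin 4) : ContDiffOn ℝ ∞ (covFrame Γ E j) (cyl U) :=
  (contDiffOn_sd (isOpen_cyl hU) hE.smooth j).add (contDiffOn_mul (hΓ.smooth_conn j) hE.smooth)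

theorem contDiffOn_rotFrame (hU : IsOpen U) (hΓ : IsLeviCivitaOn U g Γ)
    (hE : IsNullFrameOn U g E) (b : Fin 4) : ContDiffOn ℝ ∞ (rotFrame g Γ E b) (cyl U) := by
  refine ContDiffOn.sum fun j _ => (contDiffOn_entry hE.smooth j b).smul ?_
  exact contDiffOn_mul (contDiffOn_transpose hE.smooth)
    (contDiffOn_mul hΓ.smooth_g (contDiffOn_covFrame hU hΓ hE j))

section Reindex
variable {V : Type*} [AddCommGroup V] [Module ℂ V]

/-- Lie derivative terms on a lower index, contracted with a frame vector `u`, are the same as Lie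
derivative terms on `u`. -/
theorem sum_reindex_fst (A : CMat) (u v : Fin 4 → ℂ) (B : Fin 4 → Fin 4 → V) :
    ∑ i, ∑ j, (u i * v j) • ∑ s, A s i • B s j
      = ∑ i, ∑ j, ((∑ s, A i s * u s) * v j) • B i j := by
  rw [Finset.sum_comm]
  conv_rhs => rw [Finset.sum_comm]
  refine Finset.sum_congr rfl fun j _ => ?_
  simp only [Finset.smul_sum, Finset.sum_mul, Finset.sum_smul, smul_smul]
  rw [Finset.sum_comm]
  refine Finset.sum_congr rfl fun i _ => Finset.sum_congr rfl fun s _ => ?_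
  congr 1; ring

theorem sum_reindex_snd (A : CMat) (u v : Fin 4 → ℂ) (B : Fin 4 → Fin 4 → V) :
    ∑ i, ∑ j, (u i * v j) • ∑ s, A s j • B i s
      = ∑ i, ∑ j, (u i * (∑ s, A j s * v s)) • B i j := by
  refine Finset.sum_congr rfl fun i _ => ?_
  simp only [Finset.smul_sum, Finset.mul_sum, Finset.sum_smul, smul_smul]
  rw [Finset.sum_comm]
  refine Finset.sum_congr rfl fun j _ => Finset.sum_congr rfl fun s _ => ?_
  congr 1; ring

theorem sum_rotate_fst (e : CMat) (m : Fin 4 → ℂ) (v : Fin 4 → ℂ) (B : Fin 4 → Fin 4 → V) :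
    ∑ i, ∑ j, ((∑ c, e i c * m c) * v j) • B i j
      = ∑ c, m c • ∑ i, ∑ j, (e i c * v j) • B i j := by
  simp only [Finset.smul_sum, Finset.sum_mul, Finset.sum_smul, smul_smul]
  conv_rhs => rw [Finset.sum_comm]
  refine Finset.sum_congr rfl fun i _ => ?_
  conv_rhs => rw [Finset.sum_comm]
  refine Finset.sum_congr rfl fun j _ => Finset.sum_congr rfl fun s _ => ?_
  congr 1; ring

theorem sum_rotate_snd (e : CMat) (m : Fin 4 → ℂ) (u : Fin 4 → ℂ) (B : Fin 4 → Fin 4 → V) :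
    ∑ i, ∑ j, (u i * (∑ c, e j c * m c)) • B i j
      = ∑ c, m c • ∑ i, ∑ j, (u i * e j c) • B i j := by
  simp only [Finset.smul_sum, Finset.mul_sum, Finset.sum_smul, smul_smul]
  conv_rhs => rw [Finset.sum_comm]
  refine Finset.sum_congr rfl fun i _ => ?_
  conv_rhs => rw [Finset.sum_comm]
  refine Finset.sum_congr rfl fun j _ => Finset.sum_congr rfl fun s _ => ?_
  congr 1; ring

theorem sum_prod_outer (p q : Fin 4 → Fin 4 → ℂ) :
    ∑ i, ∑ j, ∑ k, ∑ l, p i l * q k j = (∑ i, ∑ l, p i l) * ∑ k, ∑ j, q k j := by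
  simp only [← Finset.sum_mul, ← Finset.mul_sum]
  rw [Finset.sum_comm (f := fun j k => q k j)]

theorem sum_prod_inner (p q : Fin 4 → Fin 4 → ℂ) :
    ∑ i, ∑ j, ∑ k, ∑ l, p i k * q j l = (∑ i, ∑ k, p i k) * ∑ j, ∑ l, q j l := by
  simp only [← Finset.sum_mul, ← Finset.mul_sum]

end Reindex

/-- The frame components of the tensor product structure by which the curvature varies. -/
theorem frame_kulkarniNomizu {G e : CMat} (hn : eᵀ * G * e = nullProducts)
    (H : CMat) (c d : Fin 4) :
    ∑ i, ∑ j, (e i c * e j d) • (eᵀ * (Matrix.of fun k l => (1 / 2) * (H i l * G k j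
        - H i k * G j l - H j l * G k i + H j k * G i l)) * e)
      = Matrix.of fun a b => (1 / 2) * ((eᵀ * H * e) c b * nullProducts a d
        - (eᵀ * H * e) c a * nullProducts d b - (eᵀ * H * e) d b * nullProducts a c
        + (eᵀ * H * e) d a * nullProducts c b) := by
  have E : ∀ (X : CMat) (a b : Fin 4), (eᵀ * X * e) a b = ∑ k, ∑ l, e k a * X k l * e l b := by
    intro X a b
    simp only [Matrix.mul_apply, Matrix.transpose_apply, Finset.sum_mul]
    rw [Finset.sum_comm]
  have N : ∀ a b, nullProducts a b = ∑ k, ∑ l, e k a * G k l * e l b := fun a b => by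
    rw [← hn, E]
  ext a b
  simp only [Matrix.sum_apply, Matrix.smul_apply, E, Matrix.of_apply, smul_eq_mul, N]
  rw [← sum_prod_outer (fun i l => e i c * H i l * e l b) (fun k j => e k a * G k j * e j d),
    ← sum_prod_inner (fun i k => e i c * H i k * e k a) (fun j l => e j d * G j l * e l b),
    mul_comm (∑ k, ∑ l, e k d * H k l * e l b),
    mul_comm (∑ k, ∑ l, e k d * H k l * e l a),
    Finset.sum_comm (f := fun k l => e k a * G k l * e l c),
    Finset.sum_comm (f := fun k l => e k d * H k l * e l a),
    ← sum_prod_inner (fun i k => e k a * G k i * e i c) (fun j l => e j d * H j l * e l b),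
    ← sum_prod_outer (fun i l => e i c * G i l * e l b) (fun k j => e j d * H j k * e k a)]
  simp only [Finset.mul_sum, ← Finset.sum_add_distrib, ← Finset.sum_sub_distrib]
  refine Finset.sum_congr rfl fun i _ => Finset.sum_congr rfl fun j _ =>
    Finset.sum_congr rfl fun k _ => Finset.sum_congr rfl fun l _ => ?_
  ring

theorem flowD_frame_entry (hU : IsOpen U) (hE : IsNullFrameOn U g E)
    (hLE : ∀ x ∈ U, flowD ξ E x = -(jac ξ x * E (0, x)) + E (0, x) * (M x)ᵀ)
    {x : Pt} (hx : x ∈ U) (i c : Fin 4) :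
    flowD ξ (fun p => E p i c) x = -(∑ s, jac ξ x i s * E (0, x) s c)
      + ∑ c', E (0, x) i c' * M x c c' := by
  have := dd_entry (diffAt (isOpen_cyl hU) hE.smooth (mem_cyl hx 0)) (1, -ξ x) i c
  refine this.trans ((congrFun (congrFun (hLE x hx) i) c).trans ?_)
  simp [Matrix.mul_apply]

/-- The variation of the frame components of the curvature, if the metric varies conformally and
the frame by the Lie derivative and an infinitesimal rotation `M`. -/
theorem flowD_riemFrame (hU : IsOpen U) (hΓ : IsLeviCivitaOn U g Γ) (hE : IsNullFrameOn U g E)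
    (hξ : ContDiffOn ℝ ∞ ξ U) (hh : ContDiffOn ℝ ∞ h U)
    (hg : ∀ x ∈ U, flowD ξ g x = g (0, x) * jac ξ x + (jac ξ x)ᵀ * g (0, x) + h x • g (0, x))
    (hLE : ∀ x ∈ U, flowD ξ E x = -(jac ξ x * E (0, x)) + E (0, x) * (M x)ᵀ)
    {x : Pt} (hx : x ∈ U) (c d : Fin 4) :
    flowD ξ (riemFrame g Γ E c d) x
      = M x * riemFrame g Γ E c d (0, x) + riemFrame g Γ E c d (0, x) * (M x)ᵀ
      + ∑ c', M x c c' • riemFrame g Γ E c' d (0, x)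
      + ∑ d', M x d d' • riemFrame g Γ E c d' (0, x)
      + h x • riemFrame g Γ E c d (0, x)
      + Matrix.of fun a b => (1 / 2) *
        (((E (0, x))ᵀ * Matrix.of (hessian Γ h x) * E (0, x)) c b * nullProducts a d
        - ((E (0, x))ᵀ * Matrix.of (hessian Γ h x) * E (0, x)) c a * nullProducts d b
        - ((E (0, x))ᵀ * Matrix.of (hessian Γ h x) * E (0, x)) d b * nullProducts a c
        + ((E (0, x))ᵀ * Matrix.of (hessian Γ h x) * E (0, x)) d a * nullProducts c b) := by
  have hW := isOpen_cyl hU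
  have hp := mem_cyl hx 0
  have dE := diffAt hW hE.smooth hp
  have dET := diffAt hW (contDiffOn_transpose hE.smooth) hp
  have dEe := fun i c => diffAt hW (contDiffOn_entry hE.smooth i c) hp
  have dY := fun i j => diffAt hW (contDiffOn_mul hΓ.smooth_g (contDiffOn_curv hU hΓ i j)) hp
  have dB := fun i j => (dET.mul (dY i j)).mul dE
  have dT := fun i j => ((dEe i c).mul (dEe j d)).smul (dB i j)
  set e := E (0, x) with he
  set A := jac ξ x with hA
  have e1 : flowD ξ (riemFrame g Γ E c d) x = ∑ i, ∑ j,
      ((flowD ξ (fun p => E p i c) x * e j d + e i c * flowD ξ (fun p => E p j d) x)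
          • (eᵀ * (g (0, x) * curv Γ i j (0, x)) * e)
        + (e i c * e j d) • (((flowD ξ E x)ᵀ * (g (0, x) * curv Γ i j (0, x))
          + eᵀ * flowD ξ (fun p => g p * curv Γ i j p) x) * e
          + eᵀ * (g (0, x) * curv Γ i j (0, x)) * flowD ξ E x)) := by
    refine (dd_sum (fun i _ => DifferentiableAt.fun_sum fun j _ => dT i j) _).trans
      (Finset.sum_congr rfl fun i _ => ?_)
    refine (dd_sum (fun j _ => dT i j) _).trans (Finset.sum_congr rfl fun j _ => ?_)
    refine (dd_smul ((dEe i c).mul (dEe j d)) (dB i j) _).trans (congrArg₂ (· + ·) ?_ ?_)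
    · exact congrArg (· • _) (dd_mul (dEe i c) (dEe j d) _)
    · refine congrArg _ ((dd_mul (dET.mul (dY i j)) dE _).trans (congrArg₂ (· + ·) ?_ rfl))
      refine congrArg (· * e) ((dd_mul dET (dY i j) _).trans (congrArg₂ (· + ·) ?_ rfl))
      exact congrArg (· * _) (dd_transpose dE _)
  have e2 : ∀ i j, ((flowD ξ E x)ᵀ * (g (0, x) * curv Γ i j (0, x))
          + eᵀ * flowD ξ (fun p => g p * curv Γ i j p) x) * e
          + eᵀ * (g (0, x) * curv Γ i j (0, x)) * flowD ξ E x
      = M x * (eᵀ * (g (0, x) * curv Γ i j (0, x)) * e)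
        + (eᵀ * (g (0, x) * curv Γ i j (0, x)) * e) * (M x)ᵀ
        + ∑ s, A s i • (eᵀ * (g (0, x) * curv Γ s j (0, x)) * e)
        + ∑ s, A s j • (eᵀ * (g (0, x) * curv Γ i s (0, x)) * e)
        + h x • (eᵀ * (g (0, x) * curv Γ i j (0, x)) * e)
        + eᵀ * (Matrix.of fun k l => (1 / 2) * (hessian Γ h x i l * g (0, x) k j
        - hessian Γ h x i k * g (0, x) j l - hessian Γ h x j l * g (0, x) k i
        + hessian Γ h x j k * g (0, x) i l)) * e := by
    intro i j
    rw [hLE x hx, flowD_lower_curv hU hΓ hξ hh hg hx]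
    simp only [Matrix.transpose_add, Matrix.transpose_neg, Matrix.transpose_mul,
      Matrix.transpose_transpose, mul_add, add_mul, neg_mul, mul_neg, Finset.mul_sum,
      Finset.sum_mul, Matrix.mul_smul, Matrix.smul_mul, mul_assoc]
    abel
  have KN := frame_kulkarniNomizu (hE.null _ hp) (Matrix.of (hessian Γ h x)) c d
  simp only [Matrix.of_apply] at KN
  rw [e1]
  simp only [e2, flowD_frame_entry hU hE hLE hx]
  rw [← KN]
  simp only [smul_add, add_mul, mul_add, add_smul, Finset.sum_add_distrib, neg_mul, mul_neg,
    neg_smul, Finset.sum_neg_distrib]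
  rw [sum_reindex_fst A (fun i => e i c) (fun j => e j d)
      (fun i j => eᵀ * (g (0, x) * curv Γ i j (0, x)) * e),
    sum_reindex_snd A (fun i => e i c) (fun j => e j d)
      (fun i j => eᵀ * (g (0, x) * curv Γ i j (0, x)) * e),
    sum_rotate_fst e (M x c) (fun j => e j d), sum_rotate_snd e (M x d) (fun i => e i c)]
  simp only [riemFrame, ← he, Finset.mul_sum, Finset.sum_mul, Matrix.mul_smul, Matrix.smul_mul,
    Finset.smul_sum, smul_comm (h x)]
  abel

/-- The Levi-Civita connection varies by Lie derivative terms only, if the metric does. -/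
theorem connVar_eq_zero (hU : IsOpen U) (hΓ : IsLeviCivitaOn U g Γ) (hE : IsNullFrameOn U g E)
    (hξ : ContDiffOn ℝ ∞ ξ U)
    (hg : ∀ x ∈ U, flowD ξ g x = g (0, x) * jac ξ x + (jac ξ x)ᵀ * g (0, x))
    {x : Pt} (hx : x ∈ U) (i : Fin 4) : connVar ξ Γ i x = 0 := by
  have h1 : g (0, x) * connVar ξ Γ i x = 0 := by
    ext k j
    rw [lower_connVar (h := fun _ => 0) hU hΓ hξ contDiffOn_const (by simpa using hg) hx]
    simp [pd]
  rw [← one_mul (connVar ξ Γ i x), ← inverse_of_null (hE.null _ (mem_cyl hx 0)), mul_assoc, h1,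
    mul_zero]

/-- The rotation coefficients are constant along `∂_t - ξ^k ∂_k`, if the metric and the frame vary
by their Lie derivatives. -/
theorem flowD_rotFrame (hU : IsOpen U) (hΓ : IsLeviCivitaOn U g Γ) (hE : IsNullFrameOn U g E)
    (hξ : ContDiffOn ℝ ∞ ξ U)
    (hg : ∀ x ∈ U, flowD ξ g x = g (0, x) * jac ξ x + (jac ξ x)ᵀ * g (0, x))
    (hLE : ∀ x ∈ U, flowD ξ E x = -(jac ξ x * E (0, x)))
    {x : Pt} (hx : x ∈ U) (b : Fin 4) : flowD ξ (rotFrame g Γ E b) x = 0 := by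
  have hW := isOpen_cyl hU
  have hp := mem_cyl hx 0
  have dE := diffAt hW hE.smooth hp
  have dg := diffAt hW hΓ.smooth_g hp
  have dET := diffAt hW (contDiffOn_transpose hE.smooth) hp
  have dEe := fun i c => diffAt hW (contDiffOn_entry hE.smooth i c) hp
  have dΓ := fun i => diffAt hW (hΓ.smooth_conn i) hp
  have dsE := fun i => diffAt hW (contDiffOn_sd hW hE.smooth i) hp
  have dN := fun i => diffAt hW (contDiffOn_covFrame hU hΓ hE i) hp
  have dB := fun j => dET.mul (dg.mul (dN j))
  have dA := diffAt hU (contDiffOn_jac hU hξ) hx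
  have dE0 := diffAt hU (contDiffOn_slice hE.smooth) hx
  have e0 : ∀ j, pd j (flowD ξ E) x
      = -(pd j (jac ξ) x * E (0, x) + jac ξ x * sd j E (0, x)) := by
    intro j
    have e : ∀ y ∈ U, flowD ξ E y = 0 - jac ξ y * E (0, y) := fun y hy => by
      rw [hLE y hy, zero_sub]
    rw [pd_congr hU e hx, ← pd_slice dE]
    refine (dd_sub (differentiableAt_const _) (dA.mul dE0) _).trans ?_
    refine (congrArg₂ (· - ·) ?_ (dd_mul dA dE0 _)).trans (zero_sub _)
    simp [dd]
  have e1 : ∀ j, flowD ξ (covFrame Γ E j) x = -(jac ξ x * covFrame Γ E j (0, x))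
      + ∑ s, jac ξ x s j • covFrame Γ E s (0, x) := by
    intro j
    have : flowD ξ (covFrame Γ E j) x = flowD ξ (sd j E) x
        + (flowD ξ (Γ j) x * E (0, x) + Γ j (0, x) * flowD ξ E x) :=
      (dd_add (dsE j) ((dΓ j).mul dE) _).trans (congrArg₂ (· + ·) rfl (dd_mul (dΓ j) dE _))
    have h2 := connVar_eq_zero hU hΓ hE hξ hg hx j
    rw [connVar, sub_eq_zero] at h2
    rw [this, flowD_sd_jac hU hE.smooth hξ hx, e0, h2, hLE x hx]
    simp only [covFrame, mul_add, add_mul, sub_mul, mul_neg, smul_add, Finset.sum_add_distrib,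
      Finset.sum_mul, Matrix.smul_mul, mul_assoc]
    abel
  have e2 : flowD ξ (rotFrame g Γ E b) x = ∑ j, (flowD ξ (fun p => E p j b) x
      • ((E (0, x))ᵀ * (g (0, x) * covFrame Γ E j (0, x)))
      + E (0, x) j b • ((flowD ξ E x)ᵀ * (g (0, x) * covFrame Γ E j (0, x))
        + (E (0, x))ᵀ * (flowD ξ g x * covFrame Γ E j (0, x)
          + g (0, x) * flowD ξ (covFrame Γ E j) x))) := by
    refine (dd_sum (fun j _ => (dEe j b).smul (dB j)) _).trans (Finset.sum_congr rfl fun j _ => ?_)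
    refine (dd_smul (dEe j b) (dB j) _).trans (congrArg₂ (· + ·) rfl (congrArg _ ?_))
    refine (dd_mul dET (dg.mul (dN j)) _).trans (congrArg₂ (· + ·) ?_ ?_)
    · exact congrArg (· * _) (dd_transpose dE _)
    · exact congrArg _ (dd_mul dg (dN j) _)
  have e3 : ∀ j, (flowD ξ E x)ᵀ * (g (0, x) * covFrame Γ E j (0, x))
        + (E (0, x))ᵀ * (flowD ξ g x * covFrame Γ E j (0, x)
          + g (0, x) * flowD ξ (covFrame Γ E j) x)
      = ∑ s, jac ξ x s j • ((E (0, x))ᵀ * (g (0, x) * covFrame Γ E s (0, x))) := by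
    intro j
    rw [e1, hLE x hx, hg x hx]
    simp only [Matrix.transpose_neg, Matrix.transpose_mul, mul_add, add_mul, neg_mul, mul_neg,
      Finset.mul_sum, Matrix.mul_smul, mul_assoc]
    abel
  have hLE' : ∀ x ∈ U, flowD ξ E x = -(jac ξ x * E (0, x)) + E (0, x) * (0 : CMat)ᵀ := by
    simpa using hLE
  rw [e2]
  simp only [e3, flowD_frame_entry (M := fun _ => 0) hU hE hLE' hx, Matrix.zero_apply, mul_zero,
    Finset.sum_const_zero, add_zero, Finset.sum_add_distrib, neg_smul, Finset.sum_neg_distrib,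
    Finset.smul_sum, Finset.sum_smul, smul_smul]
  rw [Finset.sum_comm, ← Finset.sum_neg_distrib, ← Finset.sum_add_distrib]
  refine Finset.sum_eq_zero fun j _ => ?_
  rw [← Finset.sum_neg_distrib, ← Finset.sum_add_distrib]
  refine Finset.sum_eq_zero fun s _ => ?_
  rw [mul_comm, neg_add_cancel]

end Frame

/-! ### One-parameter families of metrics and null tetrads -/

section Families

/-- The components of a one-parameter family of metrics, as complex matrices. -/
def metM (G : ℝ → MetricField) (p : ParamPt) : CMat :=
  Matrix.of fun i j => ((G p.1 p.2 i j : ℝ) : ℂ)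

/-- The matrices with the vectors of a one-parameter family of tetrads as columns. -/
def frM (T : ℝ → Pt → Tetrad) (p : ParamPt) : CMat :=
  Matrix.of fun i a => (T p.1 p.2).frame a i

/-- The Christoffel symbols of a one-parameter family of metrics: `(chrM G i)_{kj} = Γ^k_ij`. -/
def chrM (G : ℝ → MetricField) (i : Fin 4) (p : ParamPt) : CMat :=
  Matrix.of fun k j => ((christoffel (G p.1) k i j p.2 : ℝ) : ℂ)

/-- A smooth one-parameter family of symmetric tensors with null tetrads. -/
structure IsNPFamilyOn (U : Set Pt) (G : ℝ → MetricField) (T : ℝ → Pt → Tetrad) : Prop where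
  smooth_g : ContDiffOn ℝ ∞ (metM G) (cyl U)
  smooth_e : ContDiffOn ℝ ∞ (frM T) (cyl U)
  symm : ∀ t, ∀ x ∈ U, (G t x).IsSymm
  null : ∀ t, ∀ x ∈ U, IsNullTetrad (G t x) (T t x)

variable {U : Set Pt} {G : ℝ → MetricField} {T : ℝ → Pt → Tetrad}

theorem frame_null {g : Matrix (Fin 4) (Fin 4) ℝ} {e : Tetrad} (h : IsNullTetrad g e) :
    (Matrix.of fun i a => e.frame a i : CMat)ᵀ * (Matrix.of fun i j => ((g i j : ℝ) : ℂ))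
      * (Matrix.of fun i a => e.frame a i) = nullProducts := by
  ext a b
  rw [← h a b]
  simp only [Matrix.mul_apply, Matrix.transpose_apply, Matrix.of_apply, Finset.sum_mul]
  rw [Finset.sum_comm]
  refine Finset.sum_congr rfl fun i _ => Finset.sum_congr rfl fun j _ => ?_
  ring

theorem IsNPFamilyOn.isNullFrameOn (hF : IsNPFamilyOn U G T) :
    IsNullFrameOn U (metM G) (frM T) :=
  ⟨hF.smooth_e, fun p hp => frame_null (hF.null p.1 p.2 hp.2)⟩

theorem det_ne_zero_of_nullTetrad {g : Matrix (Fin 4) (Fin 4) ℝ} {e : Tetrad}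
    (h : IsNullTetrad g e) : g.det ≠ 0 := by
  have h1 := inverse_of_null (frame_null h)
  have hm : (Matrix.of fun i j => ((g i j : ℝ) : ℂ) : CMat) = Complex.ofRealHom.mapMatrix g := rfl
  rw [hm] at h1
  intro h0
  have := congrArg Matrix.det h1
  rw [Matrix.det_mul, ← RingHom.map_det, h0] at this
  simp at this

/-- Completeness relation: the inverse metric in terms of a null tetrad. -/
theorem inv_of_nullTetrad {g : Matrix (Fin 4) (Fin 4) ℝ} {e : Tetrad} (h : IsNullTetrad g e)
    (k s : Fin 4) : ((g⁻¹ k s : ℝ) : ℂ) = ((Matrix.of fun i a => e.frame a i : CMat) * nullProducts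
      * (Matrix.of fun i a => e.frame a i : CMat)ᵀ) k s := by
  have h1 := inverse_of_null (frame_null h)
  have hm : (Matrix.of fun i j => ((g i j : ℝ) : ℂ) : CMat) = Complex.ofRealHom.mapMatrix g := rfl
  rw [hm] at h1
  have h2 : Complex.ofRealHom.mapMatrix g * Complex.ofRealHom.mapMatrix g⁻¹ = 1 := by
    rw [← map_mul, Matrix.mul_nonsing_inv _ (isUnit_iff_ne_zero.2 (det_ne_zero_of_nullTetrad h)), map_one]
  have h3 : Complex.ofRealHom.mapMatrix g⁻¹ = _ := (left_inv_eq_right_inv h1 h2).symm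
  exact congrFun (congrFun h3 k) s

theorem contDiffOn_metric_entry (hF : IsNPFamilyOn U G T) (t : ℝ) (i j : Fin 4) :
    ContDiffOn ℝ ∞ (fun y => G t y i j) U := by
  have h := contDiffOn_entry hF.smooth_g i j
  have h2 : ContDiffOn ℝ ∞ (fun y => metM G (t, y) i j) U :=
    h.comp (f := fun y : Pt => (t, y)) (by fun_prop) fun _ hx => mem_cyl hx t
  exact Complex.reCLM.contDiff.comp_contDiffOn h2

theorem pd_metric (hU : IsOpen U) (hF : IsNPFamilyOn U G T) {t : ℝ} {x : Pt} (hx : x ∈ U)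
    (s i j : Fin 4) :
    ((pd s (fun y => G t y i j) x : ℝ) : ℂ) = sd s (metM G) (t, x) i j := by
  rw [← ofReal_pd (diffAt hU (contDiffOn_metric_entry hF t i j) hx)]
  have h := diffAt (isOpen_cyl hU) hF.smooth_g (mem_cyl hx t)
  have he := diffAt (isOpen_cyl hU) (contDiffOn_entry hF.smooth_g i j) (mem_cyl hx t)
  exact (pd_slice he s).trans (dd_entry h _ i j)

/-- The Christoffel symbols with the inverse metric expressed by the tetrad, which is smooth by
hypothesis. -/
theorem chrM_apply (hU : IsOpen U) (hF : IsNPFamilyOn U G T) {p : ParamPt} (hp : p ∈ cyl U)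
    (i k j : Fin 4) :
    chrM G i p k j = (1 / 2) * ∑ s, (frM T p * nullProducts * (frM T p)ᵀ) k s *
      (sd i (metM G) p j s + sd j (metM G) p i s - sd s (metM G) p i j) := by
  obtain ⟨t, x⟩ := p
  have hx : x ∈ U := hp.2
  simp only [chrM, christoffel, Matrix.of_apply]
  push_cast
  simp only [pd_metric hU hF hx, inv_of_nullTetrad (hF.null t x hx)]
  rfl

theorem IsNPFamilyOn.sd_symm (hU : IsOpen U) (hF : IsNPFamilyOn U G T) {p : ParamPt}
    (hp : p ∈ cyl U) (s i j : Fin 4) : sd s (metM G) p i j = sd s (metM G) p j i := by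
  obtain ⟨t, x⟩ := p
  rw [← pd_metric hU hF hp.2, ← pd_metric hU hF hp.2]
  rw [pd_congr hU (fun y hy => (hF.symm t y hy).apply j i) hp.2]

theorem IsNPFamilyOn.isLeviCivitaOn (hU : IsOpen U) (hF : IsNPFamilyOn U G T) :
    IsLeviCivitaOn U (metM G) (chrM G) where
  smooth_g := hF.smooth_g
  smooth_conn i := by
    have hW := isOpen_cyl hU
    have hs := fun s i j => contDiffOn_entry (contDiffOn_sd hW hF.smooth_g s) i j
    have hi := contDiffOn_mul (contDiffOn_mul hF.smooth_e contDiffOn_const)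
      (contDiffOn_transpose hF.smooth_e) (f := fun p => frM T p * nullProducts)
      (g := fun p => (frM T p)ᵀ)
    refine contDiffOn_matrix fun k j => ?_
    refine ContDiffOn.congr ?_ fun p hp => chrM_apply hU hF hp i k j
    refine contDiffOn_const.mul (ContDiffOn.sum fun s _ => ?_)
    exact (contDiffOn_entry hi k s).mul (((hs i j s).add (hs j i s)).sub (hs s i j))
  symm p hp := by
    ext i j
    exact congrArg Complex.ofReal ((hF.symm p.1 p.2 hp.2).apply i j)
  compat p hp i := by
    have hl : ∀ i, metM G p * chrM G i p = Matrix.of fun s j => (1 / 2) *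
        (sd i (metM G) p j s + sd j (metM G) p i s - sd s (metM G) p i j) := by
      intro i
      have h1 := inverse_of_null (hF.isNullFrameOn.null p hp)
      have h2 := mul_eq_one_comm.1 h1
      have e : chrM G i p = (frM T p * nullProducts * (frM T p)ᵀ) * Matrix.of fun s j => (1 / 2) *
          (sd i (metM G) p j s + sd j (metM G) p i s - sd s (metM G) p i j) := by
        ext k j
        rw [chrM_apply hU hF hp, Matrix.mul_apply, Finset.mul_sum]
        refine Finset.sum_congr rfl fun s _ => ?_
        simp only [Matrix.of_apply]
        ring
      rw [e, ← mul_assoc, h2, one_mul]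
    have hs : (metM G p)ᵀ = metM G p := by
      ext i j
      exact congrArg Complex.ofReal ((hF.symm p.1 p.2 hp.2).apply i j)
    have ht : (chrM G i p)ᵀ * metM G p = (metM G p * chrM G i p)ᵀ := by
      rw [Matrix.transpose_mul, hs]
    rw [ht, hl]
    ext k j
    simp only [Matrix.add_apply, Matrix.transpose_apply, Matrix.of_apply]
    rw [hF.sd_symm hU hp i j k, hF.sd_symm hU hp j i k, hF.sd_symm hU hp k i j]
    ring
  torsion p hp i j k := by
    rw [chrM_apply hU hF hp, chrM_apply hU hF hp]
    congr 1
    refine Finset.sum_congr rfl fun s _ => ?_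
    rw [hF.sd_symm hU hp s j i]
    ring

theorem pd_christoffel (hU : IsOpen U) (hF : IsNPFamilyOn U G T) {t : ℝ} {x : Pt} (hx : x ∈ U)
    (s k i j : Fin 4) :
    ((pd s (christoffel (G t) k i j) x : ℝ) : ℂ) = sd s (chrM G i) (t, x) k j := by
  have hs := (hF.isLeviCivitaOn hU).smooth_conn i
  have he := contDiffOn_entry hs k j
  have h2 : ContDiffOn ℝ ∞ (fun y => chrM G i (t, y) k j) U :=
    he.comp (f := fun y : Pt => (t, y)) (by fun_prop) fun _ hx => mem_cyl hx t
  have h3 : ContDiffOn ℝ ∞ (christoffel (G t) k i j) U :=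
    Complex.reCLM.contDiff.comp_contDiffOn h2
  rw [← ofReal_pd (diffAt hU h3 hx)]
  exact (pd_slice (diffAt (isOpen_cyl hU) he (mem_cyl hx t)) s).trans
    (dd_entry (diffAt (isOpen_cyl hU) hs (mem_cyl hx t)) _ k j)

theorem riemannUp_eq (hU : IsOpen U) (hF : IsNPFamilyOn U G T) {t : ℝ} {x : Pt} (hx : x ∈ U)
    (k l i j : Fin 4) :
    ((riemannUp (G t) k l i j x : ℝ) : ℂ) = curv (chrM G) i j (t, x) k l := by
  simp only [riemannUp, curv, Matrix.sub_apply, Matrix.add_apply, Matrix.mul_apply]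
  push_cast
  rw [pd_christoffel hU hF hx, pd_christoffel hU hF hx, Finset.sum_sub_distrib]
  simp only [chrM, Matrix.of_apply]
  ring

theorem riemann_eq (hU : IsOpen U) (hF : IsNPFamilyOn U G T) {t : ℝ} {x : Pt} (hx : x ∈ U)
    (k l i j : Fin 4) :
    ((riemann (G t) x k l i j : ℝ) : ℂ) = (metM G (t, x) * curv (chrM G) i j (t, x)) k l := by
  simp only [riemann, Matrix.mul_apply]
  push_cast
  simp only [riemannUp_eq hU hF hx]
  rfl

theorem contract_riemann_eq (hU : IsOpen U) (hF : IsNPFamilyOn U G T) {t : ℝ} {x : Pt}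
    (hx : x ∈ U) (a b c d : Fin 4) :
    contract (riemann (G t) x) ((T t x).frame a) ((T t x).frame b) ((T t x).frame c)
      ((T t x).frame d) = riemFrame (metM G) (chrM G) (frM T) c d (t, x) a b := by
  simp only [contract, riemFrame, riemann_eq hU hF hx, Matrix.sum_apply, Matrix.smul_apply,
    smul_eq_mul]
  have E : ∀ i j, ((frM T (t, x))ᵀ * (metM G (t, x) * curv (chrM G) i j (t, x)) * frM T (t, x)) a b
      = ∑ k, ∑ l, frM T (t, x) k a * (metM G (t, x) * curv (chrM G) i j (t, x)) k l
        * frM T (t, x) l b := by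
    intro i j
    rw [Matrix.mul_apply]
    simp only [Matrix.mul_apply (M := (frM T (t, x))ᵀ), Matrix.transpose_apply, Finset.sum_mul]
    rw [Finset.sum_comm]
  simp only [E, Finset.mul_sum]
  rw [Finset.sum_congr rfl fun k _ => Finset.sum_comm, Finset.sum_comm]
  refine Finset.sum_congr rfl fun i _ => ?_
  rw [Finset.sum_congr rfl fun k _ => Finset.sum_comm, Finset.sum_comm]
  refine Finset.sum_congr rfl fun j _ => Finset.sum_congr rfl fun k _ =>
    Finset.sum_congr rfl fun l _ => ?_
  simp only [frM, Matrix.of_apply]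
  ring

theorem pd_frame (hU : IsOpen U) (hF : IsNPFamilyOn U G T) {t : ℝ} {x : Pt} (hx : x ∈ U)
    (j c k : Fin 4) : pd j (fun y => (T t y).frame c k) x = sd j (frM T) (t, x) k c :=
  (pd_slice (diffAt (isOpen_cyl hU) (contDiffOn_entry hF.smooth_e k c) (mem_cyl hx t)) j).trans
    (dd_entry (diffAt (isOpen_cyl hU) hF.smooth_e (mem_cyl hx t)) _ k c)

theorem rotCoef_eq (hU : IsOpen U) (hF : IsNPFamilyOn U G T) {t : ℝ} {x : Pt}
    (hx : x ∈ U) (c a b : Fin 4) :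
    rotCoef (G t) (T t) c a b x
      = rotFrame (metM G) (chrM G) (frM T) b (t, x) a c := by
  simp only [rotCoef, rotFrame, covFrame, Matrix.sum_apply, Matrix.smul_apply, Matrix.mul_apply,
    Matrix.add_apply, smul_eq_mul, Finset.mul_sum, pd_frame hU hF hx]
  rw [Finset.sum_congr rfl fun k _ => Finset.sum_comm, Finset.sum_comm]
  refine Finset.sum_congr rfl fun j _ => Finset.sum_congr rfl fun i _ =>
    Finset.sum_congr rfl fun k _ => ?_
  simp only [frM, metM, chrM, Matrix.of_apply, Matrix.transpose_apply]
  ring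

end Families

/-! ### Expressions in the NP scalars along a family -/

section Expressions

/-- The value of an expression along a one-parameter family of metrics and tetrads. -/
def evalFam (G : ℝ → MetricField) (T : ℝ → Pt → Tetrad) (E : NPExpr) (p : ParamPt) : ℂ :=
  E.eval (G p.1) (T p.1) p.2

/-- Where an expression is defined along a one-parameter family of metrics and tetrads. -/
def domFam (U : Set Pt) (G : ℝ → MetricField) (T : ℝ → Pt → Tetrad) (E : NPExpr) : Set ParamPt :=
  {p | p ∈ cyl U ∧ E.DefinedAt (G p.1) (T p.1) p.2}

variable {U : Set Pt} {G : ℝ → MetricField} {T : ℝ → Pt → Tetrad} {ξ : Pt → Fin 4 → ℝ}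

/-- Each spin coefficient is a constant linear combination of two rotation coefficients. -/
theorem SpinCoef.val_eq (s : SpinCoef) : ∃ (u v : ℂ) (c₁ a₁ b₁ c₂ a₂ b₂ : Fin 4), ∀ g T x,
    s.val g T x = u * rotCoef g T c₁ a₁ b₁ x + v * rotCoef g T c₂ a₂ b₂ x := by
  cases s
  case kappa => exact ⟨1, 0, 0, 2, 0, 0, 0, 0, fun g T x => by simp [SpinCoef.val]⟩
  case rho => exact ⟨1, 0, 0, 2, 3, 0, 0, 0, fun g T x => by simp [SpinCoef.val]⟩
  case sigma => exact ⟨1, 0, 0, 2, 2, 0, 0, 0, fun g T x => by simp [SpinCoef.val]⟩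
  case tau => exact ⟨1, 0, 0, 2, 1, 0, 0, 0, fun g T x => by simp [SpinCoef.val]⟩
  case pi => exact ⟨-1, 0, 1, 3, 0, 0, 0, 0, fun g T x => by simp [SpinCoef.val]⟩
  case lambda => exact ⟨-1, 0, 1, 3, 3, 0, 0, 0, fun g T x => by simp [SpinCoef.val]⟩
  case mu => exact ⟨-1, 0, 1, 3, 2, 0, 0, 0, fun g T x => by simp [SpinCoef.val]⟩
  case nu => exact ⟨-1, 0, 1, 3, 1, 0, 0, 0, fun g T x => by simp [SpinCoef.val]⟩
  case epsilon =>
    exact ⟨1 / 2, -(1 / 2), 0, 1, 0, 2, 3, 0, fun g T x => by simp only [SpinCoef.val]; ring⟩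
  case alpha =>
    exact ⟨1 / 2, -(1 / 2), 0, 1, 3, 2, 3, 3, fun g T x => by simp only [SpinCoef.val]; ring⟩
  case beta =>
    exact ⟨1 / 2, -(1 / 2), 0, 1, 2, 2, 3, 2, fun g T x => by simp only [SpinCoef.val]; ring⟩
  case gamma =>
    exact ⟨1 / 2, -(1 / 2), 0, 1, 1, 2, 3, 1, fun g T x => by simp only [SpinCoef.val]; ring⟩

theorem evalFam_spin (hU : IsOpen U) (hF : IsNPFamilyOn U G T) (s : SpinCoef) :
    ∃ (u v : ℂ) (c₁ a₁ b₁ c₂ a₂ b₂ : Fin 4), ∀ p ∈ cyl U, evalFam G T (NPExpr.spin s) p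
      = u * rotFrame (metM G) (chrM G) (frM T) b₁ p a₁ c₁
        + v * rotFrame (metM G) (chrM G) (frM T) b₂ p a₂ c₂ := by
  obtain ⟨u, v, c₁, a₁, b₁, c₂, a₂, b₂, h⟩ := s.val_eq
  refine ⟨u, v, c₁, a₁, b₁, c₂, a₂, b₂, fun p hp => ?_⟩
  rw [← rotCoef_eq hU hF hp.2, ← rotCoef_eq hU hF hp.2]
  exact h _ _ _

theorem domFam_eq_cyl {E : NPExpr} (h : ∀ p ∈ cyl U, E.DefinedAt (G p.1) (T p.1) p.2) :
    domFam U G T E = cyl U :=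
  Set.ext fun p => ⟨fun hp => hp.1, fun hp => ⟨hp, h p hp⟩⟩

theorem domFam_comb {k : ℕ} {O : Set (Fin k → ℂ)} {F : (Fin k → ℂ) → ℂ} {hO : IsOpen O}
    {hF : ContDiffOn ℝ ∞ F O} {E : Fin k → NPExpr} :
    domFam U G T (NPExpr.comb k O F hO hF E)
      = (cyl U ∩ ⋂ i, domFam U G T (E i)) ∩ (fun p i => evalFam G T (E i) p) ⁻¹' O := by
  ext p
  refine ⟨fun h => ⟨⟨h.1, mem_iInter.2 fun i => ⟨h.1, h.2.1 i⟩⟩, h.2.2⟩, fun h => ?_⟩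
  exact ⟨h.1.1, fun i => (mem_iInter.1 h.1.2 i).2, h.2⟩

theorem evalFam_der {E : NPExpr} (hW : IsOpen (domFam U G T E))
    (hE : ContDiffOn ℝ ∞ (evalFam G T E) (domFam U G T E)) (a : Fin 4) {p : ParamPt}
    (hp : p ∈ domFam U G T E) :
    evalFam G T (NPExpr.der a E) p = ∑ i, frM T p i a * sd i (evalFam G T E) p := by
  obtain ⟨t, x⟩ := p
  simp only [← pd_slice (diffAt hW hE hp)]
  rfl

/-- Expressions have open domains and are smooth there, jointly in the parameter and the point. -/
theorem smooth_evalFam (hU : IsOpen U) (hF : IsNPFamilyOn U G T) (E : NPExpr) :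
    IsOpen (domFam U G T E) ∧ ContDiffOn ℝ ∞ (evalFam G T E) (domFam U G T E) := by
  have hΓ := hF.isLeviCivitaOn hU
  have hN := hF.isNullFrameOn
  induction E with
  | spin s =>
    rw [domFam_eq_cyl (E := NPExpr.spin s) fun _ _ => trivial]
    obtain ⟨u, v, c₁, a₁, b₁, c₂, a₂, b₂, h⟩ := evalFam_spin hU hF s
    have r := fun b a c => contDiffOn_entry (contDiffOn_rotFrame hU hΓ hN b) a c
    exact ⟨isOpen_cyl hU, ((contDiffOn_const.mul (r b₁ a₁ c₁)).add
      (contDiffOn_const.mul (r b₂ a₂ c₂))).congr h⟩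
  | riem a b c d =>
    rw [domFam_eq_cyl (E := NPExpr.riem a b c d) fun _ _ => trivial]
    exact ⟨isOpen_cyl hU, (contDiffOn_entry (contDiffOn_riemFrame hU hΓ hN c d) a b).congr
      fun p hp => contract_riemann_eq hU hF hp.2 a b c d⟩
  | der a E ih =>
    refine ⟨ih.1, ContDiffOn.congr (f := fun p => ∑ i, frM T p i a * sd i (evalFam G T E) p) ?_
      fun p hp => evalFam_der ih.1 ih.2 a hp⟩
    exact ContDiffOn.sum fun i _ => ((contDiffOn_entry hF.smooth_e i a).mono fun p hp => hp.1).mul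
      (contDiffOn_sd ih.1 ih.2 i)
  | comb k O F hO hF' E ih =>
    have hs : ContDiffOn ℝ ∞ (fun p i => evalFam G T (E i) p)
        (cyl U ∩ ⋂ i, domFam U G T (E i)) :=
      contDiffOn_pi.2 fun i => (ih i).2.mono fun p hp => mem_iInter.1 hp.2 i
    have ho : IsOpen (cyl U ∩ ⋂ i, domFam U G T (E i)) :=
      (isOpen_cyl hU).inter (isOpen_iInter_of_finite fun i => (ih i).1)
    rw [domFam_comb]
    refine ⟨hs.continuousOn.isOpen_inter_preimage ho hO, ?_⟩
    exact hF'.comp (hs.mono inter_subset_left) fun p hp => hp.2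

/-- If the metric and the tetrad vary along the parameter by their Lie derivatives, then so does
every expression in the NP scalars. -/
theorem flowD_evalFam (hU : IsOpen U) (hF : IsNPFamilyOn U G T) (hξ : ContDiffOn ℝ ∞ ξ U)
    (hg : ∀ x ∈ U, flowD ξ (metM G) x
      = metM G (0, x) * jac ξ x + (jac ξ x)ᵀ * metM G (0, x))
    (he : ∀ x ∈ U, flowD ξ (frM T) x = -(jac ξ x * frM T (0, x)))
    (E : NPExpr) {x : Pt} (hx : (0, x) ∈ domFam U G T E) : flowD ξ (evalFam G T E) x = 0 := by
  have hΓ := hF.isLeviCivitaOn hU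
  have hN := hF.isNullFrameOn
  have hW := isOpen_cyl hU
  induction E generalizing x with
  | spin s =>
    obtain ⟨u, v, c₁, a₁, b₁, c₂, a₂, b₂, h⟩ := evalFam_spin hU hF s
    have d1 := fun b a c => diffAt hW (contDiffOn_entry (contDiffOn_rotFrame hU hΓ hN b) a c) hx.1
    have z : ∀ k b a c, dd (fun p => k * rotFrame (metM G) (chrM G) (frM T) b p a c) (0, x)
        (1, -ξ x) = 0 := by
      intro k b a c
      rw [dd_const_mul _ (d1 b a c), dd_entry (diffAt hW (contDiffOn_rotFrame hU hΓ hN b) hx.1)]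
      have := congrFun (congrFun (flowD_rotFrame hU hΓ hN hξ hg he hx.1.2 b) a) c
      exact (congrArg (k * ·) this).trans (mul_zero _)
    rw [flowD_congr hW h hx.1]
    refine (dd_add ((d1 b₁ a₁ c₁).const_mul u) ((d1 b₂ a₂ c₂).const_mul v) _).trans ?_
    exact (congrArg₂ (· + ·) (z u b₁ a₁ c₁) (z v b₂ a₂ c₂)).trans (add_zero _)
  | riem a b c d =>
    have e : ∀ p ∈ cyl U, evalFam G T (NPExpr.riem a b c d) p
        = riemFrame (metM G) (chrM G) (frM T) c d p a b :=
      fun p hp => contract_riemann_eq hU hF hp.2 a b c d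
    rw [flowD_congr hW e hx.1]
    refine (dd_entry (diffAt hW (contDiffOn_riemFrame hU hΓ hN c d) hx.1) _ a b).trans ?_
    have := flowD_riemFrame (h := fun _ => 0) (M := fun _ => 0) hU hΓ hN hξ contDiffOn_const
      (by simpa using hg) (by simpa using he) hx.1.2 c d
    have hz : hessian (chrM G) (fun _ => 0) x = 0 := by
      funext i l
      have : ∀ l : Fin 4, pd l (fun _ : Pt => (0 : ℂ)) = fun _ => 0 := fun l => by
        funext y; simp [pd]
      simp [hessian, this]
    rw [hz] at this
    refine (congrFun (congrFun this a) b).trans ?_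
    simp [show (Matrix.of (0 : Fin 4 → Fin 4 → ℂ)) = 0 from rfl]
  | der a E ih =>
    obtain ⟨ho, hs⟩ := smooth_evalFam hU hF E
    have hxE : (0, x) ∈ domFam U G T E := hx
    have hxU : x ∈ U := hx.1.2
    have hE := fun p hp => evalFam_der (p := p) ho hs a hp
    have dE := fun i => diffAt hW (contDiffOn_entry hF.smooth_e i a) hx.1
    have dF := fun i => diffAt ho (contDiffOn_sd ho hs i) hxE
    rw [flowD_congr ho hE hxE]
    -- the commutator of `∂_t - ξ^k ∂_k` with `∂_i` cancels the Lie derivative of the tetrad vector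
    have h0 : ∀ i, flowD ξ (sd i (evalFam G T E)) x
        = ∑ s, jac ξ x s i * sd s (evalFam G T E) (0, x) := by
      intro i
      have ho' : IsOpen ((fun y : Pt => ((0 : ℝ), y)) ⁻¹' domFam U G T E) :=
        ho.preimage (by fun_prop)
      rw [flowD_sd ho hs hU hξ hxU hxE, pd_congr ho' (g := fun _ => 0) (fun y hy => ih hy) hxE]
      simp [pd, jac]
    have h1 : ∀ i, flowD ξ (fun p => frM T p i a) x = -∑ s, jac ξ x i s * frM T (0, x) s a := by
      intro i
      refine (dd_entry (diffAt hW hF.smooth_e hx.1) _ i a).trans ?_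
      refine (congrFun (congrFun (he x hxU) i) a).trans ?_
      simp [Matrix.mul_apply]
    have h2 : ∀ i, dd (fun p => frM T p i a * sd i (evalFam G T E) p) (0, x) (1, -ξ x)
        = (-∑ s, jac ξ x i s * frM T (0, x) s a) * sd i (evalFam G T E) (0, x)
          + frM T (0, x) i a * ∑ s, jac ξ x s i * sd s (evalFam G T E) (0, x) := by
      intro i
      rw [← h0, ← h1]
      exact dd_mul (dE i) (dF i) _
    refine (dd_sum (fun i _ => (dE i).mul (dF i)) _).trans
      ((Finset.sum_congr rfl fun i _ => h2 i).trans ?_)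
    rw [Finset.sum_add_distrib]
    simp only [Finset.mul_sum, neg_mul, Finset.sum_neg_distrib, Finset.sum_mul]
    conv_lhs => rw [Finset.sum_comm]
    rw [neg_add_eq_zero]
    refine Finset.sum_congr rfl fun i _ => Finset.sum_congr rfl fun s _ => ?_
    ring
  | comb k O F hO hF' E ih =>
    have hx' := hx
    rw [domFam_comb] at hx'
    have hd : ∀ i, HasFDerivAt (evalFam G T (E i)) (fderiv ℝ (evalFam G T (E i)) (0, x)) (0, x) :=
      fun i => (diffAt (smooth_evalFam hU hF (E i)).1 (smooth_evalFam hU hF (E i)).2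
        (mem_iInter.1 hx'.1.2 i)).hasFDerivAt
    have hF0 := (diffAt hO hF' hx'.2).hasFDerivAt
    have hc := hF0.comp ((0 : ℝ), x) (hasFDerivAt_pi.2 hd)
    refine (dd_of_hasFDerivAt hc _).trans ?_
    have : (ContinuousLinearMap.pi fun i => fderiv ℝ (evalFam G T (E i)) (0, x)) (1, -ξ x) = 0 := by
      funext i
      exact ih i (mem_iInter.1 hx'.1.2 i)
    rw [ContinuousLinearMap.comp_apply, this, map_zero]

end Expressions

/-! ### The conformal family of a conformal Killing vector -/

section ConformalFamily

variable {U : Set Pt} {g : MetricField} {T : Pt → Tetrad} {ξ : Pt → Fin 4 → ℝ} {φ : Pt → ℝ}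

theorem contDiffOn_snd {F : Type*} [NormedAddCommGroup F] [NormedSpace ℝ F] {f : Pt → F}
    (hf : ContDiffOn ℝ ∞ f U) : ContDiffOn ℝ ∞ (fun p : ParamPt => f p.2) (cyl U) :=
  hf.comp (f := fun p : ParamPt => p.2) (by fun_prop) fun _ hp => hp.2

theorem contDiffOn_frame (hT : IsNPTetradOn U g T) (a i : Fin 4) :
    ContDiffOn ℝ ∞ (fun x => (T x).frame a i) U := by
  fin_cases a
  · exact contDiffOn_ofReal (contDiffOn_pi.1 hT.smooth_l i)
  · exact contDiffOn_ofReal (contDiffOn_pi.1 hT.smooth_n i)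
  · exact contDiffOn_pi.1 hT.smooth_m i
  · exact Complex.conjCLE.contDiff.comp_contDiffOn (contDiffOn_pi.1 hT.smooth_m i)

/-- A tetrad field as a constant family. -/
theorem static_family (hT : IsNPTetradOn U g T) : IsNPFamilyOn U (fun _ => g) (fun _ => T) where
  smooth_g := contDiffOn_matrix fun i j => contDiffOn_ofReal (contDiffOn_snd (hT.smooth_g i j))
  smooth_e := contDiffOn_matrix fun i a => contDiffOn_snd (contDiffOn_frame hT a i)
  symm _ x hx := hT.symm x hx
  null _ x hx := hT.null x hx

/-- The conformal factors `exp (t φ / 2)`. -/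
def confFactor (φ : Pt → ℝ) (t : ℝ) (x : Pt) : ℝ := Real.exp (t * (φ x / 2))

theorem confFactor_pos (φ : Pt → ℝ) (t : ℝ) (x : Pt) : 0 < confFactor φ t x := Real.exp_pos _

theorem confFactor_zero (φ : Pt → ℝ) : confFactor φ 0 = fun _ => 1 := by
  funext x; simp [confFactor]

theorem rescaleTetrad_frame (Ω : Pt → ℝ) (T : Pt → Tetrad) (x : Pt) (a i : Fin 4) :
    (rescaleTetrad Ω T x).frame a i = (((Ω x)⁻¹ : ℝ) : ℂ) * (T x).frame a i := by
  fin_cases a <;> simp [rescaleTetrad, Tetrad.frame]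

theorem isNullTetrad_rescale {G : Matrix (Fin 4) (Fin 4) ℝ} {Ω : Pt → ℝ} {x : Pt}
    (hΩ : Ω x ≠ 0) (h : IsNullTetrad G (T x)) :
    IsNullTetrad (Ω x ^ 2 • G) (rescaleTetrad Ω T x) := by
  intro a b
  rw [← h a b]
  refine Finset.sum_congr rfl fun i _ => Finset.sum_congr rfl fun j _ => ?_
  have : ((Ω x : ℝ) : ℂ) ≠ 0 := by exact_mod_cast hΩ
  rw [rescaleTetrad_frame, rescaleTetrad_frame, Matrix.smul_apply, smul_eq_mul]
  push_cast
  field_simp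

theorem rescaleMetric_one (g : MetricField) : rescaleMetric (fun _ => 1) g = g := by
  funext x; simp [rescaleMetric]

theorem rescaleTetrad_one (T : Pt → Tetrad) : rescaleTetrad (fun _ => 1) T = T := by
  funext x; simp [rescaleTetrad]

theorem contDiffOn_confFactor (hφ : ContDiffOn ℝ ∞ φ U) :
    ContDiffOn ℝ ∞ (fun p : ParamPt => confFactor φ p.1 p.2) (cyl U) :=
  (contDiff_fst.contDiffOn.mul ((contDiffOn_snd hφ).div_const 2)).exp

/-- The conformal family `Ω² g`, `Ω⁻¹ e` with `Ω = exp (t φ / 2)`. -/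
theorem conformal_family (hT : IsNPTetradOn U g T) (hφ : ContDiffOn ℝ ∞ φ U) :
    IsNPFamilyOn U (fun t => rescaleMetric (confFactor φ t) g)
      (fun t => rescaleTetrad (confFactor φ t) T) where
  smooth_g := contDiffOn_matrix fun i j =>
    contDiffOn_ofReal (((contDiffOn_confFactor hφ).pow 2).mul (contDiffOn_snd (hT.smooth_g i j)))
  smooth_e := by
    refine contDiffOn_matrix fun i a => ?_
    simp only [frM, Matrix.of_apply, rescaleTetrad_frame]
    exact (contDiffOn_ofReal ((contDiffOn_confFactor hφ).inv
      fun p _ => (confFactor_pos φ p.1 p.2).ne')).mul (contDiffOn_snd (contDiffOn_frame hT a i))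
  symm t x hx := by
    unfold Matrix.IsSymm rescaleMetric
    rw [Matrix.transpose_smul, hT.symm x hx]
  null t x hx := isNullTetrad_rescale (confFactor_pos φ t x).ne' (hT.null x hx)

/-- The derivative along `∂_t` of a function that depends exponentially on `t`. -/
theorem dd_exp_param {f : ParamPt → ℂ} {x : Pt} {c z : ℂ} (hf : DifferentiableAt ℝ f (0, x))
    (h : ∀ᶠ t : ℝ in nhds 0, f (t, x) = Complex.exp (t * c) * z) :
    dd f (0, x) (1, 0) = c * z := by
  have h1 : HasDerivAt (fun t : ℝ => f (t, x)) (dd f (0, x) (1, 0)) 0 := by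
    have h2 : HasDerivAt (fun t : ℝ => (t, x)) ((1 : ℝ), (0 : Pt)) 0 :=
      (hasDerivAt_id (0 : ℝ)).prodMk (hasDerivAt_const (0 : ℝ) x)
    exact hf.hasFDerivAt.comp_hasDerivAt (0 : ℝ) h2
  have h3 : HasDerivAt (fun t : ℝ => Complex.exp (t * c) * z) (c * z) 0 := by
    have := ((Complex.ofRealCLM.hasDerivAt (x := (0 : ℝ))).mul_const c).cexp.mul_const z
    simpa using this
  exact h1.unique (h3.congr_of_eventuallyEq h)

theorem flowD_eq_dd {F : Type*} [NormedAddCommGroup F] [NormedSpace ℝ F] {f : ParamPt → F}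
    {x : Pt} : flowD ξ f x = dd f (0, x) (1, 0) - ∑ s, ξ x s • sd s f (0, x) := flowD_eq

theorem lieD_slice {f : ParamPt → ℂ} {x : Pt} (hf : DifferentiableAt ℝ f (0, x)) :
    lieD ξ (fun y => f (0, y)) x = ∑ s, ξ x s • sd s f (0, x) := by
  simp [lieD, dirD, pd_slice hf]

theorem dirD_coord (X : Pt → Fin 4 → ℂ) (i : Fin 4) : dirD X (coord i) = fun x => X x i := by
  funext x
  have h : ∀ k, pd k (coord i) x = ((Pi.single k 1 : Fin 4 → ℝ) i : ℂ) := fun k =>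
    (dd_clm_comp (Complex.ofRealCLM.comp (ContinuousLinearMap.proj (R := ℝ)
      (φ := fun _ : Fin 4 => ℝ) i)) (f := id) differentiableAt_id (Pi.single k 1)).trans
      (by simp [dd])
  unfold dirD
  rw [Finset.sum_eq_single i, h i, Pi.single_eq_same, Complex.ofReal_one, mul_one]
  · intro k _ hk
    rw [h k, Pi.single_eq_of_ne hk.symm, Complex.ofReal_zero, mul_zero]
  · simp

theorem lieD_coord (ξ : Pt → Fin 4 → ℝ) (i : Fin 4) : lieD ξ (coord i) = fun x => (ξ x i : ℂ) :=
  dirD_coord _ i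

theorem npD_coord (T : Pt → Tetrad) (a i : Fin 4) :
    npD T a (coord i) = fun x => (T x).frame a i :=
  dirD_coord _ i

/-- The NP-Lie commutator equations in components. -/
def CommutatorEqs (U : Set Pt) (T : Pt → Tetrad) (ξ : Pt → Fin 4 → ℝ) (φ : Pt → ℝ) : Prop :=
  ∀ a i : Fin 4, ∀ x ∈ U, npD T a (lieD ξ (coord i)) x - lieD ξ (npD T a (coord i)) x
    = (φ x : ℂ) / 2 * npD T a (coord i) x

theorem commutatorEqs_iff (hU : IsOpen U) (hξ : ContDiffOn ℝ ∞ ξ U) :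
    CommutatorEqs U T ξ φ ↔ ∀ a i : Fin 4, ∀ x ∈ U,
      ∑ k, jac ξ x i k * (T x).frame a k - ∑ k, ξ x k * pd k (fun y => (T y).frame a i) x
        = (φ x : ℂ) / 2 * (T x).frame a i := by
  refine forall_congr' fun a => forall_congr' fun i => forall_congr' fun x =>
    forall_congr' fun hx => ?_
  have h : ∀ k, pd k (fun y => (ξ y i : ℂ)) x = jac ξ x i k := fun k =>
    ofReal_pd (diffAt hU (contDiffOn_pi.1 hξ i) hx) k
  rw [lieD_coord, npD_coord]
  simp only [npD, lieD, dirD, h, mul_comm (jac ξ x i _)]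

theorem flowD_metM_conformal (hU : IsOpen U) (hT : IsNPTetradOn U g T)
    (hφ : ContDiffOn ℝ ∞ φ U) (hK : IsConformalKilling U g ξ φ)
    {x : Pt} (hx : x ∈ U) :
    flowD ξ (metM fun t => rescaleMetric (confFactor φ t) g) x
      = metM (fun t => rescaleMetric (confFactor φ t) g) (0, x) * jac ξ x
        + (jac ξ x)ᵀ * metM (fun t => rescaleMetric (confFactor φ t) g) (0, x) := by
  have hF := conformal_family hT hφ
  have hW := isOpen_cyl hU
  have hp := mem_cyl hx 0
  ext i j
  have de := diffAt hW (contDiffOn_entry hF.smooth_g i j) hp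
  have d := diffAt hW hF.smooth_g hp
  have h0 : rescaleMetric (confFactor φ 0) g = g := by rw [confFactor_zero, rescaleMetric_one]
  have e1 : dd (fun p => metM (fun t => rescaleMetric (confFactor φ t) g) p i j) (0, x) (1, 0)
      = (φ x : ℂ) * (g x i j : ℂ) := by
    refine dd_exp_param de (Filter.Eventually.of_forall fun t => ?_)
    simp only [metM, rescaleMetric, confFactor, Matrix.of_apply, Matrix.smul_apply, smul_eq_mul,
      ← Real.exp_nat_mul]
    push_cast
    congr 2
    ring
  have e2 : ∀ s, sd s (metM fun t => rescaleMetric (confFactor φ t) g) (0, x) i j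
      = ((pd s (fun y => g y i j) x : ℝ) : ℂ) := by
    intro s
    rw [← pd_metric hU hF hx, h0]
  have e3 := (dd_entry d (1, -ξ x) i j).symm.trans
    (flowD_eq_dd (ξ := ξ) (f := fun p => metM (fun t => rescaleMetric (confFactor φ t) g) p i j)
      (x := x))
  refine e3.trans ?_
  have e4 : ∀ s, sd s (fun p => metM (fun t => rescaleMetric (confFactor φ t) g) p i j) (0, x)
      = ((pd s (fun y => g y i j) x : ℝ) : ℂ) := fun s => (dd_entry d _ i j).trans (e2 s)
  have hk := congrArg Complex.ofReal (hK x hx i j)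
  push_cast at hk
  simp only [e1, e4]
  simp only [← hk, Matrix.add_apply, Matrix.mul_apply, Matrix.transpose_apply, metM, h0,
    Matrix.of_apply, jac, Complex.real_smul, Finset.sum_add_distrib]
  simp only [mul_comm (((pd i _ x : ℝ) : ℂ))]
  ring

theorem flowD_frM_conformal (hU : IsOpen U) (hT : IsNPTetradOn U g T)
    (hφ : ContDiffOn ℝ ∞ φ U) (hξ : ContDiffOn ℝ ∞ ξ U) (hC : CommutatorEqs U T ξ φ)
    {x : Pt} (hx : x ∈ U) :
    flowD ξ (frM fun t => rescaleTetrad (confFactor φ t) T) x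
      = -(jac ξ x * frM (fun t => rescaleTetrad (confFactor φ t) T) (0, x)) := by
  have hF := conformal_family hT hφ
  have hW := isOpen_cyl hU
  have hp := mem_cyl hx 0
  ext i a
  have de := diffAt hW (contDiffOn_entry hF.smooth_e i a) hp
  have d := diffAt hW hF.smooth_e hp
  have h0 : rescaleTetrad (confFactor φ 0) T = T := by rw [confFactor_zero, rescaleTetrad_one]
  have e1 : dd (fun p => frM (fun t => rescaleTetrad (confFactor φ t) T) p i a) (0, x) (1, 0)
      = (-(φ x : ℂ) / 2) * (T x).frame a i := by
    refine dd_exp_param de (Filter.Eventually.of_forall fun t => ?_)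
    simp only [frM, Matrix.of_apply, rescaleTetrad_frame, confFactor, ← Real.exp_neg]
    push_cast
    congr 2
    ring
  have e4 : ∀ s, sd s (fun p => frM (fun t => rescaleTetrad (confFactor φ t) T) p i a) (0, x)
      = pd s (fun y => (T y).frame a i) x := by
    intro s
    rw [← pd_slice de]
    simp only [frM, h0, Matrix.of_apply]
  refine ((dd_entry d (1, -ξ x) i a).symm.trans (flowD_eq_dd (ξ := ξ)
    (f := fun p => frM (fun t => rescaleTetrad (confFactor φ t) T) p i a) (x := x))).trans ?_
  have hc := (commutatorEqs_iff hU hξ).1 hC a i x hx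
  simp only [e1, e4]
  simp only [Matrix.neg_apply, Matrix.mul_apply, frM, h0, Matrix.of_apply,
    Complex.real_smul]
  linear_combination hc

/-- An expression that scales as `Ω ^ w` along the conformal family of a conformal Killing vector
is Lie recurrent with weight `w`. -/
theorem lieRecurrentOn_of_scalesWith (hU : IsOpen U) (hT : IsNPTetradOn U g T)
    (hφ : ContDiffOn ℝ ∞ φ U) (hξ : ContDiffOn ℝ ∞ ξ U) (hK : IsConformalKilling U g ξ φ)
    (hC : CommutatorEqs U T ξ φ) {E : NPExpr} {w : ℝ}
    (hE : ∀ t, E.ScalesWith U g T w (confFactor φ t)) :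
    LieRecurrentOn (E.domain U g T) ξ φ w (E.eval g T) := by
  intro x hx
  have hF := conformal_family hT hφ
  obtain ⟨ho, hs⟩ := smooth_evalFam hU hF E
  have hg0 : rescaleMetric (confFactor φ 0) g = g := by rw [confFactor_zero, rescaleMetric_one]
  have hT0 : rescaleTetrad (confFactor φ 0) T = T := by rw [confFactor_zero, rescaleTetrad_one]
  have hp : (0, x) ∈ domFam U (fun t => rescaleMetric (confFactor φ t) g)
      (fun t => rescaleTetrad (confFactor φ t) T) E := by
    refine ⟨mem_cyl hx.1 0, ?_⟩
    simp only [hg0, hT0]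
    exact hx.2
  have hd := diffAt ho hs hp
  have h1 := flowD_evalFam hU hF hξ (fun x hx => flowD_metM_conformal hU hT hφ hK hx)
    (fun x hx => flowD_frM_conformal hU hT hφ hξ hC hx) E hp
  rw [flowD_eq_dd, ← lieD_slice hd, sub_eq_zero] at h1
  have h2 : (fun y => evalFam (fun t => rescaleMetric (confFactor φ t) g)
      (fun t => rescaleTetrad (confFactor φ t) T) E (0, y)) = E.eval g T := by
    funext y; simp only [evalFam, hg0, hT0]
  rw [h2] at h1
  rw [← h1, dd_exp_param (c := w * (φ x / 2)) (z := E.eval g T x) hd, sub_self]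
  -- the rescaled expression is defined at `x` for small `t` only
  have hev : ∀ᶠ t : ℝ in nhds 0, (t, x) ∈ domFam U (fun t => rescaleMetric (confFactor φ t) g)
      (fun t => rescaleTetrad (confFactor φ t) T) E :=
    (Continuous.prodMk_left x).continuousAt.eventually (ho.mem_nhds hp)
  filter_upwards [hev] with t ht
  refine (hE t x hx ⟨hx.1, ht.2⟩).trans ?_
  rw [confFactor, ← Real.exp_mul]
  push_cast
  congr 2
  ring

end ConformalFamily

/-! ### Weyl scalars under infinitesimal rotations of the frame -/

section WeylAlgebra

/-- Covariant 4-tensors, by their components in a null frame. -/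
abbrev FrameTensor : Type := Fin 4 → Fin 4 → Fin 4 → Fin 4 → ℂ

/-- The algebraic symmetries of a curvature tensor. -/
structure IsCurvatureTensor (R : FrameTensor) : Prop where
  antisymm_fst : ∀ a b c d, R a b c d = -R b a c d
  antisymm_snd : ∀ a b c d, R a b c d = -R a b d c
  bianchi : ∀ a b c d, R a b c d + R a c d b + R a d b c = 0

theorem IsCurvatureTensor.pair_symm {R : FrameTensor} (hR : IsCurvatureTensor R)
    (a b c d : Fin 4) : R a b c d = R c d a b := by
  have h1 := hR.antisymm_fst
  have h2 := hR.antisymm_snd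
  have h3 := hR.bianchi
  linear_combination (1 / 2) * (h3 a b c d - h3 b c d a - h3 c d a b + h3 d a b c)
    + (1 / 2) * (h1 b c d a + h1 b d a c + h1 b a c d + h1 c a b d - h2 a c b d - h1 c d a b
      - h2 d b a c - h1 a d b c)

/-- The trace `η^{pq} R_{qbpd}` over the null frame. -/
def frameRicci (R : FrameTensor) (b d : Fin 4) : ℂ :=
  R 1 b 0 d + R 0 b 1 d - R 3 b 2 d - R 2 b 3 d

/-- The trace of the Ricci tensor over the null frame. -/
def frameScalar (R : FrameTensor) : ℂ :=
  frameRicci R 0 1 + frameRicci R 1 0 - frameRicci R 2 3 - frameRicci R 3 2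

/-- The null frame components of the Weyl tensor. -/
def frameWeyl (R : FrameTensor) (a b c d : Fin 4) : ℂ :=
  R a b c d - (1 / 2) * (nullProducts a c * frameRicci R b d - nullProducts a d * frameRicci R b c
      + nullProducts b d * frameRicci R a c - nullProducts b c * frameRicci R a d)
    + frameScalar R / 6 * (nullProducts a c * nullProducts b d - nullProducts a d * nullProducts b c)

/-- The Weyl scalars as linear functions of the curvature components. -/
def framePsi (R : FrameTensor) : Fin 5 → ℂ :=
  ![-frameWeyl R 0 2 0 2, -frameWeyl R 0 1 0 2, -frameWeyl R 0 2 3 1, -frameWeyl R 0 1 3 1,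
    -frameWeyl R 1 3 1 3]

/-- The variation of the curvature components under an infinitesimal rotation `M` of the frame
and a conformal variation of the metric by the factor `-φ`; `H` stands for the second covariant
derivative of `-φ`. -/
def varTensor (M : Matrix (Fin 4) (Fin 4) ℂ) (φ : ℂ) (H : Fin 4 → Fin 4 → ℂ) (R : FrameTensor) :
    FrameTensor := fun a b c d =>
  ∑ e, M a e * R e b c d + ∑ e, M b e * R a e c d + ∑ e, M c e * R a b e d
    + ∑ e, M d e * R a b c e - φ * R a b c d
    + (1 / 2) * (H c b * nullProducts a d - H c a * nullProducts d b - H d b * nullProducts a c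
      + H d a * nullProducts c b)

theorem nullProducts_entries : nullProducts 0 0 = 0 ∧ nullProducts 0 1 = 1 ∧ nullProducts 0 2 = 0 ∧
    nullProducts 0 3 = 0 ∧ nullProducts 1 0 = 1 ∧ nullProducts 1 1 = 0 ∧ nullProducts 1 2 = 0 ∧
    nullProducts 1 3 = 0 ∧ nullProducts 2 0 = 0 ∧ nullProducts 2 1 = 0 ∧ nullProducts 2 2 = 0 ∧
    nullProducts 2 3 = -1 ∧ nullProducts 3 0 = 0 ∧ nullProducts 3 1 = 0 ∧ nullProducts 3 2 = -1 ∧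
    nullProducts 3 3 = 0 := by
  simp [nullProducts]

/-- `M` is an infinitesimal rotation of the null frame, composed with a dilation: the
equation `M η + η Mᵀ = φ η` in components. -/
structure IsConformalRotation (M : Matrix (Fin 4) (Fin 4) ℂ) (φ : ℂ) : Prop where
  h01 : M 0 1 = 0
  h10 : M 1 0 = 0
  h23 : M 2 3 = 0
  h32 : M 3 2 = 0
  h11 : M 1 1 = φ - M 0 0
  h33 : M 3 3 = φ - M 2 2
  h20 : M 2 0 = M 1 3
  h30 : M 3 0 = M 1 2
  h21 : M 2 1 = M 0 3
  h31 : M 3 1 = M 0 2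

/-- The variation of the Weyl scalars is linear in the rotation, and the second covariant derivative
of the conformal function does not contribute. -/
theorem framePsi_varTensor {R : FrameTensor} (hR : IsCurvatureTensor R)
    {M : Matrix (Fin 4) (Fin 4) ℂ} {φ : ℂ} (hM : IsConformalRotation M φ) {H : Fin 4 → Fin 4 → ℂ}
    (hH : ∀ a b, H a b = H b a) :
    framePsi (varTensor M φ H R) 0
        = (2 * (M 0 0 + M 2 2) - φ) * framePsi R 0 + 4 * M 0 3 * framePsi R 1 ∧
    framePsi (varTensor M φ H R) 1
        = (M 0 0 + M 2 2) * framePsi R 1 + 3 * M 0 3 * framePsi R 2 + M 1 2 * framePsi R 0 ∧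
    framePsi (varTensor M φ H R) 3
        = (M 1 1 + M 3 3) * framePsi R 3 + 3 * M 1 2 * framePsi R 2 + M 0 3 * framePsi R 4 ∧
    framePsi (varTensor M φ H R) 4
        = (2 * (M 1 1 + M 3 3) - φ) * framePsi R 4 + 4 * M 1 2 * framePsi R 3 := by
  obtain ⟨n00, n01, n02, n03, n10, n11, n12, n13, n20, n21, n22, n23, n30, n31, n32, n33⟩ :=
    nullProducts_entries
  have z1 : ∀ a c d, R a a c d = 0 := fun a c d => by
    linear_combination (1 / 2) * hR.antisymm_fst a a c d
  have z2 : ∀ a b c, R a b c c = 0 := fun a b c => by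
    linear_combination (1 / 2) * hR.antisymm_snd a b c c
  have a10 := hR.antisymm_fst 1 0
  have a20 := hR.antisymm_fst 2 0
  have a30 := hR.antisymm_fst 3 0
  have a21 := hR.antisymm_fst 2 1
  have a31 := hR.antisymm_fst 3 1
  have a32 := hR.antisymm_fst 3 2
  have b10 := fun a b => hR.antisymm_snd a b 1 0
  have b20 := fun a b => hR.antisymm_snd a b 2 0
  have b30 := fun a b => hR.antisymm_snd a b 3 0
  have b21 := fun a b => hR.antisymm_snd a b 2 1
  have b31 := fun a b => hR.antisymm_snd a b 3 1
  have b32 := fun a b => hR.antisymm_snd a b 3 2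
  have p1 := hR.pair_symm 0 2 0 1
  have p2 := hR.pair_symm 0 3 0 1
  have p3 := hR.pair_symm 1 2 0 1
  have p4 := hR.pair_symm 1 3 0 1
  have p5 := hR.pair_symm 2 3 0 1
  have p6 := hR.pair_symm 0 3 0 2
  have p7 := hR.pair_symm 1 2 0 2
  have p8 := hR.pair_symm 1 3 0 2
  have p9 := hR.pair_symm 2 3 0 2
  have p10 := hR.pair_symm 1 2 0 3
  have p11 := hR.pair_symm 1 3 0 3
  have p12 := hR.pair_symm 2 3 0 3
  have p13 := hR.pair_symm 1 3 1 2
  have p14 := hR.pair_symm 2 3 1 2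
  have p15 := hR.pair_symm 2 3 1 3
  have bi : R 0 1 2 3 = R 0 2 1 3 - R 0 3 1 2 := by
    linear_combination hR.bianchi 0 1 2 3 - b31 0 2
  have H1 := hH 1 0
  have H2 := hH 2 0
  have H3 := hH 3 0
  have H4 := hH 2 1
  have H5 := hH 3 1
  have H6 := hH 3 2
  have P0 : ∀ R, framePsi R 0 = -frameWeyl R 0 2 0 2 := fun _ => rfl
  have P1 : ∀ R, framePsi R 1 = -frameWeyl R 0 1 0 2 := fun _ => rfl
  have P2 : ∀ R, framePsi R 2 = -frameWeyl R 0 2 3 1 := fun _ => rfl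
  have P3 : ∀ R, framePsi R 3 = -frameWeyl R 0 1 3 1 := fun _ => rfl
  have P4 : ∀ R, framePsi R 4 = -frameWeyl R 1 3 1 3 := fun _ => rfl
  -- all components are reduced to the independent ones by the symmetries; then the claims are
  -- polynomial identities
  simp only [P0, P1, P2, P3, P4, frameWeyl, frameScalar, frameRicci, varTensor, Fin.sum_univ_four,
    n00, n01, n02, n03, n10, n11, n12, n13, n20, n21, n22, n23, n30, n31, n32, n33,
    z1, z2, a10, a20, a30, a21, a31, a32, b10, b20, b30, b21, b31, b32, p1, p2, p3, p4, p5, p6,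
    p7, p8, p9, p10, p11, p12, p13, p14, p15, bi, H1, H2, H3, H4, H5, H6,
    hM.h01, hM.h10, hM.h23, hM.h32, hM.h11, hM.h33, hM.h20, hM.h30, hM.h21, hM.h31]
  refine ⟨?_, ?_, ?_, ?_⟩ <;> ring

end WeylAlgebra

/-! ### Weyl scalars as functions of the tetrad components of the curvature -/

section WeylFrame

/-- The value of a bilinear form on two complex vectors. -/
def bil (P : Fin 4 → Fin 4 → ℝ) (X Y : Fin 4 → ℂ) : ℂ := ∑ i, ∑ j, (P i j : ℂ) * X i * Y j

theorem contract_add (R S : Fin 4 → Fin 4 → Fin 4 → Fin 4 → ℝ) (X Y Z W : Fin 4 → ℂ) :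
    contract (fun a b c d => R a b c d + S a b c d) X Y Z W
      = contract R X Y Z W + contract S X Y Z W := by
  simp only [contract, Complex.ofReal_add, add_mul, Finset.sum_add_distrib]

theorem contract_const_mul (r : ℝ) (R : Fin 4 → Fin 4 → Fin 4 → Fin 4 → ℝ)
    (X Y Z W : Fin 4 → ℂ) :
    contract (fun a b c d => r * R a b c d) X Y Z W = r * contract R X Y Z W := by
  simp only [contract, Complex.ofReal_mul, Finset.mul_sum, mul_assoc]

theorem contract_sub (R S : Fin 4 → Fin 4 → Fin 4 → Fin 4 → ℝ) (X Y Z W : Fin 4 → ℂ) :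
    contract (fun a b c d => R a b c d - S a b c d) X Y Z W
      = contract R X Y Z W - contract S X Y Z W := by
  simp only [contract, Complex.ofReal_sub, sub_mul, Finset.sum_sub_distrib]

theorem contract_prod_ac_bd (P Q : Fin 4 → Fin 4 → ℝ) (X Y Z W : Fin 4 → ℂ) :
    contract (fun a b c d => P a c * Q b d) X Y Z W = bil P X Z * bil Q Y W := by
  unfold bil
  rw [← sum_prod_inner]
  refine Finset.sum_congr rfl fun a _ => Finset.sum_congr rfl fun b _ =>
    Finset.sum_congr rfl fun c _ => Finset.sum_congr rfl fun d _ => ?_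
  push_cast; ring

theorem contract_prod_ad_bc (P Q : Fin 4 → Fin 4 → ℝ) (X Y Z W : Fin 4 → ℂ) :
    contract (fun a b c d => P a d * Q b c) X Y Z W = bil P X W * bil Q Y Z := by
  unfold bil
  rw [Finset.sum_comm (f := fun i j => (Q i j : ℂ) * Y i * Z j), ← sum_prod_outer]
  refine Finset.sum_congr rfl fun a _ => Finset.sum_congr rfl fun b _ =>
    Finset.sum_congr rfl fun c _ => Finset.sum_congr rfl fun d _ => ?_
  push_cast; ring

/-- The tetrad components of the Riemann tensor at a point. -/
def tetradRiem (g : MetricField) (x : Pt) (t : Tetrad) : FrameTensor := fun a b c d =>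
  contract (riemann g x) (t.frame a) (t.frame b) (t.frame c) (t.frame d)

variable {g : MetricField} {x : Pt} {t : Tetrad}

theorem inv_metric_eq (h : IsNullTetrad (g x) t) (k s : Fin 4) :
    (((g x)⁻¹ k s : ℝ) : ℂ) = t.frame 0 k * t.frame 1 s + t.frame 1 k * t.frame 0 s
      - t.frame 2 k * t.frame 3 s - t.frame 3 k * t.frame 2 s := by
  obtain ⟨n00, n01, n02, n03, n10, n11, n12, n13, n20, n21, n22, n23, n30, n31, n32, n33⟩ :=
    nullProducts_entries
  rw [inv_of_nullTetrad h]
  simp only [Matrix.mul_apply, Matrix.transpose_apply, Matrix.of_apply, Fin.sum_univ_four,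
    n00, n01, n02, n03, n10, n11, n12, n13, n20, n21, n22, n23, n30, n31, n32, n33]
  ring

theorem ricci_cast (h : IsNullTetrad (g x) t) (l j : Fin 4) :
    ((ricci g x l j : ℝ) : ℂ) = ∑ k, ∑ s, (((g x)⁻¹ k s : ℝ) : ℂ) * (riemann g x s l k j : ℂ) := by
  have hd := isUnit_iff_ne_zero.2 (det_ne_zero_of_nullTetrad h)
  have e : ∀ k, riemannUp g k l k j x = ∑ s, (g x)⁻¹ k s * riemann g x s l k j := by
    intro k
    have h1 : (fun s => riemann g x s l k j) = (g x) *ᵥ fun s => riemannUp g s l k j x := rfl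
    have h2 := congrFun (congrArg ((g x)⁻¹ *ᵥ ·) h1) k
    simp only [Matrix.mulVec_mulVec, Matrix.nonsing_inv_mul _ hd, Matrix.one_mulVec] at h2
    exact h2.symm
  simp only [ricci, e]
  push_cast
  rfl

theorem bil_ricci (h : IsNullTetrad (g x) t) (b d : Fin 4) :
    bil (ricci g x) (t.frame b) (t.frame d) = frameRicci (tetradRiem g x t) b d := by
  simp only [bil, ricci_cast h, inv_metric_eq h, frameRicci, tetradRiem, contract,
    ← Finset.sum_add_distrib, ← Finset.sum_sub_distrib, Finset.sum_mul]
  conv_rhs => rw [Finset.sum_comm]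
  refine Finset.sum_congr rfl fun l _ => ?_
  conv_rhs => rw [Finset.sum_congr rfl fun s _ => Finset.sum_comm]
  conv_rhs => rw [Finset.sum_comm]
  refine Finset.sum_congr rfl fun j _ => ?_
  rw [Finset.sum_comm]
  refine Finset.sum_congr rfl fun s _ => Finset.sum_congr rfl fun k _ => ?_
  ring

theorem scalarCurv_cast (h : IsNullTetrad (g x) t) :
    ((scalarCurv g x : ℝ) : ℂ) = frameScalar (tetradRiem g x t) := by
  simp only [frameScalar, ← bil_ricci h, bil, ← Finset.sum_add_distrib,
    ← Finset.sum_sub_distrib, scalarCurv]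
  push_cast
  simp only [inv_metric_eq h]
  refine Finset.sum_congr rfl fun l _ => Finset.sum_congr rfl fun j _ => ?_
  ring

theorem bil_metric (h : IsNullTetrad (g x) t) (a b : Fin 4) :
    bil (g x) (t.frame a) (t.frame b) = nullProducts a b := h a b

theorem contract_weyl (h : IsNullTetrad (g x) t) (a b c d : Fin 4) :
    contract (weyl g x) (t.frame a) (t.frame b) (t.frame c) (t.frame d)
      = frameWeyl (tetradRiem g x t) a b c d := by
  have e : weyl g x = fun a b c d => riemann g x a b c d
      - (1 / 2) * (g x a c * ricci g x b d - g x a d * ricci g x b c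
        + ricci g x a c * g x b d - ricci g x a d * g x b c)
      + scalarCurv g x / 6 * (g x a c * g x b d - g x a d * g x b c) := by
    funext a b c d
    simp only [weyl]
    ring
  rw [e, contract_add, contract_sub, contract_const_mul, contract_const_mul, contract_sub,
    contract_add, contract_sub, contract_sub, contract_prod_ac_bd (g x) (ricci g x),
    contract_prod_ad_bc (g x) (ricci g x), contract_prod_ac_bd (ricci g x) (g x),
    contract_prod_ad_bc (ricci g x) (g x), contract_prod_ac_bd (g x) (g x),
    contract_prod_ad_bc (g x) (g x)]
  push_cast
  simp only [bil_metric h, bil_ricci h, scalarCurv_cast h, frameWeyl]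
  rw [show contract (riemann g x) (t.frame a) (t.frame b) (t.frame c) (t.frame d)
    = tetradRiem g x t a b c d from rfl]
  ring

theorem weylScalar_eq (h : IsNullTetrad (g x) t) :
    weylScalar g x t = framePsi (tetradRiem g x t) := by
  simp only [weylScalar, contract_weyl h, framePsi]

theorem framePsi_add (R S : FrameTensor) : framePsi (R + S) = framePsi R + framePsi S := by
  funext k
  fin_cases k <;>
  · simp [framePsi, frameWeyl, frameScalar, frameRicci]
    ring

theorem framePsi_smul (r : ℝ) (R : FrameTensor) : framePsi (r • R) = r • framePsi R := by
  funext k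
  fin_cases k <;>
  · simp [framePsi, frameWeyl, frameScalar, frameRicci]
    ring

/-- A Weyl scalar as a continuous linear functional of the curvature components. -/
def framePsiCLM (k : Fin 5) : FrameTensor →L[ℝ] ℂ :=
  LinearMap.toContinuousLinearMap
    { toFun := fun R => framePsi R k
      map_add' := fun R S => congrFun (framePsi_add R S) k
      map_smul' := fun r R => congrFun (framePsi_smul r R) k }

end WeylFrame

/-! ### Nondegeneracy of the canonical form of type I -/

section PetrovAlgebra

/-- Pairwise distinct points of the projective line, at least three in number, are not all zeros of
one of two nontrivial linear forms. -/
theorem not_two_lines {z w : Fin 4 → ℂ} (h : ∀ i j, i ≠ j → z i * w j ≠ z j * w i)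
    {α β γ δ : ℂ} (h1 : α ≠ 0 ∨ β ≠ 0) (h2 : γ ≠ 0 ∨ δ ≠ 0)
    (hz : ∀ i, α * z i + β * w i = 0 ∨ γ * z i + δ * w i = 0) : False := by
  have key : ∀ {α β : ℂ}, (α ≠ 0 ∨ β ≠ 0) → ∀ i j, i ≠ j → α * z i + β * w i = 0 →
      α * z j + β * w j = 0 → False := by
    intro α β hn i j hij hi hj
    refine h i j hij ?_
    rcases hn with hn | hn
    · exact mul_left_cancel₀ hn (by linear_combination w j * hi - w i * hj)
    · exact mul_left_cancel₀ hn (by linear_combination z i * hj - z j * hi)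
  rcases hz 0 with a | a <;> rcases hz 1 with b | b <;> rcases hz 2 with c | c
  · exact key h1 0 1 (by decide) a b
  · exact key h1 0 1 (by decide) a b
  · exact key h1 0 2 (by decide) a c
  · exact key h2 1 2 (by decide) b c
  · exact key h1 1 2 (by decide) b c
  · exact key h2 0 2 (by decide) a c
  · exact key h2 0 1 (by decide) a b
  · exact key h2 0 1 (by decide) a b

/-- A quartic in canonical form with four distinct roots has `Ψ₀ ≠ 0` and `Ψ₀² ≠ 9 Ψ₂²`. -/
theorem canonical_nondegenerate {Ψ : Fin 5 → ℂ} (h1 : Ψ 1 = 0) (h3 : Ψ 3 = 0)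
    (h04 : Ψ 0 = Ψ 4) (h2 : Ψ 2 ≠ 0) {z w : Fin 4 → ℂ}
    (h : ∀ i j, i ≠ j → z i * w j ≠ z j * w i) (hr : ∀ i, weylQuartic Ψ (z i) (w i) = 0) :
    Ψ 0 ≠ 0 ∧ 9 * Ψ 2 ^ 2 - Ψ 0 ^ 2 ≠ 0 := by
  simp only [weylQuartic, h1, h3, ← h04] at hr
  have h0 : Ψ 0 ≠ 0 := by
    intro h0
    refine not_two_lines h (α := 1) (β := 0) (γ := 0) (δ := 1) (by simp) (by simp) fun i => ?_
    have := hr i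
    rw [h0] at this
    have h4 : Ψ 2 * (z i * w i) ^ 2 = 0 := by linear_combination (1 / 6) * this
    have h5 := pow_eq_zero_iff (two_ne_zero) |>.1 ((mul_eq_zero.1 h4).resolve_left h2)
    simpa using h5
  refine ⟨h0, fun hd => ?_⟩
  have hd' : (3 * Ψ 2 - Ψ 0) * (3 * Ψ 2 + Ψ 0) = 0 := by linear_combination hd
  -- the quartic is `Ψ₀ (z² - s² w²)²` with `s² = -1` or `s² = 1`
  have key : ∀ s : ℂ, 3 * Ψ 2 = -s ^ 2 * Ψ 0 → (s ^ 2) ^ 2 = 1 → False := by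
    intro s hs hs1
    refine not_two_lines h (α := 1) (β := -s) (γ := 1) (δ := s) (by simp) (by simp) fun i => ?_
    have h4 : Ψ 0 * ((z i - s * w i) * (z i + s * w i)) ^ 2 = 0 := by
      linear_combination hr i - 2 * z i ^ 2 * w i ^ 2 * hs + Ψ 0 * w i ^ 4 * hs1
    have h5 := pow_eq_zero_iff (two_ne_zero) |>.1 ((mul_eq_zero.1 h4).resolve_left h0)
    rcases mul_eq_zero.1 h5 with h6 | h6
    · left; linear_combination h6
    · right; linear_combination h6
  rcases mul_eq_zero.1 hd' with h4 | h4
  · exact key Complex.I (by rw [Complex.I_sq]; linear_combination h4) (by simp)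
  · exact key 1 (by linear_combination h4) (by simp)

end PetrovAlgebra

/-! ### Symmetries of the curvature tensor -/

section CurvatureSymmetries

variable {U : Set Pt} {g : ParamPt → CMat} {Γ : Fin 4 → ParamPt → CMat}

/-- Antisymmetry of `R_klij` in its first pair, from the symmetry of second derivatives of the
metric. -/
theorem lower_curv_antisymm (hU : IsOpen U) (hΓ : IsLeviCivitaOn U g Γ) {p : ParamPt}
    (hp : p ∈ cyl U) (i j : Fin 4) : (g p * curv Γ i j p)ᵀ = -(g p * curv Γ i j p) := by
  have hW := isOpen_cyl hU
  have dg := diffAt hW hΓ.smooth_g hp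
  have dΓ := fun i => diffAt hW (hΓ.smooth_conn i) hp
  have dΓT := fun i => diffAt hW (contDiffOn_transpose (hΓ.smooth_conn i)) hp
  have e : ∀ i j, sd i (sd j g) p = sd i g p * Γ j p + g p * sd i (Γ j) p
      + ((sd i (Γ j) p)ᵀ * g p + (Γ j p)ᵀ * sd i g p) := by
    intro i j
    rw [sd_congr hW (fun p hp => hΓ.compat p hp j) hp]
    refine (dd_add (dg.mul (dΓ j)) ((dΓT j).mul dg) _).trans ?_
    refine congrArg₂ (· + ·) (dd_mul dg (dΓ j) _) ((dd_mul (dΓT j) dg _).trans ?_)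
    exact congrArg₂ (· + ·) (congrArg (· * _) (dd_transpose (dΓ j) _)) rfl
  have h := sd_comm hW hΓ.smooth_g hp i j
  rw [e, e, hΓ.compat p hp, hΓ.compat p hp] at h
  have hs := hΓ.symm p hp
  rw [Matrix.transpose_mul, hs, eq_neg_iff_add_eq_zero, curv]
  simp only [Matrix.transpose_sub, Matrix.transpose_add, Matrix.transpose_mul, mul_sub, mul_add,
    sub_mul, add_mul, mul_assoc] at h ⊢
  rw [← sub_eq_zero] at h
  rw [← h]
  abel

theorem curv_swap (i j : Fin 4) (p : ParamPt) : curv Γ j i p = -curv Γ i j p := by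
  simp only [curv]; abel

theorem curv_bianchi (hU : IsOpen U) (hΓ : IsLeviCivitaOn U g Γ) {p : ParamPt}
    (hp : p ∈ cyl U) (s l i j : Fin 4) :
    curv Γ i j p s l + curv Γ j l p s i + curv Γ l i p s j = 0 := by
  have hW := isOpen_cyl hU
  have e : ∀ i j l, sd i (Γ j) p s l = sd i (Γ l) p s j := by
    intro i j l
    refine (dd_entry (diffAt hW (hΓ.smooth_conn j) hp) _ s l).symm.trans
      (Eq.trans ?_ (dd_entry (diffAt hW (hΓ.smooth_conn l) hp) _ s j))
    exact sd_congr hW (fun q hq => hΓ.torsion q hq j l s) hp i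
  have t : ∀ i j k, Γ i p k j = Γ j p k i := hΓ.torsion p hp
  simp only [curv, Matrix.sub_apply, Matrix.add_apply, Matrix.mul_apply]
  rw [e i j l, e j i l, e l i j]
  simp only [t j l, t i l, t i j]
  ring

end CurvatureSymmetries

section TetradSymmetries

variable {U : Set Pt} {g : MetricField} {T : Pt → Tetrad}

theorem isCurvatureTensor_tetradRiem (hU : IsOpen U) (hT : IsNPTetradOn U g T) {x : Pt}
    (hx : x ∈ U) : IsCurvatureTensor (tetradRiem g x (T x)) := by
  have hF := static_family hT
  have hΓ := hF.isLeviCivitaOn hU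
  have hp := mem_cyl hx 0
  have r : ∀ k l i j, ((riemann g x k l i j : ℝ) : ℂ) = _ := riemann_eq hU hF (t := 0) hx
  have s1 : ∀ k l i j, ((riemann g x k l i j : ℝ) : ℂ) = -(riemann g x l k i j : ℂ) := by
    intro k l i j
    rw [r, r]
    exact congrFun (congrFun (lower_curv_antisymm hU hΓ hp i j) l) k
  have s2 : ∀ k l i j, ((riemann g x k l i j : ℝ) : ℂ) = -(riemann g x k l j i : ℂ) := by
    intro k l i j
    rw [r, r, curv_swap j i, mul_neg, Matrix.neg_apply]
  have s3 : ∀ k l i j, (riemann g x k l i j : ℂ) + (riemann g x k i j l : ℂ)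
      + (riemann g x k j l i : ℂ) = 0 := by
    intro k l i j
    rw [r, r, r]
    simp only [Matrix.mul_apply, ← Finset.sum_add_distrib, ← mul_add, curv_bianchi hU hΓ hp,
      mul_zero, Finset.sum_const_zero]
  refine ⟨fun a b c d => ?_, fun a b c d => ?_, fun a b c d => ?_⟩
  · simp only [tetradRiem, contract, ← Finset.sum_neg_distrib]
    rw [Finset.sum_comm]
    refine Finset.sum_congr rfl fun l _ => Finset.sum_congr rfl fun k _ =>
      Finset.sum_congr rfl fun i _ => Finset.sum_congr rfl fun j _ => ?_
    rw [s1]; ring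
  · simp only [tetradRiem, contract, ← Finset.sum_neg_distrib]
    refine Finset.sum_congr rfl fun l _ => Finset.sum_congr rfl fun k _ => ?_
    rw [Finset.sum_comm]
    refine Finset.sum_congr rfl fun i _ => Finset.sum_congr rfl fun j _ => ?_
    rw [s2]; ring
  · have e1 : tetradRiem g x (T x) a c d b = ∑ k, ∑ l, ∑ i, ∑ j, (riemann g x k i j l : ℂ)
        * (T x).frame a k * (T x).frame c i * (T x).frame d j * (T x).frame b l := by
      unfold tetradRiem contract
      refine Finset.sum_congr rfl fun k _ => ?_
      conv_rhs => rw [Finset.sum_comm]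
      refine Finset.sum_congr rfl fun i _ => Finset.sum_comm
    have e2 : tetradRiem g x (T x) a d b c = ∑ k, ∑ l, ∑ i, ∑ j, (riemann g x k j l i : ℂ)
        * (T x).frame a k * (T x).frame d j * (T x).frame b l * (T x).frame c i := by
      unfold tetradRiem contract
      refine Finset.sum_congr rfl fun k _ => ?_
      rw [Finset.sum_comm]
      exact Finset.sum_congr rfl fun l _ => Finset.sum_comm
    rw [e1, e2]
    simp only [tetradRiem, contract, ← Finset.sum_add_distrib]
    refine Finset.sum_eq_zero fun k _ => Finset.sum_eq_zero fun l _ =>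
      Finset.sum_eq_zero fun i _ => Finset.sum_eq_zero fun j _ => ?_
    linear_combination (T x).frame a k * (T x).frame b l * (T x).frame c i * (T x).frame d j
      * s3 k l i j

end TetradSymmetries

/-! ### Invariance of the canonical tetrad -/

section CanonicalTetrad

variable {U : Set Pt} {g : MetricField} {T : Pt → Tetrad} {ξ : Pt → Fin 4 → ℝ} {φ : Pt → ℝ}

/-- On families that do not depend on the parameter, `∂_t - ξ^k ∂_k` is `-ξ^k ∂_k`. -/
theorem flowD_static {F : Type*} [NormedAddCommGroup F] [NormedSpace ℝ F] {f : Pt → F} {x : Pt}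
    (hf : DifferentiableAt ℝ f x) :
    flowD ξ (fun p : ParamPt => f p.2) x = -∑ s, ξ x s • pd s f x := by
  have h : HasFDerivAt (fun p : ParamPt => f p.2)
      ((fderiv ℝ f x).comp (ContinuousLinearMap.snd ℝ ℝ Pt)) (0, x) :=
    hf.hasFDerivAt.comp ((0 : ℝ), x) hasFDerivAt_snd
  have h1 : flowD ξ (fun p : ParamPt => f p.2) x = fderiv ℝ f x (-ξ x) :=
    (dd_of_hasFDerivAt h _).trans rfl
  rw [h1, map_neg, fderiv_vec]

theorem flowD_metM_static (hU : IsOpen U) (hT : IsNPTetradOn U g T) {x : Pt} (hx : x ∈ U)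
    (i j : Fin 4) : flowD ξ (metM fun _ => g) x i j
      = -∑ s, (ξ x s : ℂ) * ((pd s (fun y => g y i j) x : ℝ) : ℂ) := by
  have hd := diffAt hU (hT.smooth_g i j) hx
  refine ((dd_entry (diffAt (isOpen_cyl hU) (static_family hT).smooth_g (mem_cyl hx 0))
    (1, -ξ x) i j).symm.trans (flowD_static (ξ := ξ)
      (diffAt hU (contDiffOn_ofReal (hT.smooth_g i j)) hx))).trans ?_
  simp only [ofReal_pd hd, Complex.real_smul]

theorem flowD_frM_static (hU : IsOpen U) (hT : IsNPTetradOn U g T) {x : Pt} (hx : x ∈ U)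
    (i a : Fin 4) : flowD ξ (frM fun _ => T) x i a
      = -∑ s, (ξ x s : ℂ) * pd s (fun y => (T y).frame a i) x := by
  refine ((dd_entry (diffAt (isOpen_cyl hU) (static_family hT).smooth_e (mem_cyl hx 0))
    (1, -ξ x) i a).symm.trans (flowD_static (ξ := ξ)
      (diffAt hU (contDiffOn_frame hT a i) hx))).trans ?_
  simp only [Complex.real_smul]

theorem isConformalKilling_iff (hU : IsOpen U) (hT : IsNPTetradOn U g T) :
    IsConformalKilling U g ξ φ ↔ ∀ x ∈ U, flowD ξ (metM fun _ => g) x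
      = metM (fun _ => g) (0, x) * jac ξ x + (jac ξ x)ᵀ * metM (fun _ => g) (0, x)
        + (-(φ x : ℂ)) • metM (fun _ => g) (0, x) := by
  refine forall_congr' fun x => forall_congr' fun hx => ?_
  rw [← Matrix.ext_iff]
  refine forall_congr' fun i => forall_congr' fun j => ?_
  rw [flowD_metM_static hU hT hx, ← Complex.ofReal_inj]
  simp only [Matrix.add_apply, Matrix.mul_apply, Matrix.transpose_apply, Matrix.smul_apply, metM,
    Matrix.of_apply, jac, smul_eq_mul]
  push_cast
  simp only [Finset.sum_add_distrib]
  simp only [mul_comm (((pd i _ x : ℝ) : ℂ))]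
  constructor <;> intro h <;> linear_combination -h

theorem commutatorEqs_iff_flowD (hU : IsOpen U) (hT : IsNPTetradOn U g T)
    (hξ : ContDiffOn ℝ ∞ ξ U) :
    CommutatorEqs U T ξ φ ↔ ∀ x ∈ U, flowD ξ (frM fun _ => T) x
      = -(jac ξ x * frM (fun _ => T) (0, x)) + ((φ x : ℂ) / 2) • frM (fun _ => T) (0, x) := by
  rw [commutatorEqs_iff hU hξ]
  constructor
  · intro h x hx
    ext i a
    rw [flowD_frM_static hU hT hx]
    simp only [Matrix.add_apply, Matrix.neg_apply, Matrix.mul_apply, Matrix.smul_apply, frM,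
      Matrix.of_apply, smul_eq_mul]
    linear_combination h a i x hx
  · intro h a i x hx
    have := congrFun (congrFun (h x hx) i) a
    rw [flowD_frM_static hU hT hx] at this
    simp only [Matrix.add_apply, Matrix.neg_apply, Matrix.mul_apply, Matrix.smul_apply, frM,
      Matrix.of_apply, smul_eq_mul] at this
    linear_combination this

/-- The products of the frame vectors are constant. -/
theorem flowD_null {G E : ParamPt → CMat} (hU : IsOpen U) (hG : ContDiffOn ℝ ∞ G (cyl U))
    (hE : IsNullFrameOn U G E) {x : Pt} (hx : x ∈ U) :
    ((flowD ξ E x)ᵀ * G (0, x) + (E (0, x))ᵀ * flowD ξ G x) * E (0, x)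
      + (E (0, x))ᵀ * G (0, x) * flowD ξ E x = 0 := by
  have hW := isOpen_cyl hU
  have hp := mem_cyl hx 0
  have dE := diffAt hW hE.smooth hp
  have dET := diffAt hW (contDiffOn_transpose hE.smooth) hp
  have dG := diffAt hW hG hp
  have e1 : flowD ξ (fun p => (E p)ᵀ * G p * E p) x = 0 := by
    rw [flowD_congr hW hE.null hp]
    simp [flowD]
  rw [← e1]
  refine Eq.symm ((dd_mul (dET.mul dG) dE _).trans (congrArg₂ (· + ·) (congrArg (· * _) ?_) rfl))
  refine (dd_mul dET dG _).trans (congrArg₂ (· + ·) (congrArg (· * _) ?_) rfl)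
  exact dd_transpose dE _

theorem eq_zero_of_frame_components {G e Y : CMat} (hn : eᵀ * G * e = nullProducts)
    (h : eᵀ * Y * e = 0) : Y = 0 := by
  have h1 := inverse_of_null hn
  have h2 := mul_eq_one_comm.1 h1
  calc Y = (G * (e * nullProducts * eᵀ)) * Y * ((e * nullProducts * eᵀ) * G) := by
        rw [h1, h2, one_mul, mul_one]
    _ = (G * e * nullProducts) * (eᵀ * Y * e) * (nullProducts * eᵀ * G) := by
        simp only [mul_assoc]
    _ = 0 := by rw [h, mul_zero, zero_mul]

/-- The commutator equations imply the conformal Killing equation. -/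
theorem isConformalKilling_of_commutatorEqs (hU : IsOpen U) (hT : IsNPTetradOn U g T)
    (hξ : ContDiffOn ℝ ∞ ξ U) (hC : CommutatorEqs U T ξ φ) : IsConformalKilling U g ξ φ := by
  have hF := static_family hT
  rw [isConformalKilling_iff hU hT]
  intro x hx
  have h1 := flowD_null (ξ := ξ) hU hF.smooth_g hF.isNullFrameOn hx
  rw [(commutatorEqs_iff_flowD hU hT hξ).1 hC x hx] at h1
  rw [← sub_eq_zero]
  refine eq_zero_of_frame_components (hF.isNullFrameOn.null _ (mem_cyl hx 0)) (h1 ▸ ?_)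
  simp only [Matrix.transpose_add, Matrix.transpose_neg, Matrix.transpose_mul,
    Matrix.transpose_smul, mul_add, add_mul, mul_sub, sub_mul, neg_mul, mul_neg, Matrix.smul_mul,
    Matrix.mul_smul, mul_assoc, neg_smul]
  module

/-- The frame components of the derivative of a frame along `ξ`, Lie derivative terms removed. -/
def frameVar (ξ : Pt → Fin 4 → ℝ) (g : MetricField) (T : Pt → Tetrad) (x : Pt) : CMat :=
  (nullProducts * ((frM (fun _ => T) (0, x))ᵀ * metM (fun _ => g) (0, x)
    * (flowD ξ (frM fun _ => T) x + jac ξ x * frM (fun _ => T) (0, x))))ᵀ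

theorem flowD_frM_eq (hT : IsNPTetradOn U g T) {x : Pt} (hx : x ∈ U) :
    flowD ξ (frM fun _ => T) x = -(jac ξ x * frM (fun _ => T) (0, x))
      + frM (fun _ => T) (0, x) * (frameVar ξ g T x)ᵀ := by
  have h1 := inverse_of_null ((static_family hT).isNullFrameOn.null _ (mem_cyl hx 0))
  simp only [frameVar, Matrix.transpose_transpose, ← mul_assoc]
  rw [h1, one_mul]
  abel

theorem frameVar_null (hU : IsOpen U) (hT : IsNPTetradOn U g T) (hK : IsConformalKilling U g ξ φ)
    {x : Pt} (hx : x ∈ U) : frameVar ξ g T x * nullProducts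
      + nullProducts * (frameVar ξ g T x)ᵀ = (φ x : ℂ) • nullProducts := by
  have hF := static_family hT
  have h1 := flowD_null (ξ := ξ) hU hF.smooth_g hF.isNullFrameOn hx
  have hn := hF.isNullFrameOn.null _ (mem_cyl hx 0)
  rw [flowD_frM_eq hT hx, (isConformalKilling_iff hU hT).1 hK x hx] at h1
  rw [← hn, ← sub_eq_zero, ← h1]
  simp only [Matrix.transpose_add, Matrix.transpose_neg, Matrix.transpose_mul,
    Matrix.transpose_transpose, mul_add, add_mul, neg_mul, mul_neg, Matrix.smul_mul,
    Matrix.mul_smul, mul_assoc, neg_smul]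
  module

theorem isConformalRotation_of_null {M : CMat} {c : ℂ}
    (h : M * nullProducts + nullProducts * Mᵀ = c • nullProducts) : IsConformalRotation M c := by
  obtain ⟨n00, n01, n02, n03, n10, n11, n12, n13, n20, n21, n22, n23, n30, n31, n32, n33⟩ :=
    nullProducts_entries
  have e : ∀ a b, (∑ k, M a k * nullProducts k b) + ∑ k, nullProducts a k * M b k
      = c * nullProducts a b := fun a b => congrFun (congrFun h a) b
  simp only [Fin.sum_univ_four] at e
  have e00 := e 0 0
  have e01 := e 0 1
  have e02 := e 0 2
  have e03 := e 0 3
  have e11 := e 1 1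
  have e12 := e 1 2
  have e13 := e 1 3
  have e22 := e 2 2
  have e23 := e 2 3
  have e33 := e 3 3
  simp only [n00, n01, n02, n03, n10, n11, n12, n13, n20, n21, n22, n23, n30, n31, n32, n33]
    at e00 e01 e02 e03 e11 e12 e13 e22 e23 e33
  exact
    { h01 := by linear_combination (1 / 2) * e00
      h10 := by linear_combination (1 / 2) * e11
      h23 := by linear_combination (-1 / 2) * e22
      h32 := by linear_combination (-1 / 2) * e33
      h11 := by linear_combination e01
      h33 := by linear_combination -e23
      h20 := by linear_combination e12
      h30 := by linear_combination e13
      h21 := by linear_combination e02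
      h31 := by linear_combination e03 }

/-- The permutation of the null frame by complex conjugation. -/
def conjIdx : Fin 4 → Fin 4 := ![0, 1, 3, 2]

theorem conj_frame (t : Tetrad) (a i : Fin 4) : conj (t.frame a i) = t.frame (conjIdx a) i := by
  fin_cases a <;> simp [Tetrad.frame, conjIdx]

/-- The infinitesimal rotation is real: `l` and `n` are real, and `m`, `m̄` are conjugate. -/
theorem conj_frameVar (hU : IsOpen U) (hT : IsNPTetradOn U g T) {x : Pt} (hx : x ∈ U)
    (a b : Fin 4) :
    conj (frameVar ξ g T x a b) = frameVar ξ g T x (conjIdx a) (conjIdx b) := by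
  have hv : ∀ i a, conj ((flowD ξ (frM fun _ => T) x + jac ξ x * frM (fun _ => T) (0, x)) i a)
      = (flowD ξ (frM fun _ => T) x + jac ξ x * frM (fun _ => T) (0, x)) i (conjIdx a) := by
    intro i a
    have hd : ∀ s, conj (pd s (fun y => (T y).frame a i) x)
        = pd s (fun y => (T y).frame (conjIdx a) i) x := by
      intro s
      simp only [← conj_frame]
      exact (dd_clm_comp (Complex.conjCLE : ℂ →L[ℝ] ℂ)
        (diffAt hU (contDiffOn_frame hT a i) hx) _).symm
    simp only [Matrix.add_apply, Matrix.mul_apply, flowD_frM_static hU hT hx, map_add, map_neg,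
      map_sum, map_mul, hd, Complex.conj_ofReal, jac, frM, Matrix.of_apply, conj_frame]
  have hq : ∀ c a, conj (((frM (fun _ => T) (0, x))ᵀ * metM (fun _ => g) (0, x)
        * (flowD ξ (frM fun _ => T) x + jac ξ x * frM (fun _ => T) (0, x))) c a)
      = ((frM (fun _ => T) (0, x))ᵀ * metM (fun _ => g) (0, x)
        * (flowD ξ (frM fun _ => T) x + jac ξ x * frM (fun _ => T) (0, x))) (conjIdx c)
          (conjIdx a) := by
    intro c a
    rw [Matrix.mul_apply, Matrix.mul_apply]
    simp only [map_sum, map_mul, hv]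
    simp only [Matrix.mul_apply, map_sum, map_mul, Matrix.transpose_apply, frM, metM,
      Matrix.of_apply, conj_frame, Complex.conj_ofReal]
  obtain ⟨Q, hQ, hM⟩ : ∃ Q : Fin 4 → Fin 4 → ℂ,
      (∀ c a, conj (Q c a) = Q (conjIdx c) (conjIdx a)) ∧
        ∀ a b, frameVar ξ g T x a b = ∑ c, nullProducts b c * Q c a := by
    refine ⟨_, hq, fun a b => ?_⟩
    rw [frameVar, Matrix.transpose_apply, Matrix.mul_apply]
  obtain ⟨n00, n01, n02, n03, n10, n11, n12, n13, n20, n21, n22, n23, n30, n31, n32, n33⟩ :=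
    nullProducts_entries
  have s0 : conjIdx 0 = 0 := rfl
  have s1 : conjIdx 1 = 1 := rfl
  have s2 : conjIdx 2 = 3 := rfl
  have s3 : conjIdx 3 = 2 := rfl
  rw [hM, hM]
  simp only [Fin.sum_univ_four]
  fin_cases b <;> simp [n00, n01, n02, n03, n10, n11, n12, n13, n20, n21, n22, n23, n30, n31,
    n32, n33, s0, s1, s2, s3, hQ]

/-- The tetrad components of the curvature, as frame components of a constant family. -/
theorem tetradRiem_eq (hU : IsOpen U) (hT : IsNPTetradOn U g T) {p : ParamPt} (hp : p ∈ cyl U)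
    (a b c d : Fin 4) : tetradRiem g p.2 (T p.2) a b c d
      = riemFrame (metM fun _ => g) (chrM fun _ => g) (frM fun _ => T) c d p a b :=
  contract_riemann_eq hU (static_family hT) hp.2 a b c d

theorem hessian_symm {G : ParamPt → CMat} {Γ : Fin 4 → ParamPt → CMat} {h : Pt → ℂ}
    (hU : IsOpen U) (hΓ : IsLeviCivitaOn U G Γ) (hh : ContDiffOn ℝ ∞ h U) {x : Pt} (hx : x ∈ U)
    (i j : Fin 4) : hessian Γ h x i j = hessian Γ h x j i := by
  simp only [hessian]
  rw [pd_comm hU hh hx]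
  simp only [hΓ.torsion _ (mem_cyl hx 0) i j]

/-- Relative to a conformal Killing vector, the Weyl scalars vary by the infinitesimal rotation
of the tetrad only. -/
theorem flowD_framePsi (hU : IsOpen U) (hT : IsNPTetradOn U g T) (hξ : ContDiffOn ℝ ∞ ξ U)
    (hφ : ContDiffOn ℝ ∞ φ U) (hK : IsConformalKilling U g ξ φ) {x : Pt} (hx : x ∈ U) :
    ∃ H : Fin 4 → Fin 4 → ℂ, (∀ a b, H a b = H b a) ∧ ∀ k,
      flowD ξ (fun p => framePsi (tetradRiem g p.2 (T p.2)) k) x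
        = framePsi (varTensor (frameVar ξ g T x) (φ x) H (tetradRiem g x (T x))) k := by
  have hF := static_family hT
  have hΓ := hF.isLeviCivitaOn hU
  have hN := hF.isNullFrameOn
  have hW := isOpen_cyl hU
  have hp := mem_cyl hx 0
  have hh : ContDiffOn ℝ ∞ (fun y => -(φ y : ℂ)) U := (contDiffOn_ofReal hφ).neg
  set Hs : CMat := (frM (fun _ => T) (0, x))ᵀ
    * Matrix.of (hessian (chrM fun _ => g) (fun y => -(φ y : ℂ)) x) * frM (fun _ => T) (0, x)
    with hHs
  refine ⟨fun a b => Hs a b, fun a b => ?_, fun k => ?_⟩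
  · have : Hsᵀ = Hs := by
      have h1 : (Matrix.of (hessian (chrM fun _ => g) (fun y => -(φ y : ℂ)) x) : CMat)ᵀ
          = Matrix.of (hessian (chrM fun _ => g) (fun y => -(φ y : ℂ)) x) := by
        ext i j
        exact hessian_symm hU hΓ hh hx j i
      rw [hHs, Matrix.transpose_mul, Matrix.transpose_mul, h1, Matrix.transpose_transpose,
        mul_assoc]
    exact congrFun (congrFun this b) a
  · have hc : ∀ a b c d, ContDiffOn ℝ ∞ (fun p : ParamPt => tetradRiem g p.2 (T p.2) a b c d)
        (cyl U) := fun a b c d => (contDiffOn_entry (contDiffOn_riemFrame hU hΓ hN c d) a b).congr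
      fun p hp => tetradRiem_eq hU hT hp a b c d
    have hd : DifferentiableAt ℝ (fun p : ParamPt => tetradRiem g p.2 (T p.2)) (0, x) :=
      diffAt hW (contDiffOn_pi.2 fun a => contDiffOn_pi.2 fun b => contDiffOn_pi.2 fun c =>
        contDiffOn_pi.2 fun d => hc a b c d) hp
    refine (dd_clm_comp (framePsiCLM k) hd (1, -ξ x)).trans ?_
    refine congrArg (fun R => framePsi R k) ?_
    funext a b c d
    have e1 : dd (fun p : ParamPt => tetradRiem g p.2 (T p.2)) (0, x) (1, -ξ x) a b c d
        = flowD ξ (fun p : ParamPt => tetradRiem g p.2 (T p.2) a b c d) x :=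
      (dd_clm_comp ((ContinuousLinearMap.proj (R := ℝ) (φ := fun _ : Fin 4 => ℂ) d).comp
        ((ContinuousLinearMap.proj (R := ℝ) (φ := fun _ : Fin 4 => Fin 4 → ℂ) c).comp
        ((ContinuousLinearMap.proj (R := ℝ) (φ := fun _ : Fin 4 => Fin 4 → Fin 4 → ℂ) b).comp
        (ContinuousLinearMap.proj (R := ℝ)
          (φ := fun _ : Fin 4 => Fin 4 → Fin 4 → Fin 4 → ℂ) a)))) hd (1, -ξ x)).symm
    have e2 := flowD_riemFrame (h := fun y => -(φ y : ℂ)) (M := frameVar ξ g T) hU hΓ hN hξ hh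
      ((isConformalKilling_iff hU hT).1 hK) (fun x hx => flowD_frM_eq hT hx) hx c d
    rw [← hHs] at e2
    have e3 : flowD ξ (fun p : ParamPt => tetradRiem g p.2 (T p.2) a b c d) x
        = flowD ξ (riemFrame (metM fun _ => g) (chrM fun _ => g) (frM fun _ => T) c d) x a b :=
      (flowD_congr hW (fun p hp => tetradRiem_eq hU hT hp a b c d) hp ξ).trans
        (dd_entry (diffAt hW (contDiffOn_riemFrame hU hΓ hN c d) hp) _ a b)
    have e4 : ∀ a b c d, riemFrame (metM fun _ => g) (chrM fun _ => g) (frM fun _ => T) c d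
        (0, x) a b = tetradRiem g x (T x) a b c d := fun a b c d =>
      (tetradRiem_eq hU hT hp a b c d).symm
    refine e1.trans (e3.trans ((congrFun (congrFun e2 a) b).trans ?_))
    simp only [Matrix.add_apply, Matrix.mul_apply, Matrix.sum_apply, Matrix.smul_apply,
      Matrix.transpose_apply, Matrix.of_apply, smul_eq_mul, e4, varTensor]
    simp only [mul_comm (tetradRiem g x (T x) _ _ _ _)]
    ring

/-- A conformal Killing vector preserves the canonical tetrad up to the conformal factor. -/
theorem commutatorEqs_of_isConformalKilling (hU : IsOpen U) (hT : IsNPTetradOn U g T)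
    (hI : ∀ x ∈ U, IsPetrovI g x) (hcan : ∀ x ∈ U, IsCanonicalI g x (T x))
    (hξ : ContDiffOn ℝ ∞ ξ U) (hφ : ContDiffOn ℝ ∞ φ U) (hK : IsConformalKilling U g ξ φ) :
    CommutatorEqs U T ξ φ := by
  rw [commutatorEqs_iff_flowD hU hT hξ]
  intro x hx
  have hW := isOpen_cyl hU
  have hp := mem_cyl hx 0
  have hM := isConformalRotation_of_null (frameVar_null hU hT hK hx)
  obtain ⟨H, hH, hL⟩ := flowD_framePsi hU hT hξ hφ hK hx
  obtain ⟨v0, v1, v3, v4⟩ := framePsi_varTensor (isCurvatureTensor_tetradRiem hU hT hx) hM hH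
  have hΨ : ∀ y ∈ U, weylScalar g y (T y) = framePsi (tetradRiem g y (T y)) := fun y hy =>
    weylScalar_eq (hT.null y hy)
  obtain ⟨c1, c3, c04, c2⟩ := hcan x hx
  obtain ⟨-, z, w, hzw, hr⟩ := hI x hx (T x) (hT.null x hx)
  obtain ⟨n0, n2⟩ := canonical_nondegenerate c1 c3 c04 c2 hzw hr
  rw [hΨ x hx] at c1 c3 c04 c2 n0 n2
  -- the canonical form holds at all points, so it can be differentiated
  have z1 : flowD ξ (fun p => framePsi (tetradRiem g p.2 (T p.2)) 1) x = 0 := by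
    rw [flowD_congr hW (g := fun _ => 0) (fun p hp => ?_) hp]
    · simp [flowD]
    · rw [← hΨ p.2 hp.2]; exact (hcan p.2 hp.2).1
  have z3 : flowD ξ (fun p => framePsi (tetradRiem g p.2 (T p.2)) 3) x = 0 := by
    rw [flowD_congr hW (g := fun _ => 0) (fun p hp => ?_) hp]
    · simp [flowD]
    · rw [← hΨ p.2 hp.2]; exact (hcan p.2 hp.2).2.1
  have z04 : flowD ξ (fun p => framePsi (tetradRiem g p.2 (T p.2)) 0) x
      = flowD ξ (fun p => framePsi (tetradRiem g p.2 (T p.2)) 4) x := by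
    refine flowD_congr hW (fun p hp => ?_) hp ξ
    rw [← hΨ p.2 hp.2]; exact (hcan p.2 hp.2).2.2.1
  have k := conj_frameVar (ξ := ξ) hU hT hx
  rw [hL, v1, c1] at z1
  rw [hL, v3, c3, ← c04] at z3
  rw [hL, hL, v0, v4, c1, c3, ← c04, hM.h11, hM.h33] at z04
  rw [flowD_frM_eq hT hx]
  generalize frameVar ξ g T x = M at *
  -- the variations of `Ψ₁` and `Ψ₃` are a linear system in `M 0 3`, `M 1 2` of determinant
  -- `9 Ψ₂² - Ψ₀²`
  have m03 : M 0 3 = 0 := by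
    refine (mul_eq_zero.1 ?_).resolve_right n2
    linear_combination 3 * framePsi (tetradRiem g x (T x)) 2 * z1
      - framePsi (tetradRiem g x (T x)) 0 * z3
  have m12 : M 1 2 = 0 := by
    refine (mul_eq_zero.1 ?_).resolve_right n2
    linear_combination 3 * framePsi (tetradRiem g x (T x)) 2 * z3
      - framePsi (tetradRiem g x (T x)) 0 * z1
  have msum : M 0 0 + M 2 2 = φ x := by
    have := mul_left_cancel₀ n0 (a := framePsi (tetradRiem g x (T x)) 0)
      (b := M 0 0 + M 2 2) (c := φ x) (by linear_combination (1 / 4) * z04)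
    exact this
  -- the remaining entries are determined by reality
  have k00 : conj (M 0 0) = M 0 0 := k 0 0
  have k22 : conj (M 2 2) = M 3 3 := k 2 2
  have k03 : conj (M 0 3) = M 0 2 := k 0 3
  have k12 : conj (M 1 2) = M 1 3 := k 1 2
  rw [m03, map_zero] at k03
  rw [m12, map_zero] at k12
  have msum' := congrArg conj msum
  rw [map_add, k00, k22, Complex.conj_ofReal, hM.h33] at msum'
  have m00 : M 0 0 = (φ x : ℂ) / 2 := by linear_combination (1 / 2) * (msum + msum')
  have m22 : M 2 2 = (φ x : ℂ) / 2 := by linear_combination (1 / 2) * (msum - msum')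
  have m11 : M 1 1 = (φ x : ℂ) / 2 := by rw [hM.h11, m00]; ring
  have m33 : M 3 3 = (φ x : ℂ) / 2 := by rw [hM.h33, m22]; ring
  have hMeq : Mᵀ = ((φ x : ℂ) / 2) • (1 : CMat) := by
    ext a b
    fin_cases a <;> fin_cases b <;>
    simp [hM.h01, hM.h10, hM.h23, hM.h32, hM.h20, hM.h30, hM.h21, hM.h31, m03, m12, ← k03, ← k12,
      m00, m11, m22, m33]
  rw [hMeq, Matrix.mul_smul, mul_one]

end CanonicalTetrad

/-! ### Weights under constant rescalings -/

section ConstantRescaling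

theorem pd_const_smul {F : Type*} [NormedAddCommGroup F] [NormedSpace ℝ F] (r : ℝ) (f : Pt → F)
    (i : Fin 4) (x : Pt) : pd i (fun y => r • f y) x = r • pd i f x := by
  change fderiv ℝ (r • f) x (Pi.single i 1) = _
  rw [fderiv_const_smul_field]
  rfl

theorem pd_const_mul_real (r : ℝ) (f : Pt → ℝ) (i : Fin 4) (x : Pt) :
    pd i (fun y => r * f y) x = r * pd i f x := pd_const_smul r f i x

theorem pd_const_mul_complex (r : ℝ) (f : Pt → ℂ) (i : Fin 4) (x : Pt) :
    pd i (fun y => (r : ℂ) * f y) x = r * pd i f x := by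
  simpa using pd_const_smul r f i x

/-- Both sides are the junk value `0` for singular `M`. -/
theorem inv_smul_matrix {r : ℝ} (hr : r ≠ 0) (M : Matrix (Fin 4) (Fin 4) ℝ) :
    (r • M)⁻¹ = r⁻¹ • M⁻¹ := by
  by_cases h : IsUnit M.det
  · exact Matrix.inv_smul' M (Units.mk0 r hr) h
  · have h' : ¬ IsUnit (r • M).det := by
      simpa [Matrix.det_smul, hr] using h
    rw [Matrix.nonsing_inv_apply_not_isUnit _ h, Matrix.nonsing_inv_apply_not_isUnit _ h',
      smul_zero]

variable {c : ℝ}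

theorem christoffel_rescale (hc : c ≠ 0) (g : MetricField) (k i j : Fin 4) :
    christoffel (rescaleMetric (fun _ => c) g) k i j = christoffel g k i j := by
  funext x
  have hp : ∀ i a b, pd i (fun y => rescaleMetric (fun _ => c) g y a b) x
      = c ^ 2 * pd i (fun y => g y a b) x := fun i a b => pd_const_mul_real (c ^ 2) _ i x
  have hi : (rescaleMetric (fun _ => c) g x)⁻¹ = (c ^ 2)⁻¹ • (g x)⁻¹ :=
    inv_smul_matrix (pow_ne_zero 2 hc) _
  simp only [christoffel, hp, hi, Matrix.smul_apply, smul_eq_mul]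
  congr 1
  refine Finset.sum_congr rfl fun s _ => ?_
  field_simp

theorem riemann_rescale (hc : c ≠ 0) (g : MetricField) (x : Pt) (k l i j : Fin 4) :
    riemann (rescaleMetric (fun _ => c) g) x k l i j = c ^ 2 * riemann g x k l i j := by
  have h : ∀ s, riemannUp (rescaleMetric (fun _ => c) g) s l i j x = riemannUp g s l i j x := by
    intro s
    simp only [riemannUp, christoffel_rescale hc]
  simp only [riemann, h, rescaleMetric, Matrix.smul_apply, smul_eq_mul, Finset.mul_sum, mul_assoc]

theorem rotCoef_rescale (hc : c ≠ 0) (g : MetricField) (T : Pt → Tetrad) (a b d : Fin 4) (x : Pt) :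
    rotCoef (rescaleMetric (fun _ => c) g) (rescaleTetrad (fun _ => c) T) a b d x
      = ((c⁻¹ : ℝ) : ℂ) * rotCoef g T a b d x := by
  have hc' : (c : ℂ) ≠ 0 := by exact_mod_cast hc
  simp only [rotCoef, christoffel_rescale hc, rescaleTetrad_frame, pd_const_mul_complex,
    Finset.mul_sum]
  refine Finset.sum_congr rfl fun i _ => Finset.sum_congr rfl fun k _ =>
    Finset.sum_congr rfl fun j _ => ?_
  have e : ∑ s, (christoffel g k j s x : ℂ) * (((c⁻¹ : ℝ) : ℂ) * (T x).frame a s)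
      = ((c⁻¹ : ℝ) : ℂ) * ∑ s, (christoffel g k j s x : ℂ) * (T x).frame a s := by
    rw [Finset.mul_sum]
    exact Finset.sum_congr rfl fun s _ => by ring
  rw [e]
  simp only [rescaleMetric, Matrix.smul_apply, smul_eq_mul]
  push_cast
  field_simp

theorem npD_rescale (T : Pt → Tetrad) (a : Fin 4) (r : ℝ) (f : Pt → ℂ) (x : Pt) :
    npD (rescaleTetrad (fun _ => c) T) a (fun y => (r : ℂ) * f y) x
      = ((c⁻¹ * r : ℝ) : ℂ) * npD T a f x := by
  simp only [npD, dirD, rescaleTetrad_frame, pd_const_mul_complex, Finset.mul_sum]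
  refine Finset.sum_congr rfl fun i _ => ?_
  push_cast
  ring

theorem eval_iterDer_rescale {g : MetricField} {T : Pt → Tetrad} {E : NPExpr} {r : ℝ}
    (h : ∀ x, E.eval (rescaleMetric (fun _ => c) g) (rescaleTetrad (fun _ => c) T) x
      = (r : ℂ) * E.eval g T x) (as : List (Fin 4)) (x : Pt) :
    (NPExpr.iterDer as E).eval (rescaleMetric (fun _ => c) g) (rescaleTetrad (fun _ => c) T) x
      = (((c⁻¹) ^ as.length * r : ℝ) : ℂ) * (NPExpr.iterDer as E).eval g T x := by
  induction as generalizing x with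
  | nil => simpa [NPExpr.iterDer] using h x
  | cons a as ih =>
    have h1 : (NPExpr.iterDer as E).eval (rescaleMetric (fun _ => c) g)
        (rescaleTetrad (fun _ => c) T) = _ := funext ih
    change npD (rescaleTetrad (fun _ => c) T) a ((NPExpr.iterDer as E).eval
      (rescaleMetric (fun _ => c) g) (rescaleTetrad (fun _ => c) T)) x = _
    rw [h1, npD_rescale, List.length_cons, pow_succ', mul_assoc]
    rfl

theorem eval_spin_rescale (hc : c ≠ 0) (g : MetricField) (T : Pt → Tetrad) (s : SpinCoef) (x : Pt) :
    (NPExpr.spin s).eval (rescaleMetric (fun _ => c) g) (rescaleTetrad (fun _ => c) T) x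
      = ((c⁻¹ : ℝ) : ℂ) * (NPExpr.spin s).eval g T x := by
  obtain ⟨u, v, c₁, a₁, b₁, c₂, a₂, b₂, h⟩ := s.val_eq
  simp only [NPExpr.eval, h, rotCoef_rescale hc]
  ring

theorem eval_riem_rescale (hc : c ≠ 0) (g : MetricField) (T : Pt → Tetrad) (p q r s : Fin 4)
    (x : Pt) :
    (NPExpr.riem p q r s).eval (rescaleMetric (fun _ => c) g) (rescaleTetrad (fun _ => c) T) x
      = (((c⁻¹) ^ 2 : ℝ) : ℂ) * (NPExpr.riem p q r s).eval g T x := by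
  have hc' : (c : ℂ) ≠ 0 := by exact_mod_cast hc
  simp only [NPExpr.eval, contract, rescaleTetrad_frame, Finset.mul_sum, riemann_rescale hc]
  refine Finset.sum_congr rfl fun i _ => Finset.sum_congr rfl fun k _ =>
    Finset.sum_congr rfl fun j _ => Finset.sum_congr rfl fun l _ => ?_
  push_cast
  field_simp

theorem hasHomotheticWeight_iterDer {U : Set Pt} {g : MetricField} {T : Pt → Tetrad} {E : NPExpr}
    {n : ℕ} (h : ∀ c : ℝ, c ≠ 0 → ∀ x, E.eval (rescaleMetric (fun _ => c) g)
      (rescaleTetrad (fun _ => c) T) x = (((c⁻¹) ^ n : ℝ) : ℂ) * E.eval g T x)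
    (as : List (Fin 4)) :
    (NPExpr.iterDer as E).HasHomotheticWeight U g T (-n - as.length) := by
  intro c hc x _ _
  rw [eval_iterDer_rescale (h c hc.ne') as x, ← pow_add]
  congr 2
  rw [show (-(n : ℝ) - as.length) = -((as.length + n : ℕ) : ℝ) by push_cast; ring,
    Real.rpow_neg hc.le, Real.rpow_natCast, inv_pow]

theorem domain_iterDer {U : Set Pt} {g : MetricField} {T : Pt → Tetrad} {E : NPExpr}
    (h : ∀ x, E.DefinedAt g T x) (as : List (Fin 4)) :
    (NPExpr.iterDer as E).domain U g T = U := by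
  have : ∀ x, (NPExpr.iterDer as E).DefinedAt g T x := by
    intro x
    induction as with
    | nil => exact h x
    | cons a as ih => exact ih
  exact Set.ext fun x => ⟨fun hx => hx.1, fun hx => ⟨hx, this x⟩⟩

end ConstantRescaling

end NewmanPenrose

end

open NewmanPenrose in
theorem theorem16 (U : Set Pt) (hU : IsOpen U) (g : MetricField) (T : Pt → Tetrad)
    (hT : IsNPTetradOn U g T) (hI : ∀ x ∈ U, IsPetrovI g x)
    (hcan : ∀ x ∈ U, IsCanonicalI g x (T x)) :
    -- the solutions of the NP-Lie commutator equations for the coordinates are exactly the (C)KVs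
    (∀ (ξ : Pt → Fin 4 → ℝ) (φ : Pt → ℝ), ContDiffOn ℝ ∞ ξ U → ContDiffOn ℝ ∞ φ U →
      (IsConformalKilling U g ξ φ ↔
        ∀ a i : Fin 4, ∀ x ∈ U,
          npD T a (lieD ξ (coord i)) x - lieD ξ (npD T a (coord i)) x
            = (φ x : ℂ) / 2 * npD T a (coord i) x)) ∧
    -- (a) properly conformally weighted combinations, relative to each (C)KV
    (∀ (ξ : Pt → Fin 4 → ℝ) (φ : Pt → ℝ), ContDiffOn ℝ ∞ ξ U → ContDiffOn ℝ ∞ φ U →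
      IsConformalKilling U g ξ φ →
      ∀ (E : NPExpr) (w : ℝ), E.HasConformalWeight U g T w →
        LieRecurrentOn (E.domain U g T) ξ φ w (E.eval g T)) ∧
    -- (b) all combinations, relative to each KV
    (∀ ξ : Pt → Fin 4 → ℝ, ContDiffOn ℝ ∞ ξ U → IsConformalKilling U g ξ (fun _ => 0) →
      ∀ E : NPExpr, ∀ x ∈ E.domain U g T, lieD ξ (E.eval g T) x = 0) ∧
    -- (b) all homogeneous combinations, relative to each HV; among these are all spin
    -- coefficients, all Riemann tensor tetrad components, and all their repeated NP derivatives
    (∀ (ξ : Pt → Fin 4 → ℝ) (c : ℝ), ContDiffOn ℝ ∞ ξ U →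
      IsConformalKilling U g ξ (fun _ => c) →
      (∀ (E : NPExpr) (w : ℝ), E.HasHomotheticWeight U g T w →
        LieRecurrentOn (E.domain U g T) ξ (fun _ => c) w (E.eval g T)) ∧
      (∀ (as : List (Fin 4)) (s : SpinCoef),
        LieRecurrentOn U ξ (fun _ => c) (-1 - as.length)
          ((NPExpr.iterDer as (NPExpr.spin s)).eval g T)) ∧
      (∀ (as : List (Fin 4)) (p q r s : Fin 4),
        LieRecurrentOn U ξ (fun _ => c) (-2 - as.length)
          ((NPExpr.iterDer as (NPExpr.riem p q r s)).eval g T))) := by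
  have key : ∀ (ξ : Pt → Fin 4 → ℝ) (φ : Pt → ℝ), ContDiffOn ℝ ∞ ξ U → ContDiffOn ℝ ∞ φ U →
      IsConformalKilling U g ξ φ → ∀ (E : NPExpr) (w : ℝ),
      (∀ t, E.ScalesWith U g T w (confFactor φ t)) →
        LieRecurrentOn (E.domain U g T) ξ φ w (E.eval g T) := fun ξ φ hξ hφ hK E w hE =>
    lieRecurrentOn_of_scalesWith hU hT hφ hξ hK
      (commutatorEqs_of_isConformalKilling hU hT hI hcan hξ hφ hK) hE
  have hom : ∀ (ξ : Pt → Fin 4 → ℝ) (c : ℝ), ContDiffOn ℝ ∞ ξ U →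
      IsConformalKilling U g ξ (fun _ => c) → ∀ (E : NPExpr) (w : ℝ),
      E.HasHomotheticWeight U g T w →
        LieRecurrentOn (E.domain U g T) ξ (fun _ => c) w (E.eval g T) := fun ξ c hξ hK E w hE =>
    key ξ _ hξ contDiffOn_const hK E w fun t => hE _ (Real.exp_pos _)
  refine ⟨fun ξ φ hξ hφ => ⟨commutatorEqs_of_isConformalKilling hU hT hI hcan hξ hφ,
    isConformalKilling_of_commutatorEqs hU hT hξ⟩, ?_, ?_, ?_⟩
  · intro ξ φ hξ hφ hK E w hE
    refine key ξ φ hξ hφ hK E w fun t => hE _ ?_ fun x _ => confFactor_pos φ t x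
    exact (contDiffOn_const.mul (hφ.div_const 2)).exp
  · intro ξ hξ hK E x hx
    -- for `φ = 0` the conformal factor is `1`, and every expression has weight `0`
    have h := key ξ _ hξ contDiffOn_const hK E 0 (fun t y _ _ => by
      have : confFactor (fun _ => 0) t = fun _ => 1 := by funext y; simp [confFactor]
      rw [this, rescaleMetric_one, rescaleTetrad_one]
      simp) x hx
    simpa using h
  · intro ξ c hξ hK
    refine ⟨hom ξ c hξ hK, fun as s => ?_, fun as p q r s => ?_⟩
    · have hw := hasHomotheticWeight_iterDer (U := U) (n := 1) (E := NPExpr.spin s)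
        (fun c hc x => by simpa using eval_spin_rescale hc g T s x) as
      have h := hom ξ c hξ hK _ _ hw
      rw [domain_iterDer (E := NPExpr.spin s) fun _ => trivial] at h
      simpa using h
    · have hw := hasHomotheticWeight_iterDer (U := U) (n := 2) (E := NPExpr.riem p q r s)
        (fun c hc x => eval_riem_rescale hc g T p q r s x) as
      have h := hom ξ c hξ hK _ _ hw
      rw [domain_iterDer (E := NPExpr.riem p q r s) fun _ => trivial] at h
      simpa using h
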